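/- Let $\mathbb F$ be an arbitrary field, $n\ge 1$, let $G$ be the free group on $\alpha_1,\dots,\alpha_{n-1}$, and let $*:G\to G$ be the anti-automorphism with $\alpha_i^*=\alpha_{n-i}$. Let $\mathrm{UT}_n$ be the algebra of upper triangular $n\times n$ matrices over $\mathbb F$, with the elementary $G$-grading $\eta$ given by $\deg e_{ij}=\alpha_i\alpha_{i+1}\cdots\alpha_{j-1}$ for $i\le j$; $\operatorname{Supp}\eta$ denotes its support. Let $*$ be an $\mathbb F$-linear involution of $\mathrm{UT}_n$ that maps the component of degree $g$ into the component of degree $g^*$, for all $g\in G$. Assume that $*$ is either orthogonal, that is, equivalent under an $\mathbb F$-algebra automorphism of $\mathrm{UT}_n$ to the reflection $\tau:e_{ij}\mapsto e_{n+1-j,\,n+1-i}$ (then put $\varepsilon_*=1$), or symplectic, that is, $n=2m$ and $*$ is equivalent to $A\mapsto DA^\tau D^{-1}$ with $D=\operatorname{diag}(I_m,-I_m)$ (then put $\varepsilon_*=-1$). Let $\mathbb F\langle X^G,*\rangle$ be the free associative (non-unital) $G$-graded algebra with involution on variables $x_i^{(g)}$ ($g\in G$, $i\in\mathbb N$): its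 monomials are the nonempty words in the letters $x_i^{(g)}$, of degree $g$, and $x_i^{(g)*}$, of degree $g^*$, and its involution reverses words and exchanges $x_i^{(g)}$ with $x_i^{(g)*}$. Let $\mathrm{Id}=\mathrm{Id}_{G,*}(\mathrm{UT}_n,\eta,*)$ be the set of its elements that vanish under all substitutions of the variables $x_i^{(g)}$ by elements of degree $g$ of $\mathrm{UT}_n$. A $T_{G,*}$-ideal is a two-sided ideal of $\mathbb F\langle X^G,*\rangle$ that is stable under $*$ and under all degree-preserving endomorphisms commuting with $*$. Call $g\in G$ symmetric if $g=\deg e_{ij}$ for some $i<j$ with $i+j=n+1$. **(1)** $\mathrm{Id}$ is the $T_{G,*}$-ideal $I$ generated by the following polynomials: 1. $x^{(g)}$ for $g\notin\operatorname{Supp}\eta$; 2. $x^{(g)*}-\varepsilon_* x^{(g)}$ for symmetric $g$, and, if $n=1$, also for $g=1=\deg e_{11}$; 3. $x_1x_2-x_2x_1$, where $\deg x_1=\deg x_2=1$; 4. if $n=2k+1$ is odd: $(x^*-x)z$, where $\deg x=1$ and $\deg z=\deg e_{k+1,i}$ for some $i>k+1$; 5. if $\mathbb F$ is finite with $q$ elements: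 $x^q-x$, where $\deg x=1$. **(2)** A sequence in $G^s$ is called $\eta$-good if there are strictly upper triangular matrix units $r_1,\dots,r_s$ with these degrees, in this order, such that $r_1\cdots r_s\ne0$ (the empty sequence is $\eta$-good). Let $\beta$ be any set of monomials in letters of nontrivial degree whose images modulo $I$ are linearly independent (in particular pairwise distinct) and span the same subspace as the images of all monomials $z_1\cdots z_s$, $s>0$, in letters $z_c$ for which $(\deg z_1,\dots,\deg z_s)$ is $\eta$-good. Consider the normal monomials, that is, the nonempty words $$\omega_0z_1\omega_1z_2\cdots z_t\omega_t,\qquad t\ge0,$$ where the $z_c$ are letters of nontrivial degree, $(\deg z_1,\dots,\deg z_t)$ is $\eta$-good, and each $\omega_c$ is a possibly empty product $x_{i_1}\cdots x_{i_r}x_{j_1}^*\cdots x_{j_s}^*$ of letters of trivial degree with $i_1\le\dots\le i_r$, $j_1\le\dots\le j_s$. Then the normal monomials which satisfy the following conditions form a basis of $\mathbb F\langle X^G,*\rangle$ modulo $\mathrm{Id}$: - $t=0$ or $z_1\cdots z_t\in\beta$; - if $a\le b$ and $\deg(z_a\cdots z_b)$ is symmetric, then no $*$ occurs in $\omega_{a-1}$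 and in $\omega_b$; - if $n=2k+1$ and $\deg z_c=\deg e_{k+1,j}$ for some $j$, then no $*$ occurs in $\omega_{c-1}$; - if $n=2k+1$ and $\deg z_c=\deg e_{j,k+1}$ for some $j$, then no $*$ occurs in $\omega_c$; - if $n=1$, then no $*$ occurs at all; - if $\mathbb F$ is finite with $q$ elements, then for all $i$ and $c$ each of $x_i$ and $x_i^*$ occurs at most $q-1$ times in $\omega_c$. -/

import Mathlib

/-! ### Graded algebras with a homogeneous involution -/

section General

variable {F : Type*} [Field F] {G : Type*}

/-- `inv` is a homogeneous involution of the `G`-graded algebra `A` (with homogeneous components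
`𝒜 g`) with respect to the map `σ : G → G`. -/
def IsHomogeneousInvolution {A : Type*} [NonUnitalRing A] [Module F A]
    (𝒜 : G → Submodule F A) (σ : G → G) (inv : A →ₗ[F] A) : Prop :=
  (∀ a b, inv (a * b) = inv b * inv a) ∧ (∀ a, inv (inv a) = a) ∧
    ∀ g, ∀ a ∈ 𝒜 g, inv a ∈ 𝒜 (σ g)

/-- Homomorphisms of graded algebras with involution: they preserve the degrees and commute with
the involutions. -/
def IsGradedStarHom {A B : Type*} [NonUnitalRing A] [Module F A] [NonUnitalRing B] [Module F B]
    (𝒜 : G → Submodule F A) (invA : A →ₗ[F] A) (ℬ : G → Submodule F B) (invB : B →ₗ[F] B)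
    (φ : A →ₙₐ[F] B) : Prop :=
  (∀ g, ∀ a ∈ 𝒜 g, φ a ∈ ℬ g) ∧ ∀ a, φ (invA a) = invB (φ a)

/-- `powSucc a k` is `a ^ (k + 1)` (in an algebra that need not have a unit). -/
def powSucc {A : Type*} [Mul A] (a : A) : ℕ → A
  | 0 => a
  | k + 1 => powSucc a k * a

end General

/-! ### The free associative graded algebra with a homogeneous involution -/

/-- The letter `x_i^{(g)}` (if `starred = false`) or `x_i^{(g)∗}` (if `starred = true`), with
`g = varDeg` and `i = index`. -/
@[ext] structure Letter (G : Type*) where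
  varDeg : G
  index : ℕ
  starred : Bool

section Free

variable {G : Type*}

/-- The letter `x_i^{(g)}` has degree `g`, the letter `x_i^{(g)∗}` has degree `σ g`. -/
def Letter.deg (σ : G → G) (l : Letter G) : G := if l.starred then σ l.varDeg else l.varDeg

/-- Exchange `x_i^{(g)}` and `x_i^{(g)∗}`. -/
def Letter.star (l : Letter G) : Letter G := ⟨l.varDeg, l.index, !l.starred⟩

/-- Monomials: nonempty words in the letters. -/
abbrev Word (G : Type*) := FreeSemigroup (Letter G)

/-- The list of the letters of a word. -/
def Word.toList (w : Word G) : List (Letter G) := w.head :: w.tail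

/-- The degree of a word is the product of the degrees of its letters. -/
def Word.deg [Group G] (σ : G → G) (w : Word G) : G :=
  FreeSemigroup.lift (Letter.deg σ) w

/-- `(l₁ ⋯ l_m)∗ = l_m∗ ⋯ l₁∗`. -/
def Word.star (w : Word G) : Word G :=
  (FreeSemigroup.lift (fun l : Letter G => MulOpposite.op (FreeSemigroup.of l.star)) w).unop

/-- The free associative algebra `F⟨X^G, ∗⟩` (without unit): its monomials are the nonempty words
in the `x_i^{(g)}` and the `x_i^{(g)∗}`. -/
abbrev FreeStarAlg (F : Type*) [Field F] (G : Type*) := MonoidAlgebra F (Word G)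

variable (F : Type*) [Field F]

/-- A word as an element of the free algebra. -/
noncomputable def mono (w : Word G) : FreeStarAlg F G := MonoidAlgebra.single w 1

/-- The variable `x_i^{(g)}`. -/
noncomputable def var (g : G) (i : ℕ) : FreeStarAlg F G := mono F (FreeSemigroup.of ⟨g, i, false⟩)

/-- The homogeneous component of degree `g` of the free algebra. -/
noncomputable def freeGrading [Group G] (σ : G → G) (g : G) : Submodule F (FreeStarAlg F G) :=
  Submodule.span F (mono F '' {w | Word.deg σ w = g})

/-- The involution of the free algebra: the linear extension of `Word.star`. -/
noncomputable def freeStar : FreeStarAlg F G →ₗ[F] FreeStarAlg F G :=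
  MonoidAlgebra.mapDomainLinearMap F F Word.star

variable {F}

/-- The set of all graded polynomial identities with involution of a graded algebra with a
homogeneous involution: the elements of the free algebra that vanish under every homomorphism of
graded algebras with involution (that is, under all evaluations of the variables `x_i^{(g)}` by
homogeneous elements of degree `g`). -/
noncomputable def gradedStarIdentities [Group G] (σ : G → G) {A : Type*} [NonUnitalRing A] [Module F A]
    (𝒜 : G → Submodule F A) (inv : A →ₗ[F] A) : Submodule F (FreeStarAlg F G) where
  carrier := {f | ∀ φ : FreeStarAlg F G →ₙₐ[F] A,
    IsGradedStarHom (freeGrading F σ) (freeStar F) 𝒜 inv φ → φ f = 0}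
  add_mem' ha hb φ hφ := by rw [map_add, ha φ hφ, hb φ hφ, add_zero]
  zero_mem' φ _ := map_zero φ
  smul_mem' c a ha φ hφ := by rw [map_smul, ha φ hφ, smul_zero]

/-- A `T_{G,∗}`-ideal: a two-sided ideal of the free algebra that is stable under `∗` and under all
endomorphisms of the free algebra as a graded algebra with involution. -/
def IsTIdeal [Group G] (σ : G → G) (J : Submodule F (FreeStarAlg F G)) : Prop :=
  (∀ a, ∀ f ∈ J, a * f ∈ J ∧ f * a ∈ J) ∧ (∀ f ∈ J, freeStar F f ∈ J) ∧
    ∀ φ : FreeStarAlg F G →ₙₐ[F] FreeStarAlg F G,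
      IsGradedStarHom (freeGrading F σ) (freeStar F) (freeGrading F σ) (freeStar F) φ →
      ∀ f ∈ J, φ f ∈ J

/-- The `T_{G,∗}`-ideal generated by a set of polynomials. -/
noncomputable def tIdeal [Group G] (σ : G → G) (S : Set (FreeStarAlg F G)) : Submodule F (FreeStarAlg F G) :=
  sInf {J | S ⊆ J ∧ IsTIdeal σ J}

end Free

/-! ### Upper triangular matrices -/

section UpperTriangular

variable (F : Type*) [Field F] (n : ℕ)

/-- The algebra `UT_n(F)` of upper triangular matrices. -/
def UT : Subalgebra F (Matrix (Fin n) (Fin n) F) where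
  carrier := {A | ∀ i j, j < i → A i j = 0}
  mul_mem' {A B} hA hB i j hij := by
    rw [Matrix.mul_apply]
    refine Finset.sum_eq_zero fun k _ => ?_
    rcases lt_or_ge k i with h | h
    · rw [hA i k h, zero_mul]
    · rw [hB k j (lt_of_lt_of_le hij h), mul_zero]
  add_mem' {A B} hA hB i j hij := by rw [Matrix.add_apply, hA i j hij, hB i j hij, add_zero]
  algebraMap_mem' r i j hij := by
    rw [Matrix.algebraMap_matrix_apply, if_neg (ne_of_gt hij)]

variable {n}

/-- For the elementary grading given by `η = (g_1, …, g_{n-1})`: the degree `g_i ⋯ g_{j-1}` of the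
matrix unit `e_{ij}`, `i ≤ j`. -/
def elemDeg {G : Type*} [Group G] (η : Fin (n - 1) → G) (i j : Fin n) : G :=
  (((List.finRange (n - 1)).filter (fun k => i.val ≤ k.val ∧ k.val < j.val)).map η).prod

/-- The elementary grading on `UT_n` given by `η`: the component of degree `g` is spanned by the
matrix units `e_{ij}`, `i ≤ j`, of degree `g`. -/
def elemGrading {G : Type*} [Group G] (η : Fin (n - 1) → G) (g : G) : Submodule F (UT F n) where
  carrier := {A | ∀ i j, A.val i j ≠ 0 → elemDeg η i j = g}
  add_mem' {A B} hA hB i j h := by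
    by_cases hA0 : A.val i j = 0
    · by_cases hB0 : B.val i j = 0
      · exact absurd (by simp [hA0, hB0]) h
      · exact hB i j hB0
    · exact hA i j hA0
  zero_mem' i j h := absurd rfl h
  smul_mem' c A hA i j h := hA i j fun h0 => h (by simp [h0])

/-- The support of the elementary grading given by `η`. -/
def elemSupport {G : Type*} [Group G] (η : Fin (n - 1) → G) : Set G :=
  {g | elemGrading F η g ≠ ⊥}

/-- A sequence of group elements is `η`-good if there are strictly upper triangular matrix units
of these degrees whose product (in the given order) is nonzero. -/
def IsGood {G : Type*} [Group G] (η : Fin (n - 1) → G) {m : ℕ} (ν : Fin m → G) : Prop :=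
  ∃ p q : Fin m → Fin n, (∀ c, p c < q c) ∧ (∀ c, elemDeg η (p c) (q c) = ν c) ∧
    (List.ofFn fun c => Matrix.single (p c) (q c) (1 : F)).prod ≠ 0

variable {F}

/-- Reflection along the secondary diagonal: `e_{ij} ↦ e_{n+1-j,n+1-i}`. -/
def reflect (A : Matrix (Fin n) (Fin n) F) : Matrix (Fin n) (Fin n) F :=
  Matrix.of fun i j => A j.rev i.rev

variable (F n) in
/-- The matrix `diag(I_m, -I_m)`, for `n = 2m`. -/
def signMatrix : Matrix (Fin n) (Fin n) F :=
  Matrix.diagonal fun i => if i.val < n / 2 then 1 else -1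

/-- An involution of `UT_n` is orthogonal if it is equivalent to the reflection `τ` along the
secondary diagonal. -/
def IsOrthogonal (inv : UT F n →ₗ[F] UT F n) : Prop :=
  ∃ φ : UT F n ≃ₐ[F] UT F n, ∀ a, (φ (inv a)).val = reflect (φ a).val

/-- An involution of `UT_n` is symplectic if `n = 2m` is even and it is equivalent to
`A ↦ D A^τ D⁻¹`, where `D = diag(I_m, -I_m)`. -/
def IsSymplectic (inv : UT F n →ₗ[F] UT F n) : Prop :=
  Even n ∧ ∃ φ : UT F n ≃ₐ[F] UT F n,
    ∀ a, (φ (inv a)).val = signMatrix F n * reflect (φ a).val * (signMatrix F n)⁻¹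

end UpperTriangular

/-! ### The fine grading by the free group -/

section Fine

/-- The free group of rank `n - 1`; the generator `α_{i+1}` is `FreeGroup.of i`. -/
abbrev FG (n : ℕ) := FreeGroup (Fin (n - 1))

/-- The sequence `η = (α_1, …, α_{n-1})`. -/
def fineSeq (n : ℕ) : Fin (n - 1) → FG n := FreeGroup.of

/-- The involution of the free group: the anti-automorphism with `α_i∗ = α_{n-i}`. -/
def genStar (n : ℕ) (g : FG n) : FG n :=
  (FreeGroup.lift (fun i : Fin (n - 1) => MulOpposite.op (FreeGroup.of i.rev)) g).unop

/-- An element is symmetric if it is the degree of some `e_{ij}` with `i < j` and `i + j = n + 1`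
(indices counted from `1`). -/
def IsSymmetricDeg {n : ℕ} (g : FG n) : Prop :=
  ∃ i j : Fin n, i < j ∧ j = i.rev ∧ g = elemDeg (fineSeq n) i j

variable (F : Type*) [Field F] (n : ℕ)

/-- The generating identities (`ε` is the sign of the involution). -/
inductive IsGenerator (ε : F) : FreeStarAlg F (FG n) → Prop
  /-- `x^{(g)}`, for `g` outside of the support -/
  | offSupport (g : FG n) (hg : g ∉ elemSupport F (fineSeq n)) : IsGenerator ε (var F g 0)
  /-- `x^{(g)∗} - ε x^{(g)}`, for symmetric `g` -/
  | symm (g : FG n) (hg : IsSymmetricDeg g) :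
      IsGenerator ε (freeStar F (var F g 0) - ε • var F g 0)
  /-- if `n = 1`, the same relation for `g = 1 = deg e_{11}` -/
  | symmOne (hn : n = 1) :
      IsGenerator ε (freeStar F (var F (1 : FG n) 0) - ε • var F (1 : FG n) 0)
  /-- `[x_1, x_2]`, for variables of trivial degree -/
  | comm : IsGenerator ε (var F (1 : FG n) 1 * var F 1 2 - var F (1 : FG n) 2 * var F 1 1)
  /-- if `n = 2k + 1`: `(x∗ - x) z`, with `deg x = 1` and `deg z = deg e_{k+1,i}`, `k + 1 < i`
  (counting from `1`, so `k + 1` is the index `c` with `c = k` counting from `0`) -/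
  | middle (k : ℕ) (hn : n = 2 * k + 1) (c i : Fin n) (hc : c.val = k) (hi : c < i) :
      IsGenerator ε ((freeStar F (var F (1 : FG n) 0) - var F (1 : FG n) 0) *
        var F (elemDeg (fineSeq n) c i) 0)
  /-- if `F` is finite with `q` elements: `x^q - x`, for `x` of trivial degree -/
  | frob (hF : Finite F) :
      IsGenerator ε (powSucc (var F (1 : FG n) 0) (Nat.card F - 1) - var F (1 : FG n) 0)

/-- The `T_{G,∗}`-ideal generated by the generating identities. -/
noncomputable def genTIdeal (ε : F) : Submodule F (FreeStarAlg F (FG n)) :=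
  tIdeal (genStar n) {f | IsGenerator F n ε f}

/-! ### Normal monomials -/

variable {n}

/-- The monomials `z_1 ⋯ z_s`, `s > 0`, in letters whose degrees form an `η`-good sequence (so that
all the letters have nontrivial degree). -/
def goodWords : Set (Word (FG n)) :=
  {w | IsGood F (fineSeq n) (fun c => (w.toList.get c).deg (genStar n))}

/-- `β` consists of products of letters of nontrivial degree, and it is mapped bijectively onto a
basis of the span of the good words modulo the generated ideal. -/
def IsLeadingBasis (ε : F) (β : Set (Word (FG n))) : Prop :=
  (∀ w ∈ β, ∀ l ∈ w.toList, l.deg (genStar n) ≠ 1) ∧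
  LinearIndependent F (fun w : β => (genTIdeal F n ε).mkQ (mono F w.val)) ∧
  Submodule.span F (Set.range fun w : β => (genTIdeal F n ε).mkQ (mono F w.val)) =
    Submodule.span F ((fun w => (genTIdeal F n ε).mkQ (mono F w)) '' goodWords F)

/-- The block `x_{i_1} ⋯ x_{i_r} x_{j_1}∗ ⋯ x_{j_s}∗` of variables of trivial degree, where
`i_1, …, i_r` is the list `plain` and `j_1, …, j_s` is the list `starred`. -/
structure Block where
  plain : List ℕ
  starred : List ℕ
  plain_sorted : plain.Pairwise (· ≤ ·)
  starred_sorted : starred.Pairwise (· ≤ ·)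

/-- The letters of a block. -/
def Block.letters (n : ℕ) (b : Block) : List (Letter (FG n)) :=
  b.plain.map (fun i => ⟨1, i, false⟩) ++ b.starred.map (fun j => ⟨1, j, true⟩)

/-- The letters of `ω_0 z_1 ω_1 z_2 ⋯ z_t ω_t`. -/
def normalLetters {t : ℕ} (z : Fin t → Letter (FG n)) (ω : Fin (t + 1) → Block) :
    List (Letter (FG n)) :=
  (ω 0).letters n ++ (List.finRange t).flatMap fun c => z c :: (ω c.succ).letters n

/-- The degree of `z_a ⋯ z_b`. -/
def segDeg {t : ℕ} (z : Fin t → Letter (FG n)) (a b : Fin t) : FG n :=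
  (((List.finRange t).filter (fun c => a ≤ c ∧ c ≤ b)).map fun c => (z c).deg (genStar n)).prod

/-- The conditions on a normal monomial `ω_0 z_1 ω_1 ⋯ z_t ω_t`. Here `z_1, …, z_t` are the values
of `z` at `0, …, t - 1`, so that `z c` stands between `ω c.castSucc` and `ω c.succ`. -/
structure IsReducedNormal {t : ℕ} (z : Fin t → Letter (FG n)) (ω : Fin (t + 1) → Block) :
    Prop where
  /-- the degrees of the `z`'s are nontrivial -/
  nontrivial : ∀ c, (z c).deg (genStar n) ≠ 1
  /-- the degrees of the `z`'s form an `η`-good sequence -/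
  good : IsGood F (fineSeq n) fun c => (z c).deg (genStar n)
  /-- no `∗` next to a segment of symmetric degree -/
  symm : ∀ a b : Fin t, a ≤ b → IsSymmetricDeg (segDeg z a b) →
    (ω a.castSucc).starred = [] ∧ (ω b.succ).starred = []
  /-- for `n = 2k + 1`: no `∗` in front of a `z` of degree `deg e_{k+1,j}` -/
  middle_left : ∀ k, n = 2 * k + 1 → ∀ (c : Fin t) (i j : Fin n), i.val = k →
    (z c).deg (genStar n) = elemDeg (fineSeq n) i j → (ω c.castSucc).starred = []
  /-- for `n = 2k + 1`: no `∗` behind a `z` of degree `deg e_{j,k+1}` -/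
  middle_right : ∀ k, n = 2 * k + 1 → ∀ (c : Fin t) (i j : Fin n), i.val = k →
    (z c).deg (genStar n) = elemDeg (fineSeq n) j i → (ω c.succ).starred = []
  /-- for `n = 1`: no `∗` at all -/
  one : n = 1 → ∀ c, (ω c).starred = []
  /-- over a field with `q` elements each `x_i` and each `x_i∗` occurs at most `q - 1` times in
  each block -/
  finite : Finite F → ∀ c i, (ω c).plain.count i ≤ Nat.card F - 1 ∧
    (ω c).starred.count i ≤ Nat.card F - 1

/-- The normal monomials `ω_0 z_1 ω_1 ⋯ z_t ω_t` that satisfy the above conditions and for which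
either `t = 0` or `z_1 ⋯ z_t ∈ β`. -/
def normalBasis (β : Set (Word (FG n))) : Set (Word (FG n)) :=
  {w | ∃ (t : ℕ) (z : Fin t → Letter (FG n)) (ω : Fin (t + 1) → Block),
    IsReducedNormal F z ω ∧ w.toList = normalLetters z ω ∧
      (t = 0 ∨ ∃ v ∈ β, v.toList = List.ofFn z)}

end Fine

/-! Write I for the generated ideal `genTIdeal` and Id for the ideal of identities. The inclusion I
⊆ Id is checked on generators. The converse and the basis come together: the normal monomials span
modulo I and are independent modulo the possibly larger Id, which forces I = Id.

Everything rests on the fineness of the grading. Positive words in a free group do not cancel, so a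
nontrivial degree in the support determines its matrix unit (`elemDeg_inj`), and a product of two
such degrees is in the support only if the units are composable (`eq_of_elemDeg_mul`). Hence a word
vanishes modulo I unless its letters of nontrivial degree trace a path of matrix units. The
involution sends the line of e_{ij} to that of e_{n+1-j,n+1-i}, reflects diagonal matrices
(`inv_apply_diag`) and acts as ε on symmetric degrees: every automorphism preserves the line of
e_{1n}, so the sign can be read there, and factoring e_{1n} through e_{i,n+1-i} carries it to the
other symmetric degrees (`inv_eq_smul_of_symmetric`).

Spanning. Letters of trivial degree commute and can be sorted into blocks. If U has symmetric
degree, then xU and Ux∗ are both ε times U∗x∗, so a star next to U disappears when its letter is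
pushed across U. This rewriting and that by the other generators terminate, because they lower
`letterWeight`. The path itself is changed by applying ∗ to factors of symmetric degree. The
combinatorial core is `flipRel_of_isPath`: paths with the same ends and the same set of variables
are connected by such flips, so they are proportional modulo I.

Independence. Substitute diagonal matrices for the variables of trivial degree, and 0 or 1 times the
matrix unit of the right degree for the others. An entry of the value of a normal monomial is then a
nonzero constant times a multiplicative function of the parameters. By Dedekind's theorem it
suffices that different basis monomials with the same end vertices give different functions. The
zeros and ones reveal the set of variables, hence the element of β by the flip theorem. The
exponents of the diagonal entries reveal the blocks: a plain letter at the vertex v contributes the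
entry v, a starred one the entry n+1-v, and the conditions on stars exclude the vertices where the
two could be confused. Over a field with q elements the bound q-1 keeps the exponents visible. -/

/-! ### Positive elements of free groups -/

/-- A product of generators without inverses is already a reduced word, so the list can be read off.
-/
theorem FreeGroup.prod_map_of_injective (α : Type*) :
    Function.Injective fun L : List α => (L.map FreeGroup.of).prod := by
  classical
  have key : ∀ L : List α, (L.map FreeGroup.of).prod = FreeGroup.mk (L.map fun a => (a, true)) := by
    intro L
    induction L with
    | nil => rfl
    | cons a L ih => rw [List.map_cons, List.prod_cons, ih]; rfl
  have red : ∀ L : List α, ((L.map FreeGroup.of).prod).toWord = L.map fun a => (a, true) := by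
    intro L
    rw [key, FreeGroup.toWord_mk, ← FreeGroup.isReduced_iff_reduce_eq, FreeGroup.IsReduced,
      List.isChain_map]
    exact (List.pairwise_of_forall fun _ _ _ => rfl).isChain
  intro L M h
  have h' := congrArg FreeGroup.toWord h
  simp only [red] at h'
  exact List.map_injective_iff.2 (fun a b hab => (Prod.mk.inj hab).1) h'

/-- The list of the indices `i, …, j - 1` of the generators in the degree of `e_{ij}`. -/
def stepList {n : ℕ} (i j : Fin n) : List (Fin (n - 1)) :=
  (List.finRange (n - 1)).filter fun k => i.val ≤ k.val ∧ k.val < j.val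

theorem elemDeg_eq {n : ℕ} (i j : Fin n) :
    elemDeg (fineSeq n) i j = ((stepList i j).map FreeGroup.of).prod := rfl

/-- A strictly increasing list is determined by its members; this turns every later computation with
intervals of generators into a membership check. -/
theorem List.eq_range'_of_sortedLT {L : List ℕ} {a b : ℕ} (h : L.Pairwise (· < ·))
    (hm : ∀ x, x ∈ L ↔ a ≤ x ∧ x < b) : L = List.range' a (b - a) := by
  refine List.Perm.eq_of_pairwise (le := (· < ·)) (fun x y _ _ h1 h2 => by omega) h
    (by simpa using List.pairwise_lt_range') ?_
  refine (List.perm_ext_iff_of_nodup (h.imp fun h => ne_of_lt h)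
    (List.nodup_range')).2 fun x => ?_
  rw [hm, List.mem_range'_1]; omega

theorem map_val_stepList {n : ℕ} (i j : Fin n) :
    (stepList i j).map Fin.val = List.range' i.val (j.val - i.val) := by
  apply List.eq_range'_of_sortedLT
  · rw [List.pairwise_map]
    exact ((List.pairwise_lt_finRange _).filter _).imp fun h => h
  · intro x
    simp only [stepList, List.mem_map, List.mem_filter, List.mem_finRange, true_and,
      decide_eq_true_eq]
    constructor
    · rintro ⟨k, hk, rfl⟩; exact hk
    · intro h; exact ⟨⟨x, by omega⟩, h, rfl⟩

theorem list_eq_of_map_val_eq {m : ℕ} {L M : List (Fin m)} (h : L.map Fin.val = M.map Fin.val) :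
    L = M :=
  List.map_injective_iff.2 Fin.val_injective h

theorem elemDeg_eq_iff_range' {n : ℕ} (i j k l : Fin n) :
    elemDeg (fineSeq n) i j = elemDeg (fineSeq n) k l ↔
      List.range' i.val (j.val - i.val) = List.range' k.val (l.val - k.val) := by
  rw [← map_val_stepList, ← map_val_stepList]
  constructor
  · intro h
    exact congrArg _ (FreeGroup.prod_map_of_injective _ h)
  · intro h
    rw [elemDeg_eq, elemDeg_eq, list_eq_of_map_val_eq h]

theorem elemDeg_of_le {n : ℕ} {i j : Fin n} (h : j ≤ i) : elemDeg (fineSeq n) i j = 1 := by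
  have : stepList i j = [] := list_eq_of_map_val_eq (by
    rw [map_val_stepList, show j.val - i.val = 0 by have : j.val ≤ i.val := h; omega]; rfl)
  rw [elemDeg_eq, this]; rfl

theorem elemDeg_self {n : ℕ} (i : Fin n) : elemDeg (fineSeq n) i i = 1 := elemDeg_of_le le_rfl

/-- The first generator and the number of generators recover both indices. Since i < j makes the
word nonempty, nothing need be assumed on k and l. -/
theorem elemDeg_inj {n : ℕ} {i j k l : Fin n} (hij : i < j)
    (h : elemDeg (fineSeq n) i j = elemDeg (fineSeq n) k l) : k = i ∧ l = j := by
  rw [elemDeg_eq_iff_range'] at h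
  have hij' : i.val < j.val := hij
  have h1 := congrArg List.length h
  have h2 := congrArg List.head? h
  simp only [List.length_range', List.head?_range'] at h1 h2
  rw [if_neg (by omega), if_neg (by omega)] at h2
  simp only [Option.some.injEq] at h2
  exact ⟨Fin.ext h2.symm, Fin.ext (by omega)⟩

theorem elemDeg_ne_one {n : ℕ} {i j : Fin n} (hij : i < j) : elemDeg (fineSeq n) i j ≠ 1 := by
  intro h
  rw [← elemDeg_self i] at h
  have := (elemDeg_inj hij h).2
  exact absurd this hij.ne

theorem elemDeg_eq_one_iff {n : ℕ} {i j : Fin n} : elemDeg (fineSeq n) i j = 1 ↔ j ≤ i :=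
  ⟨fun h => not_lt.1 fun h' => elemDeg_ne_one h' h, elemDeg_of_le⟩

theorem elemDeg_mul {n : ℕ} {i j k : Fin n} (hij : i ≤ j) (hjk : j ≤ k) :
    elemDeg (fineSeq n) i j * elemDeg (fineSeq n) j k = elemDeg (fineSeq n) i k := by
  have h1 : i.val ≤ j.val := hij
  have h2 : j.val ≤ k.val := hjk
  rw [elemDeg_eq, elemDeg_eq, elemDeg_eq, ← List.prod_append, ← List.map_append]
  congr 2
  apply list_eq_of_map_val_eq
  rw [List.map_append, map_val_stepList, map_val_stepList, map_val_stepList,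
    show k.val - i.val = (j.val - i.val) + (k.val - j.val) by omega, ← List.range'_append_1]
  congr 2; omega

/-- The product of two strictly upper triangular degrees is a degree of a matrix unit only if the
matrix units are composable. -/
theorem eq_of_elemDeg_mul {n : ℕ} {p q p' q' i j : Fin n} (hp : p < q) (hp' : p' < q')
    (h : elemDeg (fineSeq n) p q * elemDeg (fineSeq n) p' q' = elemDeg (fineSeq n) i j) :
    q = p' := by
  have h1 : p.val < q.val := hp
  have h2 : p'.val < q'.val := hp'
  rw [elemDeg_eq, elemDeg_eq, elemDeg_eq, ← List.prod_append, ← List.map_append] at h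
  have h := congrArg (List.map Fin.val) (FreeGroup.prod_map_of_injective _ h)
  rw [List.map_append, map_val_stepList, map_val_stepList, map_val_stepList] at h
  have hl := congrArg List.length h
  simp only [List.length_append, List.length_range'] at hl
  -- The letters on the two sides of the junction are q-1 and p'. They are neighbours in an interval
  -- of consecutive integers, so p' = q.
  have g0 := congrArg (fun L => L[q.val - p.val - 1]?) h
  have g1 := congrArg (fun L => L[q.val - p.val]?) h
  simp only [List.getElem?_append, List.length_range'] at g0 g1
  rw [if_pos (by omega), List.getElem?_range' (by omega), List.getElem?_range' (by omega)] at g0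
  rw [if_neg (by omega), List.getElem?_range' (by omega), List.getElem?_range' (by omega)] at g1
  simp only [Option.some.injEq] at g0 g1
  exact Fin.ext (by omega)

/-! ### The involution of the free group -/

theorem genStar_mul {n : ℕ} (g h : FG n) : genStar n (g * h) = genStar n h * genStar n g := by
  simp [genStar]

theorem genStar_one {n : ℕ} : genStar n 1 = 1 := by simp [genStar]

theorem genStar_of {n : ℕ} (i : Fin (n - 1)) :
    genStar n (FreeGroup.of i) = FreeGroup.of i.rev := by simp [genStar]

theorem genStar_genStar {n : ℕ} (g : FG n) : genStar n (genStar n g) = g := by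
  let f : FG n →* FG n :=
    { toFun := fun g => genStar n (genStar n g)
      map_one' := by rw [genStar_one, genStar_one]
      map_mul' := fun g h => by rw [genStar_mul, genStar_mul] }
  have : f = MonoidHom.id _ := by
    ext i
    change genStar n (genStar n (FreeGroup.of i)) = _
    rw [genStar_of, genStar_of, Fin.rev_rev]; rfl
  exact DFunLike.congr_fun this g

theorem genStar_eq_one_iff {n : ℕ} {g : FG n} : genStar n g = 1 ↔ g = 1 :=
  ⟨fun h => by rw [← genStar_genStar g, h, genStar_one], fun h => by rw [h, genStar_one]⟩

theorem genStar_list_prod {n : ℕ} (L : List (FG n)) :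
    genStar n L.prod = (L.reverse.map (genStar n)).prod := by
  induction L with
  | nil => exact genStar_one
  | cons g L ih => simp [genStar_mul, ih]

theorem genStar_elemDeg {n : ℕ} (i j : Fin n) :
    genStar n (elemDeg (fineSeq n) i j) = elemDeg (fineSeq n) j.rev i.rev := by
  rw [elemDeg_eq, elemDeg_eq, genStar_list_prod, ← List.map_reverse, List.map_map]
  have : genStar n ∘ FreeGroup.of = FreeGroup.of ∘ Fin.rev := funext fun i => genStar_of i
  rw [this, ← List.map_map]
  congr 2
  apply list_eq_of_map_val_eq
  rw [map_val_stepList]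
  apply List.eq_range'_of_sortedLT
  · rw [List.pairwise_map, List.pairwise_map, List.pairwise_reverse]
    refine ((List.pairwise_lt_finRange _).filter _).imp fun {a b} h => ?_
    simp only [Fin.val_rev]
    have : a.val < b.val := h
    omega
  · intro x
    simp only [List.mem_map, List.mem_reverse, stepList, List.mem_filter, List.mem_finRange,
      true_and, decide_eq_true_eq, Fin.val_rev]
    constructor
    · rintro ⟨a, ⟨k, hk, rfl⟩, rfl⟩
      simp only [Fin.val_rev]
      omega
    · intro h
      refine ⟨⟨x, by omega⟩, ⟨⟨n - 1 - 1 - x, by omega⟩, by simp only; omega, ?_⟩, rfl⟩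
      apply Fin.ext; simp only [Fin.val_rev]; omega

theorem isSymmetricDeg_elemDeg {n : ℕ} {i : Fin n} (hi : i < i.rev) :
    IsSymmetricDeg (elemDeg (fineSeq n) i i.rev) := ⟨i, i.rev, hi, rfl, rfl⟩

theorem IsSymmetricDeg.genStar_eq {n : ℕ} {g : FG n} (h : IsSymmetricDeg g) :
    genStar n g = g := by
  obtain ⟨i, j, _, rfl, rfl⟩ := h
  rw [genStar_elemDeg, Fin.rev_rev]

/-! ### Words and lists of letters -/

section Words

variable {G : Type*}

theorem Letter.star_star (l : Letter G) : l.star.star = l := by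
  cases l; simp [Letter.star]

theorem Letter.deg_star {σ : G → G} (hσ : ∀ g, σ (σ g) = g) (l : Letter G) :
    l.star.deg σ = σ (l.deg σ) := by
  obtain ⟨g, i, b⟩ := l
  cases b <;> simp [Letter.star, Letter.deg, hσ]

/-- The degree of a list of letters. -/
def listDeg [Group G] (σ : G → G) (L : List (Letter G)) : G := (L.map (Letter.deg σ)).prod

/-- `(l₁ ⋯ l_m)∗ = l_m∗ ⋯ l₁∗`, for lists of letters. -/
def listStar (L : List (Letter G)) : List (Letter G) := (L.map Letter.star).reverse

theorem listDeg_append [Group G] (σ : G → G) (L M : List (Letter G)) :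
    listDeg σ (L ++ M) = listDeg σ L * listDeg σ M := by simp [listDeg]

theorem listDeg_cons [Group G] (σ : G → G) (l : Letter G) (M : List (Letter G)) :
    listDeg σ (l :: M) = l.deg σ * listDeg σ M := by simp [listDeg]

theorem listStar_append (L M : List (Letter G)) :
    listStar (L ++ M) = listStar M ++ listStar L := by simp [listStar]

theorem listStar_listStar (L : List (Letter G)) : listStar (listStar L) = L := by
  simp [listStar, List.map_reverse, Function.comp_def, Letter.star_star]

theorem listStar_eq_nil {L : List (Letter G)} : listStar L = [] ↔ L = [] := by
  simp [listStar]

theorem length_listStar (L : List (Letter G)) : (listStar L).length = L.length := by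
  simp [listStar]

theorem listDeg_listStar [Group G] {σ : G → G} (h1 : σ 1 = 1)
    (hσ : ∀ g h, σ (g * h) = σ h * σ g) (hσ2 : ∀ g, σ (σ g) = g) (L : List (Letter G)) :
    listDeg σ (listStar L) = σ (listDeg σ L) := by
  induction L with
  | nil => simp [listDeg, listStar, h1]
  | cons l L ih =>
    rw [show listStar (l :: L) = listStar L ++ [l.star] by simp [listStar],
      listDeg_append, ih, listDeg_cons, listDeg_cons, hσ]
    simp [listDeg, Letter.deg_star hσ2]

theorem Word.toList_mul (v w : Word G) : Word.toList (v * w) = v.toList ++ w.toList := rfl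

theorem Word.toList_of (l : Letter G) : Word.toList (FreeSemigroup.of l) = [l] := rfl

theorem Word.toList_ne_nil (w : Word G) : w.toList ≠ [] := List.cons_ne_nil _ _

theorem Word.toList_injective : Function.Injective (Word.toList (G := G)) := by
  rintro ⟨a, L⟩ ⟨b, M⟩ h
  obtain ⟨rfl, rfl⟩ := List.cons.inj h
  rfl

theorem Word.exists_toList_eq {L : List (Letter G)} (h : L ≠ []) : ∃ w : Word G, w.toList = L := by
  cases L with
  | nil => exact absurd rfl h
  | cons a L => exact ⟨⟨a, L⟩, rfl⟩

theorem Word.deg_eq_listDeg [Group G] (σ : G → G) (w : Word G) :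
    Word.deg σ w = listDeg σ w.toList := by
  induction w using FreeSemigroup.recOnMul with
  | ih1 l => simp [Word.deg, listDeg, Word.toList_of]
  | ih2 l w _ h2 =>
    rw [Word.toList_mul, listDeg_append, ← h2, Word.toList_of]
    simp [Word.deg, listDeg]

theorem Word.deg_mul [Group G] (σ : G → G) (v w : Word G) :
    Word.deg σ (v * w) = Word.deg σ v * Word.deg σ w := by
  simp [Word.deg]

theorem Word.star_mul (v w : Word G) : Word.star (v * w) = w.star * v.star := by
  simp [Word.star]

theorem Word.star_of (l : Letter G) :
    Word.star (FreeSemigroup.of l) = FreeSemigroup.of l.star := by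
  simp [Word.star]

theorem Word.toList_star (w : Word G) : w.star.toList = listStar w.toList := by
  induction w using FreeSemigroup.recOnMul with
  | ih1 l => simp [Word.star_of, Word.toList_of, listStar]
  | ih2 l w _ h2 =>
    rw [Word.star_mul, Word.toList_mul, Word.toList_mul, listStar_append, h2, Word.star_of]
    simp [Word.toList_of, listStar]

theorem Word.star_star (w : Word G) : w.star.star = w :=
  Word.toList_injective (by rw [Word.toList_star, Word.toList_star, listStar_listStar])

theorem Word.deg_star [Group G] {σ : G → G} (h1 : σ 1 = 1)
    (hσ : ∀ g h, σ (g * h) = σ h * σ g) (hσ2 : ∀ g, σ (σ g) = g) (w : Word G) :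
    Word.deg σ w.star = σ (Word.deg σ w) := by
  rw [Word.deg_eq_listDeg, Word.deg_eq_listDeg, Word.toList_star, listDeg_listStar h1 hσ hσ2]

variable (F : Type*) [Field F]

theorem mono_mul (v w : Word G) : mono F (v * w) = mono F v * mono F w := by
  simp [mono, MonoidAlgebra.single_mul_single]

theorem freeStar_mono (w : Word G) : freeStar F (mono F w) = mono F w.star := by
  simp [freeStar, mono]

variable {F} in
theorem freeStarAlg_induction {p : FreeStarAlg F G → Prop} (h0 : p 0)
    (hadd : ∀ f g, p f → p g → p (f + g)) (hmono : ∀ (c : F) w, p (c • mono F w))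
    (f : FreeStarAlg F G) : p f := by
  refine MonoidAlgebra.induction_linear f h0 hadd fun w c => ?_
  have := hmono c w
  rwa [mono, MonoidAlgebra.smul_single, smul_eq_mul, mul_one] at this

/-- The monomial given by a list of letters; zero for the empty list. -/
noncomputable def lmono : List (Letter G) → FreeStarAlg F G
  | [] => 0
  | l :: L => mono F ⟨l, L⟩

theorem lmono_toList (w : Word G) : lmono F w.toList = mono F w := rfl

theorem lmono_append {L M : List (Letter G)} (hL : L ≠ []) (hM : M ≠ []) :
    lmono F (L ++ M) = lmono F L * lmono F M := by
  obtain ⟨v, rfl⟩ := Word.exists_toList_eq hL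
  obtain ⟨w, rfl⟩ := Word.exists_toList_eq hM
  rw [← Word.toList_mul, lmono_toList, lmono_toList, lmono_toList, mono_mul]

theorem freeStar_lmono (L : List (Letter G)) :
    freeStar F (lmono F L) = lmono F (listStar L) := by
  by_cases hL : L = []
  · subst hL; simp [lmono, listStar]
  · obtain ⟨v, rfl⟩ := Word.exists_toList_eq hL
    rw [← Word.toList_star, lmono_toList, lmono_toList, freeStar_mono]

theorem lmono_mem_freeGrading [Group G] (σ : G → G) (L : List (Letter G)) :
    lmono F L ∈ freeGrading F σ (listDeg σ L) := by
  by_cases hL : L = []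
  · subst hL; exact zero_mem _
  · obtain ⟨v, rfl⟩ := Word.exists_toList_eq hL
    exact Submodule.subset_span ⟨v, Word.deg_eq_listDeg σ v, rfl⟩

theorem var_eq_lmono (g : G) (i : ℕ) : var F g i = lmono F [⟨g, i, false⟩] := rfl

theorem freeStar_mul (f g : FreeStarAlg F G) :
    freeStar F (f * g) = freeStar F g * freeStar F f := by
  induction f using freeStarAlg_induction with
  | h0 => simp
  | hadd f f' h h' => simp [add_mul, mul_add, h, h']
  | hmono c v =>
    induction g using freeStarAlg_induction with
    | h0 => simp
    | hadd f f' h h' => simp only [add_mul, mul_add, map_add, h, h']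
    | hmono d w =>
      simp only [smul_mul_assoc, mul_smul_comm, map_smul, ← mono_mul, freeStar_mono,
        Word.star_mul]
      rw [smul_comm]

theorem freeStar_freeStar (f : FreeStarAlg F G) : freeStar F (freeStar F f) = f := by
  induction f using freeStarAlg_induction with
  | h0 => simp
  | hadd f f' h h' => simp [h, h']
  | hmono c v => simp [freeStar_mono, Word.star_star]

theorem freeStar_isHomogeneousInvolution [Group G] {σ : G → G} (h1 : σ 1 = 1)
    (hσ : ∀ g h, σ (g * h) = σ h * σ g) (hσ2 : ∀ g, σ (σ g) = g) :
    IsHomogeneousInvolution (freeGrading F σ) σ (freeStar F) := by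
  refine ⟨freeStar_mul F, freeStar_freeStar F, fun g a ha => ?_⟩
  induction ha using Submodule.span_induction with
  | mem x hx =>
    obtain ⟨w, hw, rfl⟩ := hx
    rw [freeStar_mono]
    exact Submodule.subset_span ⟨_, by rw [Set.mem_ofPred_eq, Word.deg_star h1 hσ hσ2, hw], rfl⟩
  | zero => simp
  | add x y _ _ hx hy => rw [map_add]; exact add_mem hx hy
  | smul c x _ hx => rw [map_smul]; exact Submodule.smul_mem _ _ hx

theorem freeGrading_mul [Group G] (σ : G → G) {g h : G} {a b : FreeStarAlg F G}
    (ha : a ∈ freeGrading F σ g) (hb : b ∈ freeGrading F σ h) :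
    a * b ∈ freeGrading F σ (g * h) := by
  induction ha using Submodule.span_induction with
  | mem x hx =>
    obtain ⟨v, hv, rfl⟩ := hx
    induction hb using Submodule.span_induction with
    | mem x hx =>
      obtain ⟨w, hw, rfl⟩ := hx
      rw [← mono_mul]
      exact Submodule.subset_span ⟨_, by
        rw [Set.mem_ofPred_eq, Word.deg_mul, Set.mem_ofPred.1 hv, Set.mem_ofPred.1 hw], rfl⟩
    | zero => simp
    | add x y _ _ hx hy => rw [mul_add]; exact add_mem hx hy
    | smul c x _ hx => rw [mul_smul_comm]; exact Submodule.smul_mem _ _ hx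
  | zero => simp
  | add x y _ _ hx hy => rw [add_mul]; exact add_mem hx hy
  | smul c x _ hx => rw [smul_mul_assoc]; exact Submodule.smul_mem _ _ hx

variable {F}

/-- The universal property of the free graded algebra with involution. -/
theorem exists_isGradedStarHom [Group G] {σ : G → G} {A : Type*} [NonUnitalRing A] [Module F A]
    [IsScalarTower F A A] [SMulCommClass F A A] {𝒜 : G → Submodule F A}
    (hmul : ∀ g h a b, a ∈ 𝒜 g → b ∈ 𝒜 h → a * b ∈ 𝒜 (g * h)) {inv : A →ₗ[F] A}
    (hinv : IsHomogeneousInvolution 𝒜 σ inv) (θ : G → ℕ → A) (hθ : ∀ g i, θ g i ∈ 𝒜 g) :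
    ∃ φ : FreeStarAlg F G →ₙₐ[F] A, IsGradedStarHom (freeGrading F σ) (freeStar F) 𝒜 inv φ ∧
      ∀ g i, φ (var F g i) = θ g i := by
  let ψ : Letter G → A := fun l =>
    if l.starred then inv (θ l.varDeg l.index) else θ l.varDeg l.index
  have hψ : ∀ l, ψ l ∈ 𝒜 (l.deg σ) := by
    rintro ⟨g, i, b⟩
    cases b
    · simpa [ψ, Letter.deg] using hθ g i
    · simpa [ψ, Letter.deg] using hinv.2.2 _ _ (hθ g i)
  have hψs : ∀ l : Letter G, ψ l.star = inv (ψ l) := by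
    rintro ⟨g, i, b⟩
    cases b
    · simp [ψ, Letter.star]
    · simp [ψ, Letter.star, hinv.2.1]
  let φ : FreeStarAlg F G →ₙₐ[F] A := MonoidAlgebra.liftMagma F (FreeSemigroup.lift ψ)
  have hφ : ∀ w, φ (mono F w) = FreeSemigroup.lift ψ w := fun w => by
    simp [φ, mono, MonoidAlgebra.liftMagma_apply_apply]
  refine ⟨φ, ⟨fun g a ha => ?_, fun a => ?_⟩, fun g i => ?_⟩
  · induction ha using Submodule.span_induction with
    | mem x hx =>
      obtain ⟨w, hw, rfl⟩ := hx
      rw [hφ, ← Set.mem_ofPred.1 hw]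
      clear hw
      induction w using FreeSemigroup.recOnMul with
      | ih1 l => simpa [Word.deg] using hψ l
      | ih2 l w h1 h2 => rw [map_mul, Word.deg_mul]; exact hmul _ _ _ _ h1 h2
    | zero => simp
    | add x y _ _ hx hy => rw [map_add]; exact add_mem hx hy
    | smul c x _ hx => rw [map_smul]; exact Submodule.smul_mem _ _ hx
  · induction a using freeStarAlg_induction with
    | h0 => simp
    | hadd f f' h h' => simp [h, h']
    | hmono c w =>
      rw [map_smul, map_smul, map_smul, map_smul, freeStar_mono, hφ, hφ]
      congr 1
      induction w using FreeSemigroup.recOnMul with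
      | ih1 l => simp [Word.star_of, hψs]
      | ih2 l w h1 h2 => rw [Word.star_mul, map_mul, map_mul, hinv.1, h1, h2]
  · rw [var, hφ]; simp [ψ]

/-! ### `T`-ideals -/

theorem isTIdeal_tIdeal [Group G] (σ : G → G) (S : Set (FreeStarAlg F G)) :
    IsTIdeal σ (tIdeal σ S) := by
  refine ⟨fun a f hf => ⟨?_, ?_⟩, fun f hf => ?_, fun φ hφ f hf => ?_⟩ <;>
    rw [tIdeal, Submodule.mem_sInf] at hf ⊢ <;> intro J hJ
  · exact (hJ.2.1 a f (hf J hJ)).1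
  · exact (hJ.2.1 a f (hf J hJ)).2
  · exact hJ.2.2.1 f (hf J hJ)
  · exact hJ.2.2.2 φ hφ f (hf J hJ)

theorem subset_tIdeal [Group G] (σ : G → G) (S : Set (FreeStarAlg F G)) :
    S ⊆ tIdeal σ S := fun f hf => by
  rw [SetLike.mem_coe, tIdeal, Submodule.mem_sInf]
  exact fun J hJ => hJ.1 hf

theorem tIdeal_le [Group G] {σ : G → G} {S : Set (FreeStarAlg F G)}
    {J : Submodule F (FreeStarAlg F G)} (hJ : IsTIdeal σ J) (hS : S ⊆ J) : tIdeal σ S ≤ J :=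
  sInf_le ⟨hS, hJ⟩

theorem isTIdeal_gradedStarIdentities [Group G] {σ : G → G} {A : Type*} [NonUnitalRing A]
    [Module F A] (𝒜 : G → Submodule F A) (inv : A →ₗ[F] A) :
    IsTIdeal σ (gradedStarIdentities σ 𝒜 inv) := by
  refine ⟨fun a f hf => ⟨fun φ hφ => ?_, fun φ hφ => ?_⟩, fun f hf φ hφ => ?_,
    fun ψ hψ f hf φ hφ => ?_⟩
  · rw [map_mul, hf φ hφ, mul_zero]
  · rw [map_mul, hf φ hφ, zero_mul]
  · rw [hφ.2, hf φ hφ, map_zero]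
  · exact hf (φ.comp ψ) ⟨fun g a ha => hφ.1 g _ (hψ.1 g a ha), fun a => by
      rw [NonUnitalAlgHom.comp_apply, NonUnitalAlgHom.comp_apply, hψ.2, hφ.2]⟩

end Words

theorem freeStar_isHomogeneousInvolution_genStar (F : Type*) [Field F] (n : ℕ) :
    IsHomogeneousInvolution (freeGrading F (genStar n)) (genStar n) (freeStar F) :=
  freeStar_isHomogeneousInvolution F genStar_one genStar_mul genStar_genStar

/-- Substitution of homogeneous elements in the generating `T`-ideal. -/
theorem exists_substitution {F : Type*} [Field F] {n : ℕ} (ε : F)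
    (θ : FG n → ℕ → FreeStarAlg F (FG n)) (hθ : ∀ g i, θ g i ∈ freeGrading F (genStar n) g) :
    ∃ φ : FreeStarAlg F (FG n) →ₙₐ[F] FreeStarAlg F (FG n),
      (∀ g i, φ (var F g i) = θ g i) ∧ (∀ f, φ (freeStar F f) = freeStar F (φ f)) ∧
      ∀ f, IsGenerator F n ε f → φ f ∈ genTIdeal F n ε := by
  obtain ⟨φ, hφ, hv⟩ := exists_isGradedStarHom
    (fun g h a b ha hb => freeGrading_mul F (genStar n) ha hb)
    (freeStar_isHomogeneousInvolution_genStar F n) θ hθ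
  exact ⟨φ, hv, hφ.2, fun f hf => (isTIdeal_tIdeal _ _).2.2 φ hφ f (subset_tIdeal _ _ hf)⟩

/-! ### Calculation modulo the generating ideal -/

section Calculus

variable {F : Type*} [Field F] {n : ℕ}

/-- The class of a monomial modulo the generating `T`-ideal. -/
noncomputable def genClass (ε : F) (L : List (Letter (FG n))) :
    FreeStarAlg F (FG n) ⧸ genTIdeal F n ε := (genTIdeal F n ε).mkQ (lmono F L)

theorem genClass_eq_smul_iff {ε c : F} {L M : List (Letter (FG n))} :
    genClass ε L = c • genClass ε M ↔ lmono F L - c • lmono F M ∈ genTIdeal F n ε := by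
  rw [genClass, genClass, ← map_smul, Submodule.mkQ_apply, Submodule.mkQ_apply,
    Submodule.Quotient.eq]

theorem genClass_eq_zero_iff {ε : F} {L : List (Letter (FG n))} :
    genClass ε L = 0 ↔ lmono F L ∈ genTIdeal F n ε := by
  rw [genClass, Submodule.mkQ_apply, Submodule.Quotient.mk_eq_zero]

theorem genClass_toList (ε : F) (w : Word (FG n)) :
    genClass ε w.toList = (genTIdeal F n ε).mkQ (mono F w) := rfl

/-- The ideal is two-sided. L and M must be nonempty because `lmono` sends the empty list to 0 and
not to a unit. -/
theorem genClass_congr {ε c : F} {L M : List (Letter (FG n))} (hL : L ≠ []) (hM : M ≠ [])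
    (h : genClass ε L = c • genClass ε M) (A B : List (Letter (FG n))) :
    genClass ε (A ++ L ++ B) = c • genClass ε (A ++ M ++ B) := by
  rw [genClass_eq_smul_iff] at h ⊢
  have hI := (isTIdeal_tIdeal (genStar n) {f | IsGenerator F n ε f}).1
  have h1 : lmono F (A ++ L) - c • lmono F (A ++ M) ∈ genTIdeal F n ε := by
    by_cases hA : A = []
    · simpa [hA] using h
    · rw [lmono_append F hA hL, lmono_append F hA hM, ← mul_smul_comm, ← mul_sub]
      exact (hI _ _ h).1
  by_cases hB : B = []
  · simpa [hB] using h1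
  · rw [lmono_append F (by simp [hL]) hB, lmono_append F (by simp [hM]) hB, ← smul_mul_assoc,
      ← sub_mul]
    exact (hI _ _ h1).2

theorem genClass_congr_of_sub_mem {ε : F} {L M : List (Letter (FG n))} (hL : L ≠ [])
    (hM : M ≠ []) (h : lmono F L - lmono F M ∈ genTIdeal F n ε) (A B : List (Letter (FG n))) :
    genClass ε (A ++ L ++ B) = genClass ε (A ++ M ++ B) := by
  have := genClass_congr (c := (1 : F)) hL hM (genClass_eq_smul_iff.2 (by rwa [one_smul])) A B
  rwa [one_smul] at this

theorem genClass_congr_zero {ε : F} {L : List (Letter (FG n))} (hL : L ≠ [])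
    (h : genClass ε L = 0) (A B : List (Letter (FG n))) : genClass ε (A ++ L ++ B) = 0 := by
  have := genClass_congr (c := (0 : F)) hL hL (by rw [h, zero_smul]) A B
  rwa [zero_smul] at this

theorem exists_of_mem_elemSupport {g : FG n} (h : g ∈ elemSupport F (fineSeq n)) :
    ∃ i j : Fin n, i ≤ j ∧ g = elemDeg (fineSeq n) i j := by
  obtain ⟨A, hA, hA0⟩ := (Submodule.ne_bot_iff _).1 h
  by_contra! hne
  refine hA0 (Subtype.ext (Matrix.ext fun i j => ?_))
  by_contra h0
  rcases le_or_gt i j with hij | hij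
  · exact hne i j hij (hA i j h0).symm
  · exact h0 (A.2 i j hij)

/-- Substitute the whole word for the variable of the generator of the same degree; the next lemmas
use this device for the other generators. -/
theorem genClass_eq_zero_of_deg {ε : F} {L : List (Letter (FG n))}
    (h : ¬ ∃ i j : Fin n, i ≤ j ∧ listDeg (genStar n) L = elemDeg (fineSeq n) i j) :
    genClass ε L = 0 := by
  classical
  have hg : listDeg (genStar n) L ∉ elemSupport F (fineSeq n) :=
    fun h' => h (exists_of_mem_elemSupport h')
  obtain ⟨φ, hv, -, hI⟩ := exists_substitution ε
    (fun g _ => if listDeg (genStar n) L = g then lmono F L else 0) (fun g i => by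
      split_ifs with h
      · exact h ▸ lmono_mem_freeGrading F _ L
      · exact zero_mem _)
  have := hI _ (IsGenerator.offSupport _ hg)
  rw [hv, if_pos rfl] at this
  exact genClass_eq_zero_iff.2 this

theorem genClass_listStar {ε : F} {L : List (Letter (FG n))}
    (h : IsSymmetricDeg (listDeg (genStar n) L)) :
    genClass ε (listStar L) = ε • genClass ε L := by
  classical
  obtain ⟨φ, hv, hs, hI⟩ := exists_substitution ε
    (fun g _ => if listDeg (genStar n) L = g then lmono F L else 0) (fun g i => by
      split_ifs with h
      · exact h ▸ lmono_mem_freeGrading F _ L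
      · exact zero_mem _)
  have := hI _ (IsGenerator.symm _ h)
  rw [map_sub, map_smul, hs, hv, if_pos rfl, freeStar_lmono] at this
  exact genClass_eq_smul_iff.2 this

theorem IsSymmetricDeg.ne_one {g : FG n} (h : IsSymmetricDeg g) : g ≠ 1 := by
  obtain ⟨i, j, hij, -, rfl⟩ := h
  exact elemDeg_ne_one hij

theorem ne_nil_of_isSymmetricDeg {L : List (Letter (FG n))}
    (h : IsSymmetricDeg (listDeg (genStar n) L)) : L ≠ [] := by
  rintro rfl
  exact h.ne_one rfl

theorem listDeg_listStar_genStar (L : List (Letter (FG n))) :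
    listDeg (genStar n) (listStar L) = genStar n (listDeg (genStar n) L) :=
  listDeg_listStar genStar_one genStar_mul genStar_genStar L

/-- Two monomials differ by the application of `∗` to a factor of symmetric degree. -/
def Flip (L M : List (Letter (FG n))) : Prop :=
  ∃ A U B, IsSymmetricDeg (listDeg (genStar n) U) ∧ L = A ++ U ++ B ∧ M = A ++ listStar U ++ B

theorem Flip.genClass_eq {ε : F} {L M : List (Letter (FG n))} (h : Flip L M) :
    genClass ε M = ε • genClass ε L := by
  obtain ⟨A, U, B, hU, rfl, rfl⟩ := h
  have hne := ne_nil_of_isSymmetricDeg hU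
  exact genClass_congr (by rwa [Ne, listStar_eq_nil]) hne (genClass_listStar hU) A B

theorem Flip.symm {L M : List (Letter (FG n))} (h : Flip L M) : Flip M L := by
  obtain ⟨A, U, B, hU, rfl, rfl⟩ := h
  exact ⟨A, listStar U, B, by rwa [listDeg_listStar_genStar, hU.genStar_eq], rfl,
    by rw [listStar_listStar]⟩

theorem Flip.cons {L M : List (Letter (FG n))} (h : Flip L M) (l : Letter (FG n)) :
    Flip (l :: L) (l :: M) := by
  obtain ⟨A, U, B, hU, rfl, rfl⟩ := h
  exact ⟨l :: A, U, B, hU, rfl, rfl⟩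

theorem Flip.listStar {L M : List (Letter (FG n))} (h : Flip L M) :
    Flip (listStar L) (listStar M) := by
  obtain ⟨A, U, B, hU, rfl, rfl⟩ := h
  refine ⟨_root_.listStar B, _root_.listStar U, _root_.listStar A, ?_, ?_, ?_⟩
  · rwa [listDeg_listStar_genStar, hU.genStar_eq]
  · simp [listStar_append]
  · simp [listStar_append]

/-- The reflexive and transitive closure of `Flip`. -/
abbrev FlipRel : List (Letter (FG n)) → List (Letter (FG n)) → Prop :=
  Relation.ReflTransGen Flip

theorem FlipRel.cons {L M : List (Letter (FG n))} (h : FlipRel L M) (l : Letter (FG n)) :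
    FlipRel (l :: L) (l :: M) :=
  Relation.ReflTransGen.lift (l :: ·) (fun _ _ h => Flip.cons h l) _ _ h

theorem FlipRel.listStar {L M : List (Letter (FG n))} (h : FlipRel L M) :
    FlipRel (listStar L) (listStar M) :=
  Relation.ReflTransGen.lift _root_.listStar (fun _ _ h => Flip.listStar h) _ _ h

theorem FlipRel.symm {L M : List (Letter (FG n))} (h : FlipRel L M) : FlipRel M L := by
  induction h with
  | refl => exact Relation.ReflTransGen.refl
  | tail _ h ih => exact Relation.ReflTransGen.head h.symm ih

theorem FlipRel.genClass_eq {ε : F} (hε : ε ≠ 0) {L M : List (Letter (FG n))}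
    (h : FlipRel L M) : ∃ c : F, c ≠ 0 ∧ genClass ε M = c • genClass ε L := by
  induction h with
  | refl => exact ⟨1, one_ne_zero, (one_smul _ _).symm⟩
  | tail _ h ih =>
    obtain ⟨c, hc, h'⟩ := ih
    exact ⟨ε * c, mul_ne_zero hε hc, by rw [h.genClass_eq, h', smul_smul]⟩

theorem genClass_swap {ε : F} {K L : List (Letter (FG n))} (hK : K ≠ []) (hL : L ≠ [])
    (hK1 : listDeg (genStar n) K = 1) (hL1 : listDeg (genStar n) L = 1)
    (A B : List (Letter (FG n))) :
    genClass ε (A ++ (K ++ L) ++ B) = genClass ε (A ++ (L ++ K) ++ B) := by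
  classical
  obtain ⟨φ, hv, hs, hI⟩ := exists_substitution ε
    (fun g i => if 1 = g then (if i = 1 then lmono F K else lmono F L) else 0) (fun g i => by
      split_ifs with h h'
      · rw [← h, ← hK1]; exact lmono_mem_freeGrading F _ K
      · rw [← h, ← hL1]; exact lmono_mem_freeGrading F _ L
      · exact zero_mem _)
  have := hI _ IsGenerator.comm
  rw [map_sub, map_mul, map_mul, hv, hv, if_pos rfl, if_pos rfl, if_pos rfl, if_neg (by simp),
    ← lmono_append F hK hL, ← lmono_append F hL hK] at this
  exact genClass_congr_of_sub_mem (by simp [hK]) (by simp [hL]) this A B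

theorem genClass_perm {ε : F} {K L : List (Letter (FG n))} (h : K.Perm L)
    (hK : ∀ l ∈ K, l.deg (genStar n) = 1) (A B : List (Letter (FG n))) :
    genClass ε (A ++ K ++ B) = genClass ε (A ++ L ++ B) := by
  induction h generalizing A with
  | nil => rfl
  | cons x h ih =>
    have := ih (fun l hl => hK l (List.mem_cons_of_mem _ hl)) (A ++ [x])
    simpa using this
  | swap x y l =>
    have := genClass_swap (ε := ε) (K := [y]) (L := [x]) (by simp) (by simp)
      (by simp [listDeg, hK]) (by simp [listDeg, hK]) A (l ++ B)
    simpa using this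
  | trans h1 _ ih1 ih2 =>
    rw [ih1 hK, ih2 fun l hl => hK l (h1.mem_iff.2 hl)]

/-- Both sU and U s∗ have symmetric degree up to the trivial factor, and each flips to U∗ s∗ with
factor ε; the two signs cancel. -/
theorem genClass_move_right {ε : F} (hε : ε * ε = 1) {s : Letter (FG n)}
    (hs : s.deg (genStar n) = 1) {U : List (Letter (FG n))}
    (hU : IsSymmetricDeg (listDeg (genStar n) U)) (A B : List (Letter (FG n))) :
    genClass ε (A ++ [s] ++ U ++ B) = genClass ε (A ++ U ++ [s.star] ++ B) := by
  have h1 : Flip (A ++ [s] ++ U ++ B) (A ++ (listStar U ++ [s.star]) ++ B) :=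
    ⟨A, [s] ++ U, B, by rwa [listDeg_append, show listDeg (genStar n) [s] = 1 by
      simp [listDeg, hs], one_mul], by simp, by simp [listStar]⟩
  have h2 : Flip (A ++ U ++ [s.star] ++ B) (A ++ (listStar U ++ [s.star]) ++ B) :=
    ⟨A, U, [s.star] ++ B, hU, by simp, by simp⟩
  have := (h1.genClass_eq (ε := ε)).symm.trans h2.genClass_eq
  have := congrArg (ε • ·) this
  simpa only [smul_smul, hε, one_smul] using this

theorem genClass_move_left {ε : F} (hε : ε * ε = 1) {s : Letter (FG n)}
    (hs : s.deg (genStar n) = 1) {U : List (Letter (FG n))}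
    (hU : IsSymmetricDeg (listDeg (genStar n) U)) (A B : List (Letter (FG n))) :
    genClass ε (A ++ U ++ [s] ++ B) = genClass ε (A ++ [s.star] ++ U ++ B) := by
  have := genClass_move_right hε (s := s.star) (U := U)
    (by rw [Letter.deg_star genStar_genStar, hs, genStar_one]) hU A B
  rw [this, Letter.star_star]

theorem lmono_middle_mem (ε : F) {k : ℕ} (hn : n = 2 * k + 1) {c i : Fin n} (hc : c.val = k)
    (hi : c < i) {s z : Letter (FG n)} (hs : s.deg (genStar n) = 1)
    (hz : z.deg (genStar n) = elemDeg (fineSeq n) c i) :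
    lmono F [s.star, z] - lmono F [s, z] ∈ genTIdeal F n ε := by
  classical
  -- The substitution below looks only at degrees, so the two variables of the generator must have
  -- different ones.
  have hne : (1 : FG n) ≠ elemDeg (fineSeq n) c i := (elemDeg_ne_one hi).symm
  obtain ⟨φ, hv, hst, hI⟩ := exists_substitution ε
    (fun g i => if listDeg (genStar n) [s] = g then lmono F [s] else
      if listDeg (genStar n) [z] = g then lmono F [z] else 0) (fun g i => by
      split_ifs with h h'
      · exact h ▸ lmono_mem_freeGrading F _ _
      · exact h' ▸ lmono_mem_freeGrading F _ _
      · exact zero_mem _)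
  have h1 : listDeg (genStar n) [s] = 1 := by simp [listDeg, hs]
  have h2 : listDeg (genStar n) [z] = elemDeg (fineSeq n) c i := by simp [listDeg, hz]
  have := hI _ (IsGenerator.middle k hn c i hc hi)
  rw [map_mul, map_sub, hst, hv, hv, if_pos h1, if_neg (by rwa [h1]), if_pos h2, freeStar_lmono,
    sub_mul, ← lmono_append F (by simp [listStar]) (by simp),
    ← lmono_append F (by simp) (by simp)] at this
  exact this

theorem genClass_middle_left (ε : F) {k : ℕ} (hn : n = 2 * k + 1) {c i : Fin n}
    (hc : c.val = k) (hi : c < i) {s z : Letter (FG n)} (hs : s.deg (genStar n) = 1)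
    (hz : z.deg (genStar n) = elemDeg (fineSeq n) c i) (A B : List (Letter (FG n))) :
    genClass ε (A ++ [s, z] ++ B) = genClass ε (A ++ [s.star, z] ++ B) := by
  exact (genClass_congr_of_sub_mem (by simp) (by simp)
    (lmono_middle_mem ε hn hc hi hs hz) A B).symm

/-- The mirror image of `genClass_middle_left`: the ideal is stable under ∗, and the middle index is
its own reflection. -/
theorem genClass_middle_right (ε : F) {k : ℕ} (hn : n = 2 * k + 1) {c i : Fin n}
    (hc : c.val = k) (hi : i < c) {s z : Letter (FG n)} (hs : s.deg (genStar n) = 1)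
    (hz : z.deg (genStar n) = elemDeg (fineSeq n) i c) (A B : List (Letter (FG n))) :
    genClass ε (A ++ [z, s] ++ B) = genClass ε (A ++ [z, s.star] ++ B) := by
  have hrev : c.rev = c := Fin.ext (by rw [Fin.val_rev]; omega)
  have h := lmono_middle_mem (F := F) ε hn hc (i := i.rev) (by
    rw [← hrev]; exact Fin.rev_lt_rev.2 hi) hs (z := z.star) (by
    rw [Letter.deg_star genStar_genStar, hz, genStar_elemDeg, hrev])
  have h := (isTIdeal_tIdeal (genStar n) {f | IsGenerator F n ε f}).2.1 _ h
  rw [map_sub, freeStar_lmono, freeStar_lmono] at h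
  simp only [listStar, List.map_cons, List.map_nil, Letter.star_star, List.reverse_cons,
    List.reverse_nil, List.nil_append, List.cons_append] at h
  exact genClass_congr_of_sub_mem (by simp) (by simp) h A B

theorem genClass_star_of_eq_one (ε : F) (hn : n = 1) {s : Letter (FG n)}
    (hs : s.deg (genStar n) = 1) (A B : List (Letter (FG n))) :
    genClass ε (A ++ [s.star] ++ B) = ε • genClass ε (A ++ [s] ++ B) := by
  classical
  obtain ⟨φ, hv, hst, hI⟩ := exists_substitution ε
    (fun g _ => if listDeg (genStar n) [s] = g then lmono F [s] else 0) (fun g i => by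
      split_ifs with h
      · exact h ▸ lmono_mem_freeGrading F _ _
      · exact zero_mem _)
  have h1 : listDeg (genStar n) [s] = 1 := by simp [listDeg, hs]
  have := hI _ (IsGenerator.symmOne hn)
  rw [map_sub, map_smul, hst, hv, if_pos h1, freeStar_lmono] at this
  exact genClass_congr (by simp [listStar]) (by simp) (genClass_eq_smul_iff.2 this) A B

theorem powSucc_lmono {G : Type*} (s : Letter G) (k : ℕ) :
    powSucc (lmono F [s]) k = lmono F (List.replicate (k + 1) s) := by
  induction k with
  | zero => rfl
  | succ k ih =>
    rw [powSucc, ih, ← lmono_append F (by simp) (by simp), ← List.replicate_succ']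

theorem map_powSucc {A B : Type*} [NonUnitalRing A] [Module F A] [NonUnitalRing B] [Module F B]
    (φ : A →ₙₐ[F] B) (a : A) (k : ℕ) : φ (powSucc a k) = powSucc (φ a) k := by
  induction k with
  | zero => rfl
  | succ k ih => rw [powSucc, powSucc, map_mul, ih]

theorem genClass_frobenius (ε : F) [Finite F] {s : Letter (FG n)}
    (hs : s.deg (genStar n) = 1) (A B : List (Letter (FG n))) :
    genClass ε (A ++ List.replicate (Nat.card F) s ++ B) = genClass ε (A ++ [s] ++ B) := by
  classical
  obtain ⟨φ, hv, hst, hI⟩ := exists_substitution ε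
    (fun g _ => if listDeg (genStar n) [s] = g then lmono F [s] else 0) (fun g i => by
      split_ifs with h
      · exact h ▸ lmono_mem_freeGrading F _ _
      · exact zero_mem _)
  have h1 : listDeg (genStar n) [s] = 1 := by simp [listDeg, hs]
  have hq : Nat.card F - 1 + 1 = Nat.card F := Nat.sub_add_cancel Nat.card_pos
  have := hI _ (IsGenerator.frob inferInstance)
  rw [map_sub, map_powSucc, hv, if_pos h1, powSucc_lmono, hq] at this
  exact genClass_congr_of_sub_mem (by simp [Nat.card_pos.ne']) (by simp) this A B

end Calculus

/-! ### Words that are composable sequences of matrix units -/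

section Paths

variable {n : ℕ}

/-- The degrees of the letters are those of strictly upper triangular matrix units which form a
path from `a` to `b`. -/
def IsPath : Fin n → List (Letter (FG n)) → Fin n → Prop
  | a, [], b => a = b
  | a, l :: L, b => ∃ q, a < q ∧ l.deg (genStar n) = elemDeg (fineSeq n) a q ∧ IsPath q L b

theorem IsPath.le {a b : Fin n} {L : List (Letter (FG n))} (h : IsPath a L b) : a ≤ b := by
  induction L generalizing a with
  | nil => exact le_of_eq h
  | cons l L ih =>
    obtain ⟨q, hq, -, h⟩ := h
    exact hq.le.trans (ih h)

theorem IsPath.lt {a b : Fin n} {L : List (Letter (FG n))} (h : IsPath a L b) (hL : L ≠ []) :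
    a < b := by
  cases L with
  | nil => exact absurd rfl hL
  | cons l L =>
    obtain ⟨q, hq, -, h⟩ := h
    exact hq.trans_le h.le

theorem isPath_append {a b : Fin n} {L M : List (Letter (FG n))} :
    IsPath a (L ++ M) b ↔ ∃ c, IsPath a L c ∧ IsPath c M b := by
  induction L generalizing a with
  | nil => simp [IsPath]
  | cons l L ih =>
    simp only [List.cons_append, IsPath, ih]
    constructor
    · rintro ⟨q, h1, h2, c, h3, h4⟩; exact ⟨c, ⟨q, h1, h2, h3⟩, h4⟩
    · rintro ⟨c, ⟨q, h1, h2, h3⟩, h4⟩; exact ⟨q, h1, h2, c, h3, h4⟩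

theorem isPath_singleton {a b : Fin n} {l : Letter (FG n)} :
    IsPath a [l] b ↔ a < b ∧ l.deg (genStar n) = elemDeg (fineSeq n) a b := by
  constructor
  · rintro ⟨q, h1, h2, rfl⟩; exact ⟨h1, h2⟩
  · rintro ⟨h1, h2⟩; exact ⟨b, h1, h2, rfl⟩

theorem IsPath.listDeg_eq {a b : Fin n} {L : List (Letter (FG n))} (h : IsPath a L b) :
    listDeg (genStar n) L = elemDeg (fineSeq n) a b := by
  induction L generalizing a with
  | nil => cases h; simp [listDeg, elemDeg_self]
  | cons l L ih =>
    obtain ⟨q, hq, h1, h⟩ := h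
    rw [listDeg_cons, h1, ih h, elemDeg_mul hq.le h.le]

theorem IsPath.listStar {a b : Fin n} {L : List (Letter (FG n))} (h : IsPath a L b) :
    IsPath b.rev (listStar L) a.rev := by
  induction L generalizing a with
  | nil => cases h; rfl
  | cons l L ih =>
    obtain ⟨q, hq, h1, h⟩ := h
    rw [show _root_.listStar (l :: L) = _root_.listStar L ++ [l.star] by simp [_root_.listStar],
      isPath_append]
    refine ⟨q.rev, ih h, isPath_singleton.2 ⟨Fin.rev_lt_rev.2 hq, ?_⟩⟩
    rw [Letter.deg_star genStar_genStar, h1, genStar_elemDeg]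

theorem IsPath.exists_of_mem {a b : Fin n} {L : List (Letter (FG n))} (h : IsPath a L b)
    {l : Letter (FG n)} (hl : l ∈ L) :
    ∃ A B p q, L = A ++ l :: B ∧ IsPath a A p ∧ p < q ∧
      l.deg (genStar n) = elemDeg (fineSeq n) p q ∧ IsPath q B b := by
  obtain ⟨A, B, rfl⟩ := List.append_of_mem hl
  obtain ⟨p, h1, q, h2, h3, h4⟩ := isPath_append.1 h
  exact ⟨A, B, p, q, rfl, h1, h2, h3, h4⟩

theorem IsPath.deg_ne_one {a b : Fin n} {L : List (Letter (FG n))} (h : IsPath a L b)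
    {l : Letter (FG n)} (hl : l ∈ L) : l.deg (genStar n) ≠ 1 := by
  obtain ⟨A, B, p, q, -, -, hpq, hd, -⟩ := h.exists_of_mem hl
  rw [hd]; exact elemDeg_ne_one hpq

theorem IsPath.bounds {a b : Fin n} {L : List (Letter (FG n))} (h : IsPath a L b)
    {l : Letter (FG n)} (hl : l ∈ L) {p q : Fin n} (hpq : p < q)
    (hd : l.deg (genStar n) = elemDeg (fineSeq n) p q) : a ≤ p ∧ q ≤ b := by
  obtain ⟨A, B, p', q', -, h1, -, h3, h4⟩ := h.exists_of_mem hl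
  obtain ⟨rfl, rfl⟩ := elemDeg_inj hpq (hd.symm.trans h3)
  exact ⟨h1.le, h4.le⟩

theorem IsPath.eq_cons {a b : Fin n} {L : List (Letter (FG n))} (h : IsPath a L b)
    {l : Letter (FG n)} (hl : l ∈ L) {q : Fin n} (hq : a < q)
    (hd : l.deg (genStar n) = elemDeg (fineSeq n) a q) : ∃ M, L = l :: M ∧ IsPath q M b := by
  obtain ⟨A, B, p', q', rfl, h1, -, h3, h4⟩ := h.exists_of_mem hl
  obtain ⟨rfl, rfl⟩ := elemDeg_inj hq (hd.symm.trans h3)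
  have : A = [] := by
    by_contra hA
    exact absurd (h1.lt hA) (lt_irrefl _)
  subst this
  exact ⟨B, rfl, h4⟩

theorem IsPath.eq_concat {a b : Fin n} {L : List (Letter (FG n))} (h : IsPath a L b)
    {l : Letter (FG n)} (hl : l ∈ L) {p : Fin n} (hp : p < b)
    (hd : l.deg (genStar n) = elemDeg (fineSeq n) p b) : ∃ M, L = M ++ [l] := by
  obtain ⟨A, B, p', q', rfl, h1, -, h3, h4⟩ := h.exists_of_mem hl
  obtain ⟨rfl, rfl⟩ := elemDeg_inj hp (hd.symm.trans h3)
  have : B = [] := by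
    by_contra hB
    exact absurd (h4.lt hB) (lt_irrefl _)
  subst this
  exact ⟨A, rfl⟩

/-- The variable of a letter. -/
def Letter.variable {G : Type*} (l : Letter G) : G × ℕ := (l.varDeg, l.index)

/-- The set of the variables that occur in a list of letters. -/
def varSet {G : Type*} (L : List (Letter G)) : Set (G × ℕ) := {x | ∃ l ∈ L, l.variable = x}

theorem Letter.eq_or_eq_star {G : Type*} {l m : Letter G} (h : l.variable = m.variable) :
    l = m ∨ l = m.star := by
  obtain ⟨g, i, b⟩ := l
  obtain ⟨g', i', b'⟩ := m
  obtain ⟨rfl, rfl⟩ := Prod.mk.inj h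
  cases b <;> cases b' <;> simp [Letter.star]

theorem varSet_listStar {G : Type*} (L : List (Letter G)) : varSet (listStar L) = varSet L := by
  ext x
  constructor
  · rintro ⟨l, hl, rfl⟩
    simp only [listStar, List.mem_reverse, List.mem_map] at hl
    obtain ⟨m, hm, rfl⟩ := hl
    exact ⟨m, hm, rfl⟩
  · rintro ⟨l, hl, rfl⟩
    exact ⟨l.star, by simpa [listStar] using ⟨l, hl, rfl⟩, rfl⟩

theorem varSet_cons {G : Type*} (l : Letter G) (L : List (Letter G)) :
    varSet (l :: L) = insert l.variable (varSet L) := by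
  ext x
  constructor
  · rintro ⟨m, hm, rfl⟩
    rcases List.mem_cons.1 hm with rfl | hm
    · exact Or.inl rfl
    · exact Or.inr ⟨m, hm, rfl⟩
  · rintro (rfl | ⟨m, hm, rfl⟩)
    · exact ⟨l, List.mem_cons_self, rfl⟩
    · exact ⟨m, List.mem_cons_of_mem _ hm, rfl⟩

theorem mem_or_star_mem_of_mem_varSet {G : Type*} {L : List (Letter G)} {l : Letter G}
    (h : l.variable ∈ varSet L) : l ∈ L ∨ l.star ∈ L := by
  obtain ⟨m, hm, h⟩ := h
  rcases Letter.eq_or_eq_star h with rfl | rfl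
  · exact Or.inl hm
  · exact Or.inr hm

/-- If a path starts with `l`, then the variable of `l` can occur in the rest only as `l∗`. -/
theorem IsPath.star_mem_of_variable_mem_tail {a b : Fin n} {l : Letter (FG n)}
    {L : List (Letter (FG n))} {q : Fin n} (hq : a < q)
    (hl : l.deg (genStar n) = elemDeg (fineSeq n) a q) (h : IsPath q L b)
    (hmem : l.variable ∈ varSet L) : l.star ∈ L := by
  rcases mem_or_star_mem_of_mem_varSet hmem with h1 | h1
  · exact absurd (h.bounds h1 hq hl).1 (not_le.2 hq)
  · exact h1

theorem deg_star_of_deg {l : Letter (FG n)} {p q : Fin n}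
    (h : l.deg (genStar n) = elemDeg (fineSeq n) p q) :
    l.star.deg (genStar n) = elemDeg (fineSeq n) q.rev p.rev := by
  rw [Letter.deg_star genStar_genStar, h, genStar_elemDeg]

/-- Cancelling a common first letter loses only one piece of information: whether its variable
occurs again in the tails. -/
theorem varSet_eq_of_cons {l : Letter (FG n)} {L M : List (Letter (FG n))}
    (h : varSet (l :: L) = varSet (l :: M)) (hl : l.variable ∈ varSet L ↔ l.variable ∈ varSet M) :
    varSet L = varSet M := by
  rw [varSet_cons, varSet_cons] at h
  ext x
  by_cases hx : x = l.variable
  · rw [hx]; exact hl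
  · have := Set.ext_iff.1 h x
    simpa [hx] using this

/-- If the variable of the first letter l recurs, it does so as l∗, which ends at `a.rev` and is
therefore the last letter of the path. The last letter y of the other path also ends at `a.rev`, and
its variable occurs in the first path as y, in last place, or as y∗, in first place. In both cases y
= l∗. -/
theorem variable_mem_tail_symmetric {a q : Fin n} {l : Letter (FG n)}
    {L M : List (Letter (FG n))} (hq : a < q)
    (hl : l.deg (genStar n) = elemDeg (fineSeq n) a q)
    (hL : IsPath q L a.rev) (hM : IsPath q M a.rev) (hv : varSet (l :: L) = varSet (l :: M))
    (h : l.variable ∈ varSet L) : l.variable ∈ varSet M := by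
  have hs := hL.star_mem_of_variable_mem_tail hq hl h
  have hsd := deg_star_of_deg hl
  have hrev : q.rev < a.rev := Fin.rev_lt_rev.2 hq
  have hqb : q < a.rev := hL.lt (List.ne_nil_of_mem hs)
  have hMne : M ≠ [] := by
    rintro rfl
    exact hqb.ne hM
  obtain ⟨M', y, rfl⟩ : ∃ M' y, M = M' ++ [y] :=
    ⟨M.dropLast, M.getLast hMne, (List.dropLast_append_getLast hMne).symm⟩
  obtain ⟨p, hM', hy⟩ := isPath_append.1 hM
  obtain ⟨hp, hyd⟩ := isPath_singleton.1 hy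
  have hpath : IsPath a (l :: L) a.rev := ⟨q, hq, hl, hL⟩
  have hyv : y.variable ∈ varSet (l :: L) := by
    rw [hv]; exact ⟨y, by simp, rfl⟩
  -- In `l :: L` only the last letter can end at `a.rev`, and that is `l.star`.
  have hend : ∀ x ∈ l :: L, ∀ p' : Fin n, p' < a.rev →
      x.deg (genStar n) = elemDeg (fineSeq n) p' a.rev → x = l.star := by
    intro x hx p' hp' hxd
    obtain ⟨A, hA⟩ := hpath.eq_concat hx hp' hxd
    obtain ⟨B, hB⟩ := hpath.eq_concat (List.mem_cons_of_mem _ hs) hrev hsd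
    have := hA.symm.trans hB
    exact List.singleton_inj.1 (List.append_inj' this rfl).2
  have hyl : y = l.star := by
    rcases mem_or_star_mem_of_mem_varSet hyv with h1 | h1
    · exact hend y h1 p hp hyd
    · have hyd' := deg_star_of_deg hyd
      rw [Fin.rev_rev] at hyd'
      have hlt : a < p.rev := by rw [← Fin.rev_rev a]; exact Fin.rev_lt_rev.2 hp
      obtain ⟨B, hB, -⟩ := hpath.eq_cons h1 hlt hyd'
      rw [(List.cons.inj hB).1, Letter.star_star]
  exact ⟨y, by simp, by rw [hyl]; rfl⟩

/-- The star of the first letter l would end at `a.rev`, beyond b, so it occurs in neither path.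
Hence l itself occurs in M; as it starts at a, it comes first, and it can be removed from both
paths. -/
theorem flipRel_of_lt_rev {a b : Fin n} (hab : b < a.rev) {L M : List (Letter (FG n))}
    (hne : L ≠ [])
    (hL : IsPath a L b) (hM : IsPath a M b) (hv : varSet L = varSet M)
    (ih : ∀ (a' b' : Fin n) (L' M' : List (Letter (FG n))), L'.length < L.length →
      IsPath a' L' b' → IsPath a' M' b' → varSet L' = varSet M' → FlipRel L' M') :
    FlipRel L M := by
  obtain ⟨l, L, rfl⟩ := List.exists_cons_of_ne_nil hne
  obtain ⟨q, hq, hl, hL'⟩ := hL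
  have hsd := deg_star_of_deg hl
  have hrev : q.rev < a.rev := Fin.rev_lt_rev.2 hq
  have hlM : l.variable ∈ varSet M := by rw [← hv]; exact ⟨l, by simp, rfl⟩
  have hmem : l ∈ M := by
    rcases mem_or_star_mem_of_mem_varSet hlM with h | h
    · exact h
    · exact absurd (hM.bounds h hrev hsd).2 (not_le.2 hab)
  obtain ⟨M', rfl, hM'⟩ := hM.eq_cons hmem hq hl
  have hnot : ∀ N, IsPath q N b → l.variable ∉ varSet N := fun N hN h =>
    absurd (hN.bounds (hN.star_mem_of_variable_mem_tail hq hl h) hrev hsd).2 (not_le.2 hab)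
  refine FlipRel.cons (ih q b L M' (by simp) hL' hM' ?_) l
  exact varSet_eq_of_cons hv ⟨fun h => absurd h (hnot _ hL'), fun h => absurd h (hnot _ hM')⟩

/-- Two paths with the same ends and the same variables are obtained from each other by flips. -/
theorem flipRel_of_isPath (k : ℕ) : ∀ {a b : Fin n} {L M : List (Letter (FG n))},
    L.length = k → IsPath a L b → IsPath a M b → varSet L = varSet M → FlipRel L M := by
  induction k using Nat.strong_induction_on with
  | _ k ih =>
  intro a b L M hk hL hM hv
  have ih' : ∀ (a' b' : Fin n) (L' M' : List (Letter (FG n))), L'.length < L.length →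
      IsPath a' L' b' → IsPath a' M' b' → varSet L' = varSet M' → FlipRel L' M' :=
    fun a' b' L' M' h h1 h2 h3 => ih _ (hk ▸ h) rfl h1 h2 h3
  by_cases hne : L = []
  · subst hne
    have : M = [] := by
      by_contra h
      have h1 : a = b := hL
      exact (hM.lt h).ne h1
    rw [this]
  rcases lt_trichotomy b a.rev with hab | hab | hab
  · exact flipRel_of_lt_rev hab hne hL hM hv ih'
  -- Here the whole path has symmetric degree. If l occurs in the other path, it is its first letter
  -- and is peeled off; otherwise l∗ occurs, and the other path is flipped as a whole beforehand.
  · subst hab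
    obtain ⟨l, L, rfl⟩ := List.exists_cons_of_ne_nil hne
    have key : ∀ N, IsPath a N a.rev → varSet (l :: L) = varSet N → l ∈ N →
        FlipRel (l :: L) N := by
      intro N hN hvN hlN
      obtain ⟨q, hq, hl, hL'⟩ := hL
      obtain ⟨N', rfl, hN'⟩ := hN.eq_cons hlN hq hl
      refine FlipRel.cons (ih' q a.rev L N' (by simp) hL' hN' ?_) l
      exact varSet_eq_of_cons hvN ⟨variable_mem_tail_symmetric hq hl hL' hN' hvN,
        variable_mem_tail_symmetric hq hl hN' hL' hvN.symm⟩
    have hlM : l.variable ∈ varSet M := by rw [← hv]; exact ⟨l, by simp, rfl⟩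
    rcases mem_or_star_mem_of_mem_varSet hlM with h | h
    · exact key M hM hv h
    · have hMs := hM.listStar
      rw [Fin.rev_rev] at hMs
      have h1 := key (listStar M) hMs (by rw [hv, varSet_listStar])
        (by simpa [listStar] using ⟨l.star, h, Letter.star_star l⟩)
      refine h1.trans (Relation.ReflTransGen.single ⟨[], listStar M, [], ?_, by simp, by
        simp [listStar_listStar]⟩)
      rw [hMs.listDeg_eq]
      exact isSymmetricDeg_elemDeg (hL.lt (by simp))
  -- Applying ∗ to both paths exchanges this case with the first one.
  · have := flipRel_of_lt_rev (a := b.rev) (b := a.rev) (by rwa [Fin.rev_rev])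
      (L := listStar L) (M := listStar M) (by rwa [Ne, listStar_eq_nil]) hL.listStar hM.listStar
      (by rw [varSet_listStar, varSet_listStar, hv]) (by rwa [length_listStar])
    have := this.listStar
    rwa [listStar_listStar, listStar_listStar] at this

end Paths

/-! ### Homogeneous involutions of `UT_n` -/

section Involution

variable {F : Type*} [Field F] {n : ℕ}

theorem UT.apply_eq_zero (A : UT F n) {i j : Fin n} (h : j < i) : A.val i j = 0 := A.2 i j h

theorem elemGrading_mul {g h : FG n} {A B : UT F n} (hA : A ∈ elemGrading F (fineSeq n) g)
    (hB : B ∈ elemGrading F (fineSeq n) h) : A * B ∈ elemGrading F (fineSeq n) (g * h) := by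
  intro i j hij
  have hij' : ∑ k, A.val i k * B.val k j ≠ 0 := hij
  obtain ⟨k, -, hk⟩ := Finset.exists_ne_zero_of_sum_ne_zero hij'
  have h1 := left_ne_zero_of_mul hk
  have h2 := right_ne_zero_of_mul hk
  have hik : i ≤ k := not_lt.1 fun h => h1 (UT.apply_eq_zero A h)
  have hkj : k ≤ j := not_lt.1 fun h => h2 (UT.apply_eq_zero B h)
  rw [← elemDeg_mul hik hkj, hA i k h1, hB k j h2]

/-- A homogeneous element whose degree is that of `e_{pq}` is concentrated at the position
`(p, q)`. -/
theorem eq_of_apply_ne_zero {p q : Fin n} (hpq : p < q) {A : UT F n}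
    (hA : A ∈ elemGrading F (fineSeq n) (elemDeg (fineSeq n) p q)) {i j : Fin n}
    (h : A.val i j ≠ 0) : i = p ∧ j = q :=
  elemDeg_inj hpq (hA i j h).symm

theorem apply_eq_zero_of_mem_one {A : UT F n} (hA : A ∈ elemGrading F (fineSeq n) 1)
    {i j : Fin n} (h : i ≠ j) : A.val i j = 0 := by
  by_contra h0
  have h1 := elemDeg_eq_one_iff.1 (hA i j h0)
  exact h0 (UT.apply_eq_zero A (lt_of_le_of_ne h1 h.symm))

variable (F) in
/-- The matrix unit `e_{pq}`, `p ≤ q`, as an element of `UT_n`. -/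
def utUnit (p q : Fin n) (h : p ≤ q) : UT F n :=
  ⟨Matrix.single p q 1, fun i j hij => by
    rw [Matrix.single_apply, if_neg]
    rintro ⟨rfl, rfl⟩
    exact absurd h (not_le.2 hij)⟩

theorem utUnit_apply {p q : Fin n} (h : p ≤ q) (i j : Fin n) :
    (utUnit F p q h).val i j = if p = i ∧ q = j then 1 else 0 := Matrix.single_apply ..

theorem utUnit_mem {p q : Fin n} (h : p ≤ q) :
    utUnit F p q h ∈ elemGrading F (fineSeq n) (elemDeg (fineSeq n) p q) := by
  intro i j hij
  rw [utUnit_apply] at hij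
  have := (ite_ne_right_iff.1 hij).1
  rw [this.1, this.2]

theorem utUnit_mul {p q r : Fin n} (h : p ≤ q) (h' : q ≤ r) :
    utUnit F p q h * utUnit F q r h' = utUnit F p r (h.trans h') :=
  Subtype.ext (by
    change Matrix.single p q (1 : F) * Matrix.single q r 1 = Matrix.single p r 1
    rw [Matrix.single_mul_single_same, one_mul])

theorem utUnit_ne_zero {p q : Fin n} (h : p ≤ q) : utUnit F p q h ≠ 0 := by
  intro h0
  have := congrArg (fun A : UT F n => A.val p q) h0
  simp [utUnit_apply] at this

theorem eq_smul_utUnit {p q : Fin n} (hpq : p < q) {A : UT F n}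
    (hA : A ∈ elemGrading F (fineSeq n) (elemDeg (fineSeq n) p q)) :
    A = A.val p q • utUnit F p q hpq.le := by
  refine Subtype.ext (Matrix.ext fun i j => ?_)
  change A.val i j = A.val p q * (utUnit F p q hpq.le).val i j
  rw [utUnit_apply]
  by_cases h : p = i ∧ q = j
  · rw [if_pos h, h.1, h.2, mul_one]
  · rw [if_neg h, mul_zero]
    by_contra h0
    have := eq_of_apply_ne_zero hpq hA h0
    exact h ⟨this.1.symm, this.2.symm⟩

variable {inv : UT F n →ₗ[F] UT F n}


theorem involution_injective
    (hinv : IsHomogeneousInvolution (elemGrading F (fineSeq n)) (genStar n) inv) :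
    Function.Injective inv := fun a b h => by
  rw [← hinv.2.1 a, h, hinv.2.1]

theorem inv_mem_rev
    (hinv : IsHomogeneousInvolution (elemGrading F (fineSeq n)) (genStar n) inv)
    {p q : Fin n} {A : UT F n}
    (hA : A ∈ elemGrading F (fineSeq n) (elemDeg (fineSeq n) p q)) :
    inv A ∈ elemGrading F (fineSeq n) (elemDeg (fineSeq n) q.rev p.rev) := by
  rw [← genStar_elemDeg]; exact hinv.2.2 _ _ hA

/-- The component of degree `elemDeg (fineSeq n) q.rev p.rev` is a line, so its elements are
determined by this entry, and the involution is injective. -/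
theorem inv_apply_ne_zero
    (hinv : IsHomogeneousInvolution (elemGrading F (fineSeq n)) (genStar n) inv)
    {p q : Fin n} (hpq : p < q) {A : UT F n}
    (hA : A ∈ elemGrading F (fineSeq n) (elemDeg (fineSeq n) p q)) (h0 : A ≠ 0) :
    (inv A).val q.rev p.rev ≠ 0 := by
  intro h
  have := eq_smul_utUnit (Fin.rev_lt_rev.2 hpq) (inv_mem_rev hinv hA)
  rw [h, zero_smul] at this
  exact h0 (involution_injective hinv (this.trans (map_zero inv).symm))

theorem inv_mem_one
    (hinv : IsHomogeneousInvolution (elemGrading F (fineSeq n)) (genStar n) inv)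
    {A : UT F n} (hA : A ∈ elemGrading F (fineSeq n) 1) :
    inv A ∈ elemGrading F (fineSeq n) 1 := by
  have := hinv.2.2 _ _ hA
  rwa [genStar_one] at this

theorem involution_one
    (hinv : IsHomogeneousInvolution (elemGrading F (fineSeq n)) (genStar n) inv) :
    inv 1 = 1 := by
  have h : ∀ a, inv 1 * a = a := fun a => by
    rw [← hinv.2.1 a, ← hinv.1, mul_one]
  simpa using h 1

/-- On diagonal matrices the involution is the reflection. -/
theorem inv_apply_diag
    (hinv : IsHomogeneousInvolution (elemGrading F (fineSeq n)) (genStar n) inv)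
    {A : UT F n} (hA : A ∈ elemGrading F (fineSeq n) 1) (a : Fin n) :
    (inv A).val a a = A.val a.rev a.rev := by
  have hiA := inv_mem_one hinv hA
  have left : ∀ {B C : UT F n}, C ∈ elemGrading F (fineSeq n) 1 → ∀ i j,
      (C * B).val i j = C.val i i * B.val i j := by
    intro B C hC i j
    change ∑ k, C.val i k * B.val k j = _
    exact Finset.sum_eq_single i
      (fun k _ hk => by rw [apply_eq_zero_of_mem_one hC hk.symm, zero_mul]) (by simp)
  have right : ∀ {B C : UT F n}, C ∈ elemGrading F (fineSeq n) 1 → ∀ i j,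
      (B * C).val i j = B.val i j * C.val j j := by
    intro B C hC i j
    change ∑ k, B.val i k * C.val k j = _
    exact Finset.sum_eq_single j
      (fun k _ hk => by rw [apply_eq_zero_of_mem_one hC hk, mul_zero]) (by simp)
  rcases lt_trichotomy a a.rev with h | h | h
  · have hE := utUnit_mem (F := F) h.le
    -- Applying the involution to this equation puts `inv A` on the left of a nonzero multiple of
    -- the same matrix unit, and comparing entries gives the claim. The other cases differ only in
    -- the choice of the matrix unit.
    have h1 : utUnit F a a.rev h.le * A = A.val a.rev a.rev • utUnit F a a.rev h.le := by
      refine Subtype.ext (Matrix.ext fun i j => ?_)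
      rw [right hA]
      change _ = A.val a.rev a.rev * (utUnit F a a.rev h.le).val i j
      rw [utUnit_apply]
      split_ifs with hij
      · rw [← hij.2, mul_comm]
      · simp
    have h2 := congrArg (fun X : UT F n => (inv X).val a.rev.rev a.rev) h1
    simp only [hinv.1, map_smul] at h2
    rw [left hiA, Fin.rev_rev] at h2
    have h3 := inv_apply_ne_zero hinv h hE (utUnit_ne_zero _)
    rw [Fin.rev_rev] at h3
    exact mul_right_cancel₀ h3 h2
  · rw [← h]
    -- For the middle index there is no strictly upper unit from a to its reflection, so a unit
    -- ending at a is used instead.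
    by_cases hne : ∃ b : Fin n, b < a
    · obtain ⟨b, hb⟩ := hne
      have hE := utUnit_mem (F := F) hb.le
      have h1 : utUnit F b a hb.le * A = A.val a a • utUnit F b a hb.le := by
        refine Subtype.ext (Matrix.ext fun i j => ?_)
        rw [right hA]
        change _ = A.val a a * (utUnit F b a hb.le).val i j
        rw [utUnit_apply]
        split_ifs with hij
        · rw [← hij.2, mul_comm]
        · simp
      have h2 := congrArg (fun X : UT F n => (inv X).val a.rev b.rev) h1
      simp only [hinv.1, map_smul] at h2
      rw [left hiA, ← h] at h2
      have h3 := inv_apply_ne_zero hinv hb hE (utUnit_ne_zero _)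
      rw [← h] at h3
      exact mul_right_cancel₀ h3 h2
    -- A self-reflected index with nothing below it has nothing above it either, so n = 1 and A is a
    -- scalar.
    · have hall : ∀ b : Fin n, b = a := by
        intro b
        have h1 : a ≤ b := not_lt.1 fun hb => hne ⟨b, hb⟩
        have h2 : a ≤ b.rev := not_lt.1 fun hb => hne ⟨_, hb⟩
        have h3 := Fin.rev_le_rev.2 h2
        rw [Fin.rev_rev, ← h] at h3
        exact le_antisymm h3 h1
      have hA1 : A = A.val a a • 1 := by
        refine Subtype.ext (Matrix.ext fun i j => ?_)
        rw [hall i, hall j]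
        change _ = A.val a a * (1 : Matrix (Fin n) (Fin n) F) a a
        simp
      have := congrArg inv hA1
      rw [map_smul, involution_one hinv, ← hA1] at this
      rw [this]
  · have hE := utUnit_mem (F := F) h.le
    have h1 : A * utUnit F a.rev a h.le = A.val a.rev a.rev • utUnit F a.rev a h.le := by
      refine Subtype.ext (Matrix.ext fun i j => ?_)
      rw [left hA]
      change _ = A.val a.rev a.rev * (utUnit F a.rev a h.le).val i j
      rw [utUnit_apply]
      split_ifs with hij
      · rw [← hij.1]
      · simp
    have h2 := congrArg (fun X : UT F n => (inv X).val a.rev a.rev.rev) h1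
    simp only [hinv.1, map_smul] at h2
    rw [right hiA, Fin.rev_rev, mul_comm] at h2
    have h3 := inv_apply_ne_zero hinv h hE (utUnit_ne_zero _)
    rw [Fin.rev_rev] at h3
    exact mul_right_cancel₀ h3 h2

/-- An automorphism of `UT_n` maps `e_{1n}` to a multiple of itself. -/
theorem apply_eq_zero_of_algEquiv (φ : UT F n ≃ₐ[F] UT F n) {p q : Fin n} (hpq : p ≤ q)
    (hp : ∀ i, p ≤ i) (hq : ∀ i, i ≤ q) {i j : Fin n}
    (h0 : (φ (utUnit F p q hpq)).val i j ≠ 0) : i = p ∧ j = q := by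
  set y := φ (utUnit F p q hpq) with hy
  -- The corner unit spans a two-sided ideal of dimension one, and this property is carried over to
  -- its image y.
  have hr : ∀ b : UT F n, ∃ c : F, y * b = c • y := by
    intro b
    refine ⟨(φ.symm b).val q q, ?_⟩
    rw [hy, ← map_smul, ← φ.apply_symm_apply b, ← map_mul, φ.symm_apply_apply]
    congr 1
    refine Subtype.ext (Matrix.ext fun i j => ?_)
    change ∑ k, (utUnit F p q hpq).val i k * (φ.symm b).val k j =
      (φ.symm b).val q q * (utUnit F p q hpq).val i j
    simp only [utUnit_apply]
    rw [Finset.sum_eq_single q (fun k _ hk => by rw [if_neg (fun h => hk h.2.symm), zero_mul])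
      (by simp)]
    by_cases hj : q = j
    · subst hj; rw [mul_comm]
    · rw [UT.apply_eq_zero _ (lt_of_le_of_ne (hq j) (Ne.symm hj)), mul_zero,
        if_neg (fun h => hj h.2), mul_zero]
  have hl : ∀ b : UT F n, ∃ c : F, b * y = c • y := by
    intro b
    refine ⟨(φ.symm b).val p p, ?_⟩
    rw [hy, ← map_smul, ← φ.apply_symm_apply b, ← map_mul, φ.symm_apply_apply]
    congr 1
    refine Subtype.ext (Matrix.ext fun i j => ?_)
    change ∑ k, (φ.symm b).val i k * (utUnit F p q hpq).val k j =
      (φ.symm b).val p p * (utUnit F p q hpq).val i j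
    simp only [utUnit_apply]
    rw [Finset.sum_eq_single p (fun k _ hk => by rw [if_neg (fun h => hk h.1.symm), mul_zero])
      (by simp)]
    by_cases hi : p = i
    · subst hi; rfl
    · rw [UT.apply_eq_zero _ (lt_of_le_of_ne (hp i) hi), zero_mul,
        if_neg (fun h => hi h.1), mul_zero]
  constructor
  -- If i ≠ p, row i of e_{pi} y is zero, so the factor c is zero; but row p of e_{pi} y is row i of
  -- y, which is not zero. The columns are treated in the same way.
  · obtain ⟨c, hc⟩ := hl (utUnit F p i (hp i))
    by_contra hi
    have h1 := congrArg (fun X : UT F n => X.val i j) hc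
    have h2 := congrArg (fun X : UT F n => X.val p j) hc
    change ∑ k, (utUnit F p i (hp i)).val i k * y.val k j = c * y.val i j at h1
    change ∑ k, (utUnit F p i (hp i)).val p k * y.val k j = c * y.val p j at h2
    simp only [utUnit_apply] at h1 h2
    rw [Finset.sum_eq_zero (fun k _ => by rw [if_neg (fun h => hi h.1.symm), zero_mul])] at h1
    have hc0 : c = 0 := (mul_eq_zero.1 h1.symm).resolve_right h0
    rw [hc0, zero_mul, Finset.sum_eq_single i
      (fun k _ hk => by rw [if_neg (fun h => hk h.2.symm), zero_mul]) (by simp),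
      if_pos (by simp), one_mul] at h2
    exact h0 h2
  · obtain ⟨c, hc⟩ := hr (utUnit F j q (hq j))
    by_contra hj
    have h1 := congrArg (fun X : UT F n => X.val i j) hc
    have h2 := congrArg (fun X : UT F n => X.val i q) hc
    change ∑ k, y.val i k * (utUnit F j q (hq j)).val k j = c * y.val i j at h1
    change ∑ k, y.val i k * (utUnit F j q (hq j)).val k q = c * y.val i q at h2
    simp only [utUnit_apply] at h1 h2
    rw [Finset.sum_eq_zero (fun k _ => by rw [if_neg (fun h => hj h.2.symm), mul_zero])] at h1
    have hc0 : c = 0 := (mul_eq_zero.1 h1.symm).resolve_right h0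
    rw [hc0, zero_mul, Finset.sum_eq_single j
      (fun k _ hk => by rw [if_neg (fun h => hk h.1.symm), mul_zero]) (by simp),
      if_pos (by simp), mul_one] at h2
    exact h0 h2

/-- The corner matrix unit is an eigenvector of the involution for the eigenvalue `ε`. -/
theorem inv_corner {ε : F} (hε : (ε = 1 ∧ IsOrthogonal inv) ∨ (ε = -1 ∧ IsSymplectic inv))
    {p q : Fin n} (hpq : p < q) (hp : p.val = 0) (hq : q.val = n - 1) :
    inv (utUnit F p q hpq.le) = ε • utUnit F p q hpq.le := by
  have hp' : ∀ i, p ≤ i := fun i => Fin.le_def.2 (by omega)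
  have hq' : ∀ i, i ≤ q := fun i => Fin.le_def.2 (by omega)
  have hrp : p.rev = q := Fin.ext (by rw [Fin.val_rev]; omega)
  have hrq : q.rev = p := Fin.ext (by rw [Fin.val_rev]; omega)
  -- The image of the corner unit is again supported in the corner, which the reflection fixes. In
  -- the symplectic case D contributes 1 from the first row and -1 from the last column.
  have hrefl : ∀ φ : UT F n ≃ₐ[F] UT F n, reflect (φ (utUnit F p q hpq.le)).val =
      (φ (utUnit F p q hpq.le)).val := by
    intro φ
    have key := fun {i j} => apply_eq_zero_of_algEquiv φ hpq.le hp' hq' (i := i) (j := j)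
    ext i j
    rw [reflect, Matrix.of_apply]
    by_cases h : i = p ∧ j = q
    · rw [h.1, h.2, hrp, hrq]
    · have h1 : (φ (utUnit F p q hpq.le)).val i j = 0 := by
        by_contra h0; exact h (key h0)
      rw [h1]
      by_contra h0
      have := key h0
      exact h ⟨by rw [← Fin.rev_rev i, this.2, hrq], by rw [← Fin.rev_rev j, this.1, hrp]⟩
  rcases hε with ⟨rfl, φ, hφ⟩ | ⟨rfl, heven, φ, hφ⟩
  · rw [one_smul]
    refine φ.injective (Subtype.ext ?_)
    rw [hφ, hrefl]
  · refine φ.injective (Subtype.ext ?_)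
    have hDD : signMatrix F n * signMatrix F n = 1 := by
      rw [signMatrix, Matrix.diagonal_mul_diagonal, ← Matrix.diagonal_one]
      congr 1; ext i; split_ifs <;> simp
    rw [hφ, hrefl, Matrix.inv_eq_right_inv hDD, map_smul]
    have key := fun {i j} => apply_eq_zero_of_algEquiv φ hpq.le hp' hq' (i := i) (j := j)
    ext i j
    change _ = -1 * (φ (utUnit F p q hpq.le)).val i j
    rw [signMatrix, Matrix.mul_diagonal, Matrix.diagonal_mul]
    by_cases h : (φ (utUnit F p q hpq.le)).val i j = 0
    · rw [h]; simp
    · obtain ⟨rfl, rfl⟩ := key h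
      have hpq' : i.val < j.val := hpq
      obtain ⟨r, hr⟩ := heven
      rw [if_pos (by omega), if_neg (by omega)]
      ring

/-- Elements of symmetric degree are eigenvectors of the involution for the eigenvalue `ε`. -/
theorem inv_eq_smul_of_symmetric
    (hinv : IsHomogeneousInvolution (elemGrading F (fineSeq n)) (genStar n) inv)
    {ε : F}
    (hε : (ε = 1 ∧ IsOrthogonal inv) ∨ (ε = -1 ∧ IsSymplectic inv)) {g : FG n}
    (hg : IsSymmetricDeg g) {A : UT F n} (hA : A ∈ elemGrading F (fineSeq n) g) :
    inv A = ε • A := by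
  obtain ⟨i, j, hij, rfl, rfl⟩ := hg
  rw [eq_smul_utUnit hij hA, map_smul, smul_comm]
  congr 1
  obtain ⟨p, hp⟩ : ∃ p : Fin n, p.val = 0 := ⟨⟨0, by omega⟩, rfl⟩
  have hpq' : p.rev.val = n - 1 := by rw [Fin.val_rev]; omega
  have hpi : p ≤ i := Fin.le_def.2 (by omega)
  have hpq : p < p.rev := (hpi.trans_lt hij).trans_le (Fin.rev_le_rev.2 hpi)
  have hc := inv_corner hε hpq hp hpq'
  rcases eq_or_lt_of_le hpi with rfl | hpi
  · exact hc
  have hiq : i.rev < p.rev := Fin.rev_lt_rev.2 hpi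
  have h1 : inv (utUnit F p i hpi.le) ∈ _ := inv_mem_rev hinv (utUnit_mem hpi.le)
  have h2 : inv (utUnit F i i.rev hij.le) ∈ _ := inv_mem_rev hinv (utUnit_mem hij.le)
  rw [Fin.rev_rev] at h2
  have h3 : inv (utUnit F i.rev p.rev hiq.le) ∈ _ := inv_mem_rev hinv (utUnit_mem hiq.le)
  rw [Fin.rev_rev, Fin.rev_rev] at h3
  have h1 := eq_smul_utUnit hiq h1
  have h2 := eq_smul_utUnit hij h2
  have h3 := eq_smul_utUnit hpi h3
  set c1 := (inv (utUnit F p i hpi.le)).val i.rev p.rev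
  set c2 := (inv (utUnit F i i.rev hij.le)).val i i.rev
  set c3 := (inv (utUnit F i.rev p.rev hiq.le)).val p i
  have hne := utUnit_ne_zero (F := F) hpi.le
  have hne' := utUnit_ne_zero (F := F) hpq.le
  -- The involution exchanges the lines of e_{pi} and e_{i'p'}, where ' is the reflection, and its
  -- square is the identity.
  have h13 : c1 * c3 = 1 := by
    have h := hinv.2.1 (utUnit F p i hpi.le)
    rw [h1, map_smul, h3, smul_smul] at h
    have h' : (c1 * c3 - 1) • utUnit F p i hpi.le = 0 := by rw [sub_smul, h, one_smul, sub_self]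
    exact sub_eq_zero.1 ((smul_eq_zero.1 h').resolve_right hne)
  -- The corner unit has eigenvalue ε; through this factorization its eigenvalue is also c1 c2 c3 =
  -- c2.
  have hprod : utUnit F p p.rev hpq.le = utUnit F p i hpi.le * utUnit F i i.rev hij.le *
      utUnit F i.rev p.rev hiq.le := by rw [utUnit_mul, utUnit_mul]
  have hcc := hc
  rw [hprod, hinv.1, hinv.1, h1, h2, h3, ← hprod] at hcc
  simp only [smul_mul_assoc, mul_smul_comm, smul_smul] at hcc
  rw [utUnit_mul, utUnit_mul] at hcc
  have h' : (c1 * c2 * c3 - ε) • utUnit F p p.rev hpq.le = 0 := by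
    rw [sub_smul, hcc, sub_self]
  have h'' := sub_eq_zero.1 ((smul_eq_zero.1 h').resolve_right hne')
  have : c2 = ε := by rw [← h'']; linear_combination (-c2) * h13
  rw [h2, this]

end Involution

/-! ### The generating polynomials are identities -/

section Identities

variable {F : Type*} [Field F] {n : ℕ} {inv : UT F n →ₗ[F] UT F n}

theorem var_mem_freeGrading (g : FG n) (i : ℕ) :
    var F g i ∈ freeGrading F (genStar n) g := by
  have := lmono_mem_freeGrading F (genStar n) [(⟨g, i, false⟩ : Letter (FG n))]
  rwa [← var_eq_lmono, show listDeg (genStar n) [(⟨g, i, false⟩ : Letter (FG n))] = g by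
    simp [listDeg, Letter.deg]] at this

theorem diag_mul_apply {A B : UT F n} (hA : A ∈ elemGrading F (fineSeq n) 1) (i j : Fin n) :
    (A * B).val i j = A.val i i * B.val i j := by
  change ∑ k, A.val i k * B.val k j = _
  exact Finset.sum_eq_single i
    (fun k _ hk => by rw [apply_eq_zero_of_mem_one hA hk.symm, zero_mul]) (by simp)

theorem powSucc_mem_one {A : UT F n} (hA : A ∈ elemGrading F (fineSeq n) 1) (k : ℕ) :
    powSucc A k ∈ elemGrading F (fineSeq n) 1 := by
  induction k with
  | zero => exact hA
  | succ k ih => rw [powSucc, ← one_mul (1 : FG n)]; exact elemGrading_mul ih hA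

theorem powSucc_diag_apply {A : UT F n} (hA : A ∈ elemGrading F (fineSeq n) 1) (k : ℕ)
    (i : Fin n) : (powSucc A k).val i i = A.val i i ^ (k + 1) := by
  induction k with
  | zero => rw [powSucc, zero_add, pow_one]
  | succ k ih => rw [powSucc, diag_mul_apply (powSucc_mem_one hA k), ih, pow_succ _ (k + 1)]

theorem eq_one_of_sign {ε : F} (hε : (ε = 1 ∧ IsOrthogonal inv) ∨ (ε = -1 ∧ IsSymplectic inv))
    (hn : n = 1) : ε = 1 := by
  rcases hε with h | h
  · exact h.1
  · have := h.2.1; subst hn; exact absurd this (by decide)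

theorem sign_mul_sign {ε : F}
    (hε : (ε = 1 ∧ IsOrthogonal inv) ∨ (ε = -1 ∧ IsSymplectic inv)) : ε * ε = 1 := by
  rcases hε with ⟨rfl, -⟩ | ⟨rfl, -⟩ <;> simp

theorem genTIdeal_le_gradedStarIdentities
    (hinv : IsHomogeneousInvolution (elemGrading F (fineSeq n)) (genStar n) inv) {ε : F}
    (hε : (ε = 1 ∧ IsOrthogonal inv) ∨ (ε = -1 ∧ IsSymplectic inv)) :
    genTIdeal F n ε ≤
      gradedStarIdentities (genStar n) (elemGrading F (fineSeq n)) inv := by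
  refine tIdeal_le (isTIdeal_gradedStarIdentities _ _) ?_
  rintro f hf φ hφ
  have hmem : ∀ g i, φ (var F g i) ∈ elemGrading F (fineSeq n) g :=
    fun g i => hφ.1 g _ (var_mem_freeGrading g i)
  have hdiag : ∀ A : UT F n, A ∈ elemGrading F (fineSeq n) 1 → ∀ B ∈ elemGrading F (fineSeq n) 1,
      (∀ i, A.val i i = B.val i i) → A = B := by
    intro A hA B hB h
    refine Subtype.ext (Matrix.ext fun i j => ?_)
    by_cases hij : i = j
    · rw [hij, h]
    · rw [apply_eq_zero_of_mem_one hA hij, apply_eq_zero_of_mem_one hB hij]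
  rcases hf with ⟨g, hg⟩ | ⟨g, hg⟩ | hn | _ | ⟨k, hn, c, i, hc, hi⟩ | hF
  · have : elemGrading F (fineSeq n) g = ⊥ := not_not.1 hg
    have h := hmem g 0
    rwa [this, Submodule.mem_bot] at h
  · rw [map_sub, map_smul, hφ.2, inv_eq_smul_of_symmetric hinv hε hg (hmem g 0), sub_self]
  · rw [map_sub, map_smul, hφ.2, eq_one_of_sign hε hn, one_smul, sub_eq_zero]
    refine hdiag _ (inv_mem_one hinv (hmem 1 0)) _ (hmem 1 0) fun i => ?_
    rw [inv_apply_diag hinv (hmem 1 0)]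
    have : i.rev = i := Fin.ext (by rw [Fin.val_rev]; omega)
    rw [this]
  · rw [map_sub, map_mul, map_mul, sub_eq_zero]
    have h1 := elemGrading_mul (hmem 1 1) (hmem 1 2)
    have h2 := elemGrading_mul (hmem 1 2) (hmem 1 1)
    rw [one_mul] at h1 h2
    refine hdiag _ h1 _ h2 fun i => ?_
    rw [diag_mul_apply (hmem 1 1), diag_mul_apply (hmem 1 2), mul_comm]
  · rw [map_mul, map_sub, hφ.2]
    have hrev : c.rev = c := Fin.ext (by rw [Fin.val_rev]; omega)
    refine Subtype.ext (Matrix.ext fun p q => ?_)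
    rw [diag_mul_apply (sub_mem (inv_mem_one hinv (hmem 1 0)) (hmem 1 0))]
    by_cases h0 : (φ (var F (elemDeg (fineSeq n) c i) 0)).val p q = 0
    · rw [h0, mul_zero]; rfl
    · obtain ⟨rfl, rfl⟩ := eq_of_apply_ne_zero hi (hmem _ 0) h0
      change ((inv (φ (var F 1 0))).val p p - (φ (var F 1 0)).val p p) * _ = 0
      rw [inv_apply_diag hinv (hmem 1 0), hrev, sub_self, zero_mul]
  · rw [map_sub, map_powSucc, sub_eq_zero]
    have := Fintype.ofFinite F
    refine hdiag _ (powSucc_mem_one (hmem 1 0) _) _ (hmem 1 0) fun i => ?_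
    rw [powSucc_diag_apply (hmem 1 0), Nat.sub_add_cancel Nat.card_pos, Nat.card_eq_fintype_card,
      FiniteField.pow_card]

end Identities

/-! ### Good sequences are paths -/

section Good

variable {F : Type*} [Field F] {n : ℕ}

/-- A product of matrix units is nonzero exactly when consecutive indices agree, which is what a
path records. -/
theorem isPath_iff_isGood (hn : 1 ≤ n) (L : List (Letter (FG n))) :
    IsGood F (fineSeq n) (fun c => (L.get c).deg (genStar n)) ↔ ∃ a b, IsPath a L b := by
  have key : ∀ (L : List (Letter (FG n))) (p q : Fin L.length → Fin n), (∀ c, p c < q c) →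
      (∀ c, elemDeg (fineSeq n) (p c) (q c) = (L.get c).deg (genStar n)) →
      (List.ofFn fun c => Matrix.single (p c) (q c) (1 : F)).prod ≠ 0 → L ≠ [] →
      ∃ a b, IsPath a L b ∧ (List.ofFn fun c => Matrix.single (p c) (q c) (1 : F)).prod =
        Matrix.single a b 1 := by
    intro L
    induction L with
    | nil => intro p q _ _ _ h; exact absurd rfl h
    | cons l L ih =>
      intro p q hpq hd hne _
      simp only [List.length_cons, List.ofFn_succ, List.prod_cons] at hne ⊢
      have h0 : l.deg (genStar n) = elemDeg (fineSeq n) (p 0) (q 0) := (hd 0).symm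
      by_cases hL : L = []
      · subst hL
        refine ⟨p 0, q 0, ⟨q 0, hpq 0, h0, rfl⟩, ?_⟩
        simp
      · obtain ⟨a, b, hab, heq⟩ := ih (fun c => p c.succ) (fun c => q c.succ)
          (fun c => hpq _) (fun c => hd c.succ) (right_ne_zero_of_mul hne) hL
        rw [heq] at hne ⊢
        by_cases hqa : q 0 = a
        · subst hqa
          exact ⟨p 0, b, ⟨q 0, hpq 0, h0, hab⟩, by rw [Matrix.single_mul_single_same, one_mul]⟩
        · exact absurd (Matrix.single_mul_single_of_ne _ _ _ _ hqa _) hne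
  constructor
  · rintro ⟨p, q, hpq, hd, hne⟩
    by_cases hL : L = []
    · subst hL; exact ⟨⟨0, hn⟩, ⟨0, hn⟩, rfl⟩
    · obtain ⟨a, b, h, -⟩ := key L p q hpq hd hne hL
      exact ⟨a, b, h⟩
  · rintro ⟨a, b, h⟩
    -- The induction follows a single entry because the empty product is the identity matrix and not
    -- a matrix unit.
    suffices h' : ∃ p q : Fin L.length → Fin n, (∀ c, p c < q c) ∧
        (∀ c, elemDeg (fineSeq n) (p c) (q c) = (L.get c).deg (genStar n)) ∧
        ((List.ofFn fun c => Matrix.single (p c) (q c) (1 : F)).prod) a b = 1 by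
      obtain ⟨p, q, h1, h2, h3⟩ := h'
      refine ⟨p, q, h1, h2, fun h0 => ?_⟩
      rw [h0] at h3
      exact zero_ne_one h3
    induction L generalizing a with
    | nil =>
      cases h
      exact ⟨Fin.elim0, Fin.elim0, fun c => c.elim0, fun c => c.elim0, by simp⟩
    | cons l L ih =>
      obtain ⟨r, har, hd, h⟩ := h
      obtain ⟨p, q, h1, h2, h3⟩ := ih r h
      refine ⟨Fin.cons a p, Fin.cons r q, fun c => ?_, fun c => ?_, ?_⟩
      · refine Fin.cases ?_ (fun c => ?_) c
        · simpa using har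
        · simpa using h1 c
      · refine Fin.cases ?_ (fun c => ?_) c
        · simpa using hd.symm
        · simpa using h2 c
      · simp only [List.length_cons, List.ofFn_succ, List.prod_cons, Fin.cons_zero, Fin.cons_succ]
        rw [Matrix.single_mul_apply_same, h3, one_mul]

theorem isGood_ofFn_iff (hn : 1 ≤ n) {t : ℕ} (z : Fin t → Letter (FG n)) :
    IsGood F (fineSeq n) (fun c => (z c).deg (genStar n)) ↔ ∃ a b, IsPath a (List.ofFn z) b := by
  rw [← isPath_iff_isGood (F := F) hn]
  have key : ∀ {m m' : ℕ} (h : m = m') (ν : Fin m' → FG n),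
      IsGood F (fineSeq n) ν ↔ IsGood F (fineSeq n) (fun c => ν (Fin.cast h c)) := by
    rintro m _ rfl ν; rfl
  rw [key (List.length_ofFn (f := z))]
  simp only [List.get_ofFn]

theorem mem_goodWords_iff (hn : 1 ≤ n) (w : Word (FG n)) :
    w ∈ goodWords F ↔ ∃ a b, IsPath a w.toList b := isPath_iff_isGood hn _

/-- The list of the letters of nontrivial degree. -/
def zPart (L : List (Letter (FG n))) : List (Letter (FG n)) :=
  L.filter fun l => l.deg (genStar n) ≠ 1

theorem zPart_append (L M : List (Letter (FG n))) : zPart (L ++ M) = zPart L ++ zPart M :=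
  List.filter_append ..

theorem zPart_cons_of_eq {l : Letter (FG n)} (h : l.deg (genStar n) = 1)
    (L : List (Letter (FG n))) : zPart (l :: L) = zPart L := by simp [zPart, h]

theorem zPart_cons_of_ne {l : Letter (FG n)} (h : l.deg (genStar n) ≠ 1)
    (L : List (Letter (FG n))) : zPart (l :: L) = l :: zPart L := by simp [zPart, h]

theorem zPart_eq_nil {L : List (Letter (FG n))} (h : ∀ l ∈ L, l.deg (genStar n) = 1) :
    zPart L = [] := by simpa [zPart] using h

theorem zPart_eq_self {L : List (Letter (FG n))} (h : ∀ l ∈ L, l.deg (genStar n) ≠ 1) :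
    zPart L = L := by simpa [zPart] using h

theorem listDeg_zPart (L : List (Letter (FG n))) :
    listDeg (genStar n) (zPart L) = listDeg (genStar n) L := by
  induction L with
  | nil => rfl
  | cons l L ih =>
    by_cases h : l.deg (genStar n) = 1
    · rw [zPart_cons_of_eq h, listDeg_cons, h, one_mul, ih]
    · rw [zPart_cons_of_ne h, listDeg_cons, listDeg_cons, ih]

theorem zPart_eq_append {L A B : List (Letter (FG n))} (h : zPart L = A ++ B) :
    ∃ A' B', L = A' ++ B' ∧ zPart A' = A ∧ zPart B' = B := List.filter_eq_append_iff.1 h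

theorem zPart_listStar (L : List (Letter (FG n))) :
    zPart (listStar L) = listStar (zPart L) := by
  induction L with
  | nil => rfl
  | cons l L ih =>
    have hs : l.star.deg (genStar n) = 1 ↔ l.deg (genStar n) = 1 := by
      rw [Letter.deg_star genStar_genStar, genStar_eq_one_iff]
    have h1 : ∀ (l : Letter (FG n)) L, listStar (l :: L) = listStar L ++ [l.star] := by
      simp [listStar]
    rw [h1, zPart_append, ih]
    by_cases h : l.deg (genStar n) = 1
    · rw [zPart_cons_of_eq h, zPart_cons_of_eq (hs.2 h)]; simp [zPart]
    · rw [zPart_cons_of_ne h, zPart_cons_of_ne (mt hs.1 h), h1]; simp [zPart]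

/-- A monomial vanishes modulo the generating ideal, unless its letters of nontrivial degree form a
path. -/
theorem exists_isPath_or_genClass_eq_zero (ε : F) (hn : 1 ≤ n) (L : List (Letter (FG n))) :
    (∃ a b, IsPath a (zPart L) b) ∨ genClass ε L = 0 := by
  induction L with
  | nil => exact Or.inl ⟨⟨0, hn⟩, ⟨0, hn⟩, rfl⟩
  | cons l L ih =>
    rcases ih with ⟨a, b, h⟩ | h
    · by_cases h1 : l.deg (genStar n) = 1
      · rw [zPart_cons_of_eq h1]; exact Or.inl ⟨a, b, h⟩
      rw [zPart_cons_of_ne h1]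
      by_cases hl : ∃ i j : Fin n, i ≤ j ∧ l.deg (genStar n) = elemDeg (fineSeq n) i j
      · obtain ⟨i, j, hij, hl⟩ := hl
        have hij : i < j := lt_of_le_of_ne hij fun h => h1 (by rw [hl, h, elemDeg_self])
        rcases hz : zPart L with _ | ⟨z, Z⟩
        · exact Or.inl ⟨i, j, j, hij, hl, rfl⟩
        rw [hz] at h
        by_cases hja : j = a
        · exact Or.inl ⟨i, b, j, hij, hl, hja ▸ h⟩
        obtain ⟨q, haq, hzd, -⟩ := h
        obtain ⟨A, B, rfl, hA, -⟩ := zPart_eq_append (L := L) (A := [z]) (B := Z) hz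
        right
        -- The factor from l up to the next letter of nontrivial degree has as its degree the
        -- product of two noncomposable degrees, which is outside the support.
        refine genClass_congr_zero (L := l :: A) (by simp) ?_ [] B
        refine genClass_eq_zero_of_deg ?_
        rintro ⟨i', j', -, hd⟩
        rw [listDeg_cons, ← listDeg_zPart A, hA, hl, show listDeg (genStar n) [z] = _ by
          simp [listDeg]; exact hzd] at hd
        exact hja (eq_of_elemDeg_mul hij haq hd)
      · right
        refine genClass_congr_zero (L := [l]) (by simp) ?_ [] L
        exact genClass_eq_zero_of_deg (by simpa [listDeg] using hl)
    · by_cases hL : L = []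
      · subst hL
        by_cases hl : ∃ i j : Fin n, i ≤ j ∧ l.deg (genStar n) = elemDeg (fineSeq n) i j
        · obtain ⟨i, j, hij, hl⟩ := hl
          left
          by_cases h1 : l.deg (genStar n) = 1
          · rw [zPart_cons_of_eq h1]; exact ⟨⟨0, hn⟩, ⟨0, hn⟩, rfl⟩
          · rw [zPart_cons_of_ne h1]
            exact ⟨i, j, j, lt_of_le_of_ne hij fun h => h1 (by rw [hl, h, elemDeg_self]), hl, rfl⟩
        · right
          exact genClass_eq_zero_of_deg (by simpa [listDeg] using hl)
      · right
        have := genClass_congr_zero hL h [l] []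
        simpa using this

/-- A segment of the z-part comes from a segment of the full word, and the extra letters do not
change its degree; so flips of the z-part are induced by flips of the word. -/
theorem Flip.lift_zPart {L M : List (Letter (FG n))} (h : Flip (zPart L) M) :
    ∃ L', Flip L L' ∧ zPart L' = M := by
  obtain ⟨A, U, B, hU, hL, rfl⟩ := h
  obtain ⟨A', B', rfl, hA, rfl⟩ := zPart_eq_append hL
  obtain ⟨A', U', rfl, rfl, rfl⟩ := zPart_eq_append hA
  rw [listDeg_zPart] at hU
  exact ⟨A' ++ _root_.listStar U' ++ B', ⟨A', U', B', hU, rfl, rfl⟩, by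
    simp [zPart_append, zPart_listStar]⟩

theorem FlipRel.lift_zPart {L M : List (Letter (FG n))} (h : FlipRel (zPart L) M) :
    ∃ L', FlipRel L L' ∧ zPart L' = M := by
  induction h with
  | refl => exact ⟨L, Relation.ReflTransGen.refl, rfl⟩
  | tail _ h ih =>
    obtain ⟨L', h1, rfl⟩ := ih
    obtain ⟨L'', h2, rfl⟩ := h.lift_zPart
    exact ⟨L'', h1.tail h2, rfl⟩

end Good

/-! ### Generic evaluations -/

section Evaluation

variable {F : Type*} [Field F] {n : ℕ}

/-- The parameters of the evaluations: zeros and ones for the variables of nontrivial degree, and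
the diagonal entries of the values of the variables of trivial degree. They form a monoid. -/
abbrev EvalParam (F : Type*) (n : ℕ) := (FG n × ℕ → ZMod 2) × (ℕ × Fin n → F)

variable (F) in
/-- The inclusion of `{0, 1}` in `F`. -/
noncomputable def bitHom : ZMod 2 →* F where
  toFun x := if x = 1 then 1 else 0
  map_one' := if_pos rfl
  map_mul' := by
    have h : ∀ x y : ZMod 2, x * y = 1 ↔ x = 1 ∧ y = 1 := by decide
    intro x y
    by_cases hx : x = 1 <;> by_cases hy : y = 1 <;> simp [h, hx, hy]

theorem bitHom_zero : bitHom F 0 = 0 := by simp [bitHom]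

open Classical in
variable (F) in
/-- The sum of the strictly upper triangular matrix units of degree `g`. -/
noncomputable def unitOfDeg (g : FG n) : UT F n :=
  ⟨Matrix.of fun p q => if p < q ∧ elemDeg (fineSeq n) p q = g then 1 else 0, fun i j h => by
    rw [Matrix.of_apply, if_neg fun h' => lt_asymm h h'.1]⟩

theorem unitOfDeg_mem (g : FG n) : unitOfDeg F g ∈ elemGrading F (fineSeq n) g := by
  intro i j h
  by_contra h'
  exact h (if_neg fun h'' => h' h''.2)

theorem unitOfDeg_apply {p q : Fin n} (h : p < q) :
    (unitOfDeg F (elemDeg (fineSeq n) p q)).val p q = 1 := if_pos ⟨h, rfl⟩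

variable (F n) in
/-- Diagonal matrices as elements of `UT_n`. -/
def utDiagonal (d : Fin n → F) : UT F n :=
  ⟨Matrix.diagonal d, fun _ _ h => Matrix.diagonal_apply_ne' _ (ne_of_lt h)⟩

theorem utDiagonal_mem (d : Fin n → F) : utDiagonal F n d ∈ elemGrading F (fineSeq n) 1 := by
  intro i j h
  by_cases hij : i = j
  · rw [hij, elemDeg_self]
  · exact absurd (Matrix.diagonal_apply_ne _ hij) h

open Classical in
/-- The value of the variable `x_i^{(g)}`. -/
noncomputable def varValue (k : EvalParam F n) (g : FG n) (i : ℕ) : UT F n :=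
  if g = 1 then utDiagonal F n fun a => k.2 (i, a) else bitHom F (k.1 (g, i)) • unitOfDeg F g

theorem varValue_mem (k : EvalParam F n) (g : FG n) (i : ℕ) :
    varValue k g i ∈ elemGrading F (fineSeq n) g := by
  rw [varValue]
  split_ifs with h
  · rw [h]; exact utDiagonal_mem _
  · exact Submodule.smul_mem _ _ (unitOfDeg_mem g)

variable {inv : UT F n →ₗ[F] UT F n}

theorem exists_evalHom
    (hinv : IsHomogeneousInvolution (elemGrading F (fineSeq n)) (genStar n) inv)
    (k : EvalParam F n) :
    ∃ φ : FreeStarAlg F (FG n) →ₙₐ[F] UT F n, IsGradedStarHom (freeGrading F (genStar n))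
      (freeStar F) (elemGrading F (fineSeq n)) inv φ ∧ ∀ g i, φ (var F g i) = varValue k g i :=
  exists_isGradedStarHom (𝒜 := elemGrading F (fineSeq n))
    (fun _ _ _ _ ha hb => elemGrading_mul ha hb) hinv (varValue k) (varValue_mem k)

/-- The evaluation with the given parameters. -/
noncomputable def evalHom
    (hinv : IsHomogeneousInvolution (elemGrading F (fineSeq n)) (genStar n) inv)
    (k : EvalParam F n) : FreeStarAlg F (FG n) →ₙₐ[F] UT F n := (exists_evalHom hinv k).choose

theorem evalHom_isGradedStarHom
    (hinv : IsHomogeneousInvolution (elemGrading F (fineSeq n)) (genStar n) inv)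
    (k : EvalParam F n) : IsGradedStarHom (freeGrading F (genStar n)) (freeStar F)
      (elemGrading F (fineSeq n)) inv (evalHom hinv k) := (exists_evalHom hinv k).choose_spec.1

theorem evalHom_var
    (hinv : IsHomogeneousInvolution (elemGrading F (fineSeq n)) (genStar n) inv)
    (k : EvalParam F n) (g : FG n) (i : ℕ) : evalHom hinv k (var F g i) = varValue k g i :=
  (exists_evalHom hinv k).choose_spec.2 g i

/-- The value of a letter. -/
noncomputable def letterValue (inv : UT F n →ₗ[F] UT F n) (k : EvalParam F n)
    (l : Letter (FG n)) : UT F n :=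
  if l.starred then inv (varValue k l.varDeg l.index) else varValue k l.varDeg l.index

theorem evalHom_lmono
    (hinv : IsHomogeneousInvolution (elemGrading F (fineSeq n)) (genStar n) inv)
    (k : EvalParam F n) {L : List (Letter (FG n))} (hL : L ≠ []) :
    evalHom hinv k (lmono F L) = (L.map (letterValue inv k)).prod := by
  have h1 : ∀ l : Letter (FG n), evalHom hinv k (lmono F [l]) = letterValue inv k l := by
    rintro ⟨g, i, b⟩
    cases b
    · exact evalHom_var hinv k g i
    · have : lmono F [(⟨g, i, true⟩ : Letter (FG n))] = freeStar F (var F g i) := by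
        rw [var_eq_lmono, freeStar_lmono]; rfl
      rw [this, (evalHom_isGradedStarHom hinv k).2, evalHom_var]; rfl
  induction L with
  | nil => exact absurd rfl hL
  | cons l L ih =>
    by_cases h : L = []
    · subst h; rw [h1]; simp
    · have := lmono_append F (L := [l]) (by simp) h
      rw [List.singleton_append] at this
      rw [this, map_mul, ih h, h1]; simp

/-- The entry of the value at a given position, as a function of the parameters. -/
noncomputable def evalEntry
    (hinv : IsHomogeneousInvolution (elemGrading F (fineSeq n)) (genStar n) inv) (a b : Fin n) :
    FreeStarAlg F (FG n) →ₗ[F] (EvalParam F n → F) where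
  toFun f k := (evalHom hinv k f).val a b
  map_add' f g := funext fun k => by rw [map_add]; rfl
  map_smul' c f := funext fun k => by rw [map_smul]; rfl

theorem evalEntry_eq_zero_of_mem
    (hinv : IsHomogeneousInvolution (elemGrading F (fineSeq n)) (genStar n) inv) (a b : Fin n)
    {f : FreeStarAlg F (FG n)}
    (hf : f ∈ gradedStarIdentities (genStar n) (elemGrading F (fineSeq n)) inv) :
    evalEntry hinv a b f = 0 := funext fun k => by
  change (evalHom hinv k f).val a b = 0
  rw [hf _ (evalHom_isGradedStarHom hinv k)]; rfl

theorem evalEntry_eq_zero_of_deg_ne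
    (hinv : IsHomogeneousInvolution (elemGrading F (fineSeq n)) (genStar n) inv) (a b : Fin n)
    {L : List (Letter (FG n))} (h : listDeg (genStar n) L ≠ elemDeg (fineSeq n) a b) :
    evalEntry hinv a b (lmono F L) = 0 := funext fun k => by
  by_contra h0
  exact h ((evalHom_isGradedStarHom hinv k).1 _ _ (lmono_mem_freeGrading F _ L) a b h0).symm

/-- Dedekind's independence of characters, pulled back along the evaluation of one entry. J is left
open because the lemma serves both for the generated ideal and for the ideal of identities. -/
theorem mkQ_notMem_span_of_evalEntry
    (hinv : IsHomogeneousInvolution (elemGrading F (fineSeq n)) (genStar n) inv)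
    {J : Submodule F (FreeStarAlg F (FG n))}
    (hJ : J ≤ gradedStarIdentities (genStar n) (elemGrading F (fineSeq n)) inv) (a b : Fin n)
    {x : FreeStarAlg F (FG n)} {S : Set (FreeStarAlg F (FG n))} {χ : EvalParam F n →* F} {c : F}
    (hc : c ≠ 0) (hx : evalEntry hinv a b x = c • (χ : EvalParam F n → F))
    (hS : ∀ y ∈ S, evalEntry hinv a b y = 0 ∨
      ∃ (ψ : EvalParam F n →* F) (e : F), ψ ≠ χ ∧
        evalEntry hinv a b y = e • (ψ : EvalParam F n → F)) :
    J.mkQ x ∉ Submodule.span F (J.mkQ '' S) := by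
  intro hmem
  let Ψ : (FreeStarAlg F (FG n) ⧸ J) →ₗ[F] (EvalParam F n → F) :=
    J.liftQ (evalEntry hinv a b) fun f hf => evalEntry_eq_zero_of_mem hinv a b (hJ hf)
  have hΨ : ∀ y, Ψ (J.mkQ y) = evalEntry hinv a b y := fun y => J.liftQ_apply _ y
  have h1 := Submodule.mem_map_of_mem (f := Ψ) hmem
  rw [Submodule.map_span, hΨ, hx] at h1
  have h2 : Submodule.span F (Ψ '' (J.mkQ '' S)) ≤
      Submodule.span F ((fun ψ : EvalParam F n →* F => (ψ : EvalParam F n → F)) '' {χ}ᶜ) := by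
    rw [Submodule.span_le]
    rintro _ ⟨_, ⟨y, hy, rfl⟩, rfl⟩
    rw [hΨ, SetLike.mem_coe]
    rcases hS y hy with h | ⟨ψ, e, hne, h⟩
    · rw [h]; exact zero_mem _
    · rw [h]
      exact Submodule.smul_mem _ _ (Submodule.subset_span ⟨ψ, hne, rfl⟩)
  have h3 := (Submodule.smul_mem_iff _ hc).1 (h2 h1)
  exact (linearIndependent_monoidHom (EvalParam F n) F).notMem_span_image
    (s := {χ}ᶜ) (x := χ) (by simp) h3

/-! ### The values of normal monomials -/

/-- The vertices of a path of letters. -/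
def IsVertexSeq {t : ℕ} (z : Fin t → Letter (FG n)) (v : Fin (t + 1) → Fin n) : Prop :=
  ∀ c : Fin t, v c.castSucc < v c.succ ∧
    (z c).deg (genStar n) = elemDeg (fineSeq n) (v c.castSucc) (v c.succ)

theorem IsVertexSeq.strictMono {t : ℕ} {z : Fin t → Letter (FG n)} {v : Fin (t + 1) → Fin n}
    (h : IsVertexSeq z v) : StrictMono v := Fin.strictMono_iff_lt_succ.2 fun c => (h c).1

theorem IsPath.exists_isVertexSeq {t : ℕ} {z : Fin t → Letter (FG n)} {a b : Fin n}
    (h : IsPath a (List.ofFn z) b) :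
    ∃ v : Fin (t + 1) → Fin n, v 0 = a ∧ v (Fin.last t) = b ∧ IsVertexSeq z v := by
  induction t generalizing a with
  | zero =>
    rw [List.ofFn_zero] at h
    exact ⟨fun _ => a, rfl, h, fun c => c.elim0⟩
  | succ t ih =>
    rw [List.ofFn_succ] at h
    obtain ⟨q, haq, hd, h⟩ := h
    obtain ⟨v, h0, hl, hv⟩ := ih h
    refine ⟨Fin.cons a v, rfl, by rw [← hl, ← Fin.succ_last, Fin.cons_succ], fun c => ?_⟩
    refine Fin.cases ?_ (fun c => ?_) c
    · rw [Fin.castSucc_zero, Fin.cons_zero, Fin.cons_succ, h0]; exact ⟨haq, hd⟩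
    · rw [← Fin.succ_castSucc, Fin.cons_succ, Fin.cons_succ]; exact hv c

theorem IsVertexSeq.isPath {t : ℕ} {z : Fin t → Letter (FG n)} {v : Fin (t + 1) → Fin n}
    (h : IsVertexSeq z v) : IsPath (v 0) (List.ofFn z) (v (Fin.last t)) := by
  induction t with
  | zero => rw [List.ofFn_zero]; rfl
  | succ t ih =>
    rw [List.ofFn_succ]
    refine ⟨v 1, (h 0).1, (h 0).2, ?_⟩
    exact ih (z := fun c => z c.succ) (v := fun c => v c.succ) fun c => h c.succ

theorem IsVertexSeq.unique {t : ℕ} {z : Fin t → Letter (FG n)} {v v' : Fin (t + 1) → Fin n}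
    (h : IsVertexSeq z v) (h' : IsVertexSeq z v') (h0 : v 0 = v' 0) : v = v' := by
  funext c
  induction c using Fin.induction with
  | zero => exact h0
  | succ c _ => exact (elemDeg_inj (h c).1 ((h c).2.symm.trans (h' c).2)).2.symm

/-- The coefficient of the value of a letter of nontrivial degree. -/
noncomputable def letterCoeff (inv : UT F n →ₗ[F] UT F n) (l : Letter (FG n)) (p q : Fin n) : F :=
  if l.starred then (inv (unitOfDeg F l.varDeg)).val p q else 1

theorem letterCoeff_ne_zero
    (hinv : IsHomogeneousInvolution (elemGrading F (fineSeq n)) (genStar n) inv)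
    {l : Letter (FG n)} {p q : Fin n} (hpq : p < q)
    (hl : l.deg (genStar n) = elemDeg (fineSeq n) p q) : letterCoeff inv l p q ≠ 0 := by
  obtain ⟨g, i, b⟩ := l
  cases b
  · simp [letterCoeff]
  · have hg : g = elemDeg (fineSeq n) q.rev p.rev := by
      rw [← genStar_elemDeg, ← hl]; simp [Letter.deg, genStar_genStar]
    have hpq' := Fin.rev_lt_rev.2 hpq
    have h := inv_apply_ne_zero hinv hpq' (unitOfDeg_mem (F := F) _) (by
      intro h0
      have := unitOfDeg_apply (F := F) hpq'
      rw [h0] at this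
      exact zero_ne_one this)
    rw [Fin.rev_rev, Fin.rev_rev, ← hg] at h
    simpa [letterCoeff] using h

theorem letterValue_apply (k : EvalParam F n)
    {l : Letter (FG n)} {p q : Fin n} (hpq : p < q)
    (hl : l.deg (genStar n) = elemDeg (fineSeq n) p q) :
    (letterValue inv k l).val p q = bitHom F (k.1 l.variable) * letterCoeff inv l p q := by
  obtain ⟨g, i, b⟩ := l
  have hg1 : g ≠ 1 := by
    rintro rfl
    have : Letter.deg (genStar n) ⟨1, i, b⟩ = 1 := by cases b <;> simp [Letter.deg, genStar_one]
    exact elemDeg_ne_one hpq (hl.symm.trans this)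
  cases b
  · have hg : g = elemDeg (fineSeq n) p q := by simpa [Letter.deg] using hl
    have : letterValue inv k ⟨g, i, false⟩ = bitHom F (k.1 (g, i)) • unitOfDeg F g := by
      simp [letterValue, varValue, hg1]
    rw [this]
    change bitHom F (k.1 (g, i)) * (unitOfDeg F g).val p q = _
    rw [hg, unitOfDeg_apply hpq]; rfl
  · have : letterValue inv k ⟨g, i, true⟩ = bitHom F (k.1 (g, i)) • inv (unitOfDeg F g) := by
      simp [letterValue, varValue, hg1]
    rw [this]; rfl

theorem letterValue_mem
    (hinv : IsHomogeneousInvolution (elemGrading F (fineSeq n)) (genStar n) inv)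
    (k : EvalParam F n) (l : Letter (FG n)) :
    letterValue inv k l ∈ elemGrading F (fineSeq n) (l.deg (genStar n)) := by
  rw [letterValue, Letter.deg]
  split_ifs
  · exact hinv.2.2 _ _ (varValue_mem _ _ _)
  · exact varValue_mem _ _ _

/-- The value of a block at a vertex. -/
def blockValue (d : ℕ × Fin n → F) (b : Block) (x : Fin n) : F :=
  (b.plain.map fun i => d (i, x)).prod * (b.starred.map fun i => d (i, x.rev)).prod

theorem diagLetters_apply
    (hinv : IsHomogeneousInvolution (elemGrading F (fineSeq n)) (genStar n) inv)
    (k : EvalParam F n) (L : List ℕ) (s : Bool) (X : UT F n) (i j : Fin n) :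
    (((L.map fun m => (⟨1, m, s⟩ : Letter (FG n))).map (letterValue inv k)).prod * X).val i j =
      (L.map fun m => k.2 (m, if s then i.rev else i)).prod * X.val i j := by
  induction L with
  | nil => simp
  | cons m L ih =>
    simp only [List.map_cons, List.prod_cons, mul_assoc]
    have h1 : varValue k 1 m ∈ elemGrading F (fineSeq n) 1 := varValue_mem k 1 m
    have h2 : ∀ x, (varValue k (1 : FG n) m).val x x = k.2 (m, x) := fun x => by
      simp [varValue, utDiagonal]
    cases s
    · change (varValue k 1 m * _).val i j = _
      rw [diag_mul_apply h1, h2]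
      exact congrArg _ ih
    · change (inv (varValue k 1 m) * _).val i j = _
      rw [diag_mul_apply (inv_mem_one hinv h1), inv_apply_diag hinv h1, h2]
      exact congrArg _ ih

theorem block_apply
    (hinv : IsHomogeneousInvolution (elemGrading F (fineSeq n)) (genStar n) inv)
    (k : EvalParam F n) (b : Block) (X : UT F n) (i j : Fin n) :
    (((b.letters n).map (letterValue inv k)).prod * X).val i j =
      blockValue k.2 b i * X.val i j := by
  rw [Block.letters, List.map_append, List.prod_append, mul_assoc, diagLetters_apply hinv,
    diagLetters_apply hinv, blockValue, mul_assoc]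
  simp

theorem normalLetters_zero (z : Fin 0 → Letter (FG n)) (ω : Fin 1 → Block) :
    normalLetters z ω = (ω 0).letters n := by simp [normalLetters]

theorem normalLetters_succ {t : ℕ} (z : Fin (t + 1) → Letter (FG n)) (ω : Fin (t + 2) → Block) :
    normalLetters z ω = (ω 0).letters n ++
      z 0 :: normalLetters (fun c => z c.succ) (fun c => ω c.succ) := by
  simp [normalLetters, List.finRange_succ, List.flatMap_cons, List.flatMap_map]

/-- Each letter of nontrivial degree has a value supported at one position and the blocks are
diagonal, so the matrix product has a single summand, along the vertices. -/
theorem normalLetters_apply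
    (hinv : IsHomogeneousInvolution (elemGrading F (fineSeq n)) (genStar n) inv)
    (k : EvalParam F n) {t : ℕ} {z : Fin t → Letter (FG n)} (ω : Fin (t + 1) → Block)
    {v : Fin (t + 1) → Fin n} (hv : IsVertexSeq z v) :
    (((normalLetters z ω).map (letterValue inv k)).prod).val (v 0) (v (Fin.last t)) =
      (∏ c, letterCoeff inv (z c) (v c.castSucc) (v c.succ)) *
        ((∏ c, bitHom F (k.1 (z c).variable)) * ∏ c, blockValue k.2 (ω c) (v c)) := by
  induction t with
  | zero =>
    rw [normalLetters_zero, ← mul_one (List.prod _), block_apply hinv]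
    simp
  | succ t ih =>
    rw [normalLetters_succ, List.map_append, List.prod_append, block_apply hinv, List.map_cons,
      List.prod_cons]
    have hz := hv 0
    have hmul : (letterValue inv k (z 0) * ((normalLetters (fun c => z c.succ)
        (fun c => ω c.succ)).map (letterValue inv k)).prod).val (v 0) (v (Fin.last (t + 1))) =
        (letterValue inv k (z 0)).val (v 0) (v 1) * (((normalLetters (fun c => z c.succ)
        (fun c => ω c.succ)).map (letterValue inv k)).prod).val (v 1) (v (Fin.last (t + 1))) := by
      -- Row `v 0` of the value of `z 0` can be nonzero only in column `v 1`.
      refine Finset.sum_eq_single (v 1) (fun x _ hx => ?_) (fun h => absurd (Finset.mem_univ _) h)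
      by_cases h0 : (letterValue inv k (z 0)).val (v 0) x = 0
      · exact mul_eq_zero_of_left h0 _
      · have hm := letterValue_mem hinv k (z 0)
        rw [hz.2] at hm
        exact absurd (eq_of_apply_ne_zero hz.1 hm h0).2 hx
    have hrec := ih (z := fun c => z c.succ) (fun c => ω c.succ) (v := fun c => v c.succ)
      (fun c => hv c.succ)
    rw [hmul, letterValue_apply k (p := v 0) (q := v 1) hz.1 hz.2]
    have hrec' : (((normalLetters (fun c => z c.succ)
        (fun c => ω c.succ)).map (letterValue inv k)).prod).val (v 1) (v (Fin.last (t + 1))) = _ :=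
      hrec
    rw [hrec', Fin.prod_univ_succ fun c => letterCoeff inv (z c) (v c.castSucc) (v c.succ),
      Fin.prod_univ_succ fun c => bitHom F (k.1 (z c).variable),
      Fin.prod_univ_succ fun c => blockValue k.2 (ω c) (v c)]
    simp only [Fin.castSucc_zero, Fin.succ_zero_eq_one, Fin.succ_castSucc]
    ring

/-- The value of a normal monomial, up to a constant factor: a multiplicative function of the
parameters. -/
noncomputable def normalHom {t : ℕ} (z : Fin t → Letter (FG n)) (ω : Fin (t + 1) → Block)
    (v : Fin (t + 1) → Fin n) : EvalParam F n →* F where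
  toFun k := (∏ c, bitHom F (k.1 (z c).variable)) * ∏ c, blockValue k.2 (ω c) (v c)
  map_one' := by simp [blockValue]
  map_mul' k k' := by
    simp only [blockValue, Prod.fst_mul, Prod.snd_mul, Pi.mul_apply, map_mul, List.prod_map_mul,
      Finset.prod_mul_distrib]
    ring

theorem evalEntry_normalLetters
    (hinv : IsHomogeneousInvolution (elemGrading F (fineSeq n)) (genStar n) inv)
    {t : ℕ} {z : Fin t → Letter (FG n)} (ω : Fin (t + 1) → Block)
    (hne : normalLetters z ω ≠ [])
    {v : Fin (t + 1) → Fin n} (hv : IsVertexSeq z v) :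
    ∃ c : F, c ≠ 0 ∧ evalEntry hinv (v 0) (v (Fin.last t)) (lmono F (normalLetters z ω)) =
      c • (normalHom z ω v : EvalParam F n → F) := by
  refine ⟨∏ c, letterCoeff inv (z c) (v c.castSucc) (v c.succ),
    Finset.prod_ne_zero_iff.2 fun c _ => letterCoeff_ne_zero hinv (hv c).1 (hv c).2,
    funext fun k => ?_⟩
  change (evalHom hinv k (lmono F (normalLetters z ω))).val (v 0) (v (Fin.last t)) = _
  rw [evalHom_lmono hinv k hne, normalLetters_apply hinv k ω hv]
  rfl

/-- Set one variable of nontrivial degree to 0, the others to 1 and all diagonal entries to 1: the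
value vanishes exactly when that variable occurs. -/
theorem varSet_eq_of_normalHom_eq {t t' : ℕ} {z : Fin t → Letter (FG n)}
    {z' : Fin t' → Letter (FG n)} {ω : Fin (t + 1) → Block} {ω' : Fin (t' + 1) → Block}
    {v : Fin (t + 1) → Fin n} {v' : Fin (t' + 1) → Fin n}
    (h : normalHom (F := F) z ω v = normalHom z' ω' v') :
    varSet (List.ofFn z) = varSet (List.ofFn z') := by
  classical
  have key : ∀ {t : ℕ} (z : Fin t → Letter (FG n)) (ω : Fin (t + 1) → Block)
      (v : Fin (t + 1) → Fin n) (x : FG n × ℕ),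
      normalHom (F := F) z ω v (fun y => if y = x then 0 else 1, 1) = 0 ↔
        x ∈ varSet (List.ofFn z) := by
    intro t z ω v x
    have h1 : ∏ c, blockValue (F := F) 1 (ω c) (v c) = 1 := by simp [blockValue]
    change (∏ c, bitHom F (if (z c).variable = x then 0 else 1)) *
      ∏ c, blockValue (F := F) 1 (ω c) (v c) = 0 ↔ _
    rw [h1, mul_one, Finset.prod_eq_zero_iff]
    constructor
    · rintro ⟨c, -, hc⟩
      by_cases hx : (z c).variable = x
      · exact ⟨z c, by simp, hx⟩
      · rw [if_neg hx, map_one] at hc; exact absurd hc one_ne_zero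
    · rintro ⟨l, hl, rfl⟩
      obtain ⟨c, rfl⟩ := (List.mem_ofFn).1 hl
      exact ⟨c, Finset.mem_univ _, by rw [if_pos rfl, bitHom_zero]⟩
  ext x
  rw [← key z ω v, ← key z' ω' v', h]

end Evaluation

/-! ### Normal monomials are determined by their values -/

section Separation

variable {F : Type*} [Field F] {n : ℕ}

/-- The polynomials X^e and X^e' agree at more points than their degrees. If F has q elements, all
of F is used, and e, e' ≤ q - 1 is what makes it large enough. -/
theorem eq_of_forall_pow_eq {e e' : ℕ} (hF : Finite F → e ≤ Nat.card F - 1 ∧ e' ≤ Nat.card F - 1)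
    (h : ∀ u : F, u ^ e = u ^ e') : e = e' := by
  classical
  obtain ⟨s, hs⟩ : ∃ s : Finset F, max e e' < s.card := by
    cases finite_or_infinite F with
    | inl hfin =>
      have := Fintype.ofFinite F
      refine ⟨Finset.univ, ?_⟩
      have h1 := hF hfin
      have h2 : 0 < Nat.card F := Nat.card_pos
      rw [Finset.card_univ, ← Nat.card_eq_fintype_card]
      omega
    | inr hinf =>
      obtain ⟨s, hs⟩ := Infinite.exists_subset_card_eq F (max e e' + 1)
      exact ⟨s, by omega⟩
  have hp : (Polynomial.X ^ e : Polynomial F) = Polynomial.X ^ e' := by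
    refine Polynomial.eq_of_degrees_lt_of_eval_finset_eq s ?_ ?_ fun u _ => by simpa using h u
    · rw [Polynomial.degree_X_pow]; exact_mod_cast (le_max_left e e').trans_lt hs
    · rw [Polynomial.degree_X_pow]; exact_mod_cast (le_max_right e e').trans_lt hs
  simpa using congrArg Polynomial.natDegree hp

/-- The exponent of the variable `(i, y)` in the value of a normal monomial. -/
def normalExponent {t : ℕ} (ω : Fin (t + 1) → Block) (v : Fin (t + 1) → Fin n) (i : ℕ)
    (y : Fin n) : ℕ :=
  ∑ c, ((if v c = y then (ω c).plain.count i else 0) +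
    if (v c).rev = y then (ω c).starred.count i else 0)

theorem prod_map_update (L : List ℕ) (i : ℕ) (x y : Fin n) (u : F) :
    (L.map fun m => if (m, x) = (i, y) then u else 1).prod =
      u ^ (if x = y then L.count i else 0) := by
  induction L with
  | nil => simp
  | cons m L ih =>
    rw [List.map_cons, List.prod_cons, ih]
    by_cases hx : x = y <;> by_cases hm : m = i <;> simp [hx, hm, pow_succ']

/-- Setting all parameters but one diagonal entry to 1 isolates the exponent of that entry. -/
theorem normalHom_update {t : ℕ} (z : Fin t → Letter (FG n)) (ω : Fin (t + 1) → Block)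
    (v : Fin (t + 1) → Fin n) (i : ℕ) (y : Fin n) (u : F) :
    normalHom z ω v (1, fun x => if x = (i, y) then u else 1) = u ^ normalExponent ω v i y := by
  change (∏ c, bitHom F ((1 : FG n × ℕ → ZMod 2) (z c).variable)) *
    ∏ c, blockValue (fun x => if x = (i, y) then u else 1) (ω c) (v c) = _
  simp only [Pi.one_apply, map_one, Finset.prod_const_one, one_mul, normalExponent,
    ← Finset.prod_pow_eq_pow_sum, blockValue, prod_map_update, pow_add]

theorem isPath_segment {t : ℕ} {z : Fin t → Letter (FG n)} {v : Fin (t + 1) → Fin n}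
    (hv : IsVertexSeq z v) (i j : Fin (t + 1)) (hij : i ≤ j) :
    IsPath (v i) (((List.ofFn z).take j.val).drop i.val) (v j) := by
  induction j using Fin.induction with
  | zero =>
    have : i = 0 := Fin.le_zero_iff.1 hij
    subst this
    exact rfl
  | succ c ih =>
    rcases eq_or_lt_of_le hij with rfl | hlt
    · rw [List.drop_eq_nil_of_le (by simp)]; exact rfl
    · have hic : i ≤ c.castSucc := Fin.le_castSucc_iff.2 hlt
      have hic' : i.val ≤ c.val := hic
      have htake : (List.ofFn z).take (c.val + 1) = (List.ofFn z).take c.val ++ [z c] := by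
        rw [List.take_add_one, List.getElem?_eq_getElem (by simp)]
        simp
      rw [Fin.val_succ, htake, List.drop_append_of_le_length (by simp; omega), isPath_append]
      exact ⟨_, ih hic, isPath_singleton.2 (hv c)⟩

theorem segDeg_eq {t : ℕ} (z : Fin t → Letter (FG n)) (a b : Fin t) :
    segDeg z a b = listDeg (genStar n) (((List.ofFn z).take (b.val + 1)).drop a.val) := by
  have h : (List.finRange t).filter (fun c => a ≤ c ∧ c ≤ b) =
      ((List.finRange t).take (b.val + 1)).drop a.val := by
    apply list_eq_of_map_val_eq
    rw [List.map_drop, List.map_take, List.map_coe_finRange_eq_range, List.take_range,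
      List.range_eq_range', List.drop_range']
    have : List.range' (0 + a.val * 1) (min (b.val + 1) t - a.val) =
        List.range' a.val (b.val + 1 - a.val) := by
      congr 1
      · omega
      · omega
    rw [this]
    apply List.eq_range'_of_sortedLT
    · rw [List.pairwise_map]
      exact ((List.pairwise_lt_finRange _).filter _).imp fun h => h
    · intro x
      simp only [List.mem_map, List.mem_filter, List.mem_finRange, true_and, decide_eq_true_eq]
      constructor
      · rintro ⟨k, ⟨h1, h2⟩, rfl⟩
        have h1' : a.val ≤ k.val := h1
        have h2' : k.val ≤ b.val := h2
        omega
      · intro h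
        exact ⟨⟨x, by omega⟩, ⟨Fin.le_def.2 h.1, Fin.le_def.2 (by simp only; omega)⟩, rfl⟩
  rw [segDeg, h, listDeg, List.ofFn_eq_map, ← List.map_take, ← List.map_drop, List.map_map]
  rfl

/-- In a reduced normal monomial no `∗` occurs at a vertex whose reflection is a vertex. -/
theorem IsReducedNormal.starred_eq_nil {t : ℕ} {z : Fin t → Letter (FG n)}
    {ω : Fin (t + 1) → Block} (h : IsReducedNormal F z ω) {v : Fin (t + 1) → Fin n}
    (hv : IsVertexSeq z v) (h0 : t = 0 → (v 0).val = 0) {c c' : Fin (t + 1)}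
    (hc : (v c').rev = v c) : (ω c').starred = [] := by
  -- Between two vertices that are reflections of each other the segment of the path has symmetric
  -- degree.
  have hsymm : ∀ i j : Fin (t + 1), i < j → (v i).rev = v j →
      (ω i).starred = [] ∧ (ω j).starred = [] := by
    intro i j hij hrev
    obtain ⟨a, rfl⟩ : ∃ a : Fin t, a.castSucc = i :=
      ⟨⟨i.val, by have : i.val < j.val := hij; omega⟩, rfl⟩
    obtain ⟨b, rfl⟩ : ∃ b : Fin t, b.succ = j :=
      Fin.exists_succ_eq.2 (Fin.ne_zero_of_lt hij)
    refine h.symm a b (Fin.castSucc_lt_succ_iff.1 hij) ?_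
    have hp := isPath_segment hv _ _ hij.le
    rw [Fin.val_succ, Fin.val_castSucc] at hp
    rw [segDeg_eq, hp.listDeg_eq, ← hrev]
    exact isSymmetricDeg_elemDeg (by rw [hrev]; exact hv.strictMono hij)
  rcases lt_trichotomy c' c with hlt | rfl | hlt
  · exact (hsymm _ _ hlt hc).1
  -- A self-reflected vertex is the middle index. The star is excluded by the letter of the path
  -- that follows, or at the last vertex by the one that precedes. If there is no letter, the vertex
  -- is 0, and this is the middle index only for n = 1.
  · have hval := congrArg Fin.val hc
    rw [Fin.val_rev] at hval
    have hk : n = 2 * (v c').val + 1 := by omega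
    induction c' using Fin.lastCases with
    | last =>
      rcases Nat.eq_zero_or_pos t with rfl | ht
      · have := h0 rfl
        have h1 : (v (Fin.last 0)).val = 0 := this
        exact h.one (by omega) _
      · obtain ⟨c, hcc⟩ : ∃ c : Fin t, c.succ = Fin.last t :=
          ⟨⟨t - 1, by omega⟩, Fin.ext (by simp; omega)⟩
        rw [← hcc] at hk ⊢
        exact h.middle_right _ hk c _ _ rfl (hv c).2
    | cast c => exact h.middle_left _ hk c _ _ rfl (hv c).2
  · exact (hsymm _ _ hlt (by rw [← hc, Fin.rev_rev])).2

/-- Only a starred letter at the reflected vertex could also contribute to this exponent, and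
reducedness forbids it. -/
theorem IsReducedNormal.exponent_plain {t : ℕ} {z : Fin t → Letter (FG n)}
    {ω : Fin (t + 1) → Block} (h : IsReducedNormal F z ω) {v : Fin (t + 1) → Fin n}
    (hv : IsVertexSeq z v) (h0 : t = 0 → (v 0).val = 0) (i : ℕ) (c : Fin (t + 1)) :
    normalExponent ω v i (v c) = (ω c).plain.count i := by
  rw [normalExponent, Finset.sum_eq_single c]
  · rw [if_pos rfl]
    split_ifs with hc
    · rw [h.starred_eq_nil hv h0 hc]; simp
    · rfl
  · intro c' _ hne
    rw [if_neg fun h' => hne (hv.strictMono.injective h')]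
    split_ifs with hc
    · rw [h.starred_eq_nil hv h0 hc]; simp
    · rfl
  · exact fun h => absurd (Finset.mem_univ _) h

theorem exponent_starred {t : ℕ} {z : Fin t → Letter (FG n)} (ω : Fin (t + 1) → Block)
    {v : Fin (t + 1) → Fin n} (hv : IsVertexSeq z v) (i : ℕ) (c : Fin (t + 1))
    (hc : ∀ c', v c' ≠ (v c).rev) :
    normalExponent ω v i (v c).rev = (ω c).starred.count i := by
  rw [normalExponent, Finset.sum_eq_single c]
  · rw [if_neg (hc c), if_pos rfl, zero_add]
  · intro c' _ hne
    rw [if_neg (hc c'), if_neg fun h' => hne (hv.strictMono.injective (Fin.rev_injective h')),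
      add_zero]
  · exact fun h => absurd (Finset.mem_univ _) h

/-- Every exponent is the count in one block, plain or starred, or zero, so the bound on the blocks
is inherited. -/
theorem IsReducedNormal.exponent_le {t : ℕ} {z : Fin t → Letter (FG n)}
    {ω : Fin (t + 1) → Block} (h : IsReducedNormal F z ω) {v : Fin (t + 1) → Fin n}
    (hv : IsVertexSeq z v) (h0 : t = 0 → (v 0).val = 0) (hF : Finite F) (i : ℕ) (y : Fin n) :
    normalExponent ω v i y ≤ Nat.card F - 1 := by
  by_cases hy : ∃ c, v c = y
  · obtain ⟨c, rfl⟩ := hy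
    rw [h.exponent_plain hv h0]
    exact (h.finite hF c i).1
  · push Not at hy
    by_cases hy' : ∃ c, (v c).rev = y
    · obtain ⟨c, rfl⟩ := hy'
      rw [exponent_starred ω hv i c hy]
      exact (h.finite hF c i).2
    · push Not at hy'
      simp [normalExponent, hy, hy']

theorem Block.ext_count {b b' : Block} (h : ∀ i, b.plain.count i = b'.plain.count i)
    (h' : ∀ i, b.starred.count i = b'.starred.count i) : b = b' := by
  obtain ⟨p, s, hp, hs⟩ := b
  obtain ⟨p', s', hp', hs'⟩ := b'
  have h1 : p = p' := List.Perm.eq_of_pairwise (fun _ _ _ _ => le_antisymm) hp hp'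
    (List.perm_iff_count.2 h)
  have h2 : s = s' := List.Perm.eq_of_pairwise (fun _ _ _ _ => le_antisymm) hs hs'
    (List.perm_iff_count.2 h')
  subst h1 h2
  rfl

/-- The exponents at the vertices give the plain letters. Those at reflections of vertices give the
starred ones, unless the reflection is itself a vertex; then there are none on either side. -/
theorem eq_of_normalHom_eq {t : ℕ} {z : Fin t → Letter (FG n)} {ω ω' : Fin (t + 1) → Block}
    (h : IsReducedNormal F z ω) (h' : IsReducedNormal F z ω') {v : Fin (t + 1) → Fin n}
    (hv : IsVertexSeq z v) (h0 : t = 0 → (v 0).val = 0)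
    (heq : normalHom (F := F) z ω v = normalHom z ω' v) : ω = ω' := by
  have he : ∀ i y, normalExponent ω v i y = normalExponent ω' v i y := fun i y => by
    refine eq_of_forall_pow_eq (F := F)
      (fun hF => ⟨h.exponent_le hv h0 hF i y, h'.exponent_le hv h0 hF i y⟩) fun u => ?_
    rw [← normalHom_update z, ← normalHom_update z, heq]
  funext c
  refine Block.ext_count (fun i => ?_) fun i => ?_
  · rw [← h.exponent_plain hv h0, ← h'.exponent_plain hv h0, he]
  · by_cases hc : ∃ c', v c' = (v c).rev
    · obtain ⟨c', hc'⟩ := hc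
      rw [h.starred_eq_nil hv h0 hc'.symm, h'.starred_eq_nil hv h0 hc'.symm]
    · push Not at hc
      rw [← exponent_starred ω hv i c hc, ← exponent_starred ω' hv i c hc, he]

end Separation

/-! ### Leading bases -/

section Leading

variable {F : Type*} [Field F] {n : ℕ} {ε : F} {β : Set (Word (FG n))}

theorem genClass_ne_zero_of_mem (hβ : IsLeadingBasis F ε β) {w : Word (FG n)} (hw : w ∈ β) :
    genClass ε w.toList ≠ 0 := 
  hβ.2.1.ne_zero (⟨w, hw⟩ : β)

theorem exists_isPath_of_mem (hn : 1 ≤ n) (hβ : IsLeadingBasis F ε β) {w : Word (FG n)}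
    (hw : w ∈ β) : ∃ a b, IsPath a w.toList b := by
  rcases exists_isPath_or_genClass_eq_zero ε hn w.toList with h | h
  · rwa [zPart_eq_self (hβ.1 w hw)] at h
  · exact absurd h (genClass_ne_zero_of_mem hβ hw)

/-- The flip theorem makes the two classes proportional, and independent vectors are not
proportional unless they have the same index. -/
theorem eq_of_mem_leadingBasis (hε : ε ≠ 0) (hβ : IsLeadingBasis F ε β) {w w' : Word (FG n)}
    (hw : w ∈ β) (hw' : w' ∈ β) {a b : Fin n} (h : IsPath a w.toList b)
    (h' : IsPath a w'.toList b) (hv : varSet w.toList = varSet w'.toList) : w = w' := by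
  obtain ⟨c, hc, heq⟩ := (flipRel_of_isPath _ rfl h h' hv).genClass_eq hε
  have hinj := hβ.2.1
  unfold LinearIndependent at hinj
  have h1 := @hinj (Finsupp.single ⟨w', hw'⟩ 1) (Finsupp.single ⟨w, hw⟩ c) (by
    simp only [Finsupp.linearCombination_single, one_smul]
    exact heq)
  rcases (Finsupp.single_eq_single_iff _ _ _ _).1 h1 with h2 | h2
  · exact (congrArg Subtype.val h2.1).symm
  · exact absurd h2.1 one_ne_zero

/-- The empty blocks. -/
def emptyBlock : Block := ⟨[], [], List.Pairwise.nil, List.Pairwise.nil⟩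

theorem normalLetters_emptyBlock {t : ℕ} (z : Fin t → Letter (FG n)) :
    normalLetters z (fun _ => emptyBlock) = List.ofFn z := by
  induction t with
  | zero => rw [normalLetters_zero]; simp [emptyBlock, Block.letters]
  | succ t ih =>
    rw [normalLetters_succ, ih, List.ofFn_succ]
    simp [emptyBlock, Block.letters]

/-- A path is a normal monomial with empty blocks. -/
theorem evalEntry_of_isPath {inv : UT F n →ₗ[F] UT F n}
    (hinv : IsHomogeneousInvolution (elemGrading F (fineSeq n)) (genStar n) inv)
    {a b : Fin n} {w : Word (FG n)} (h : IsPath a w.toList b) :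
    ∃ (c : F) (χ : EvalParam F n →* F), c ≠ 0 ∧
      evalEntry hinv a b (mono F w) = c • (χ : EvalParam F n → F) ∧
      ∃ (t : ℕ) (z : Fin t → Letter (FG n)) (v : Fin (t + 1) → Fin n), w.toList = List.ofFn z ∧
        χ = normalHom z (fun _ => emptyBlock) v := by
  have hz : w.toList = List.ofFn w.toList.get := (List.ofFn_get _).symm
  obtain ⟨v, rfl, rfl, hv⟩ := IsPath.exists_isVertexSeq (hz ▸ h)
  have hnl := normalLetters_emptyBlock w.toList.get
  obtain ⟨c, hc, heq⟩ := evalEntry_normalLetters hinv (fun _ => emptyBlock)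
    (by rw [hnl, ← hz]; exact w.toList_ne_nil) hv
  rw [hnl, ← hz, lmono_toList] at heq
  exact ⟨c, _, hc, heq, _, _, v, hz, rfl⟩

/-- That β spans gives only a linear combination for the class of w. If no element of β were related
to w by flips, each would have at this entry either the value 0 or a character different from that
of w, since equal characters mean equal variables; this contradicts independence of characters. -/
theorem exists_mem_leadingBasis (hn : 1 ≤ n) {inv : UT F n →ₗ[F] UT F n}
    (hinv : IsHomogeneousInvolution (elemGrading F (fineSeq n)) (genStar n) inv)
    (hε : (ε = 1 ∧ IsOrthogonal inv) ∨ (ε = -1 ∧ IsSymplectic inv))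
    (hβ : IsLeadingBasis F ε β) {w : Word (FG n)} {a b : Fin n} (h : IsPath a w.toList b) :
    ∃ w' ∈ β, FlipRel w.toList w'.toList := by
  by_contra! hno
  have hmem : (genTIdeal F n ε).mkQ (mono F w) ∈
      Submodule.span F ((genTIdeal F n ε).mkQ '' (mono F '' β)) := by
    have h1 : (genTIdeal F n ε).mkQ '' (mono F '' β) =
        Set.range fun w : β => (genTIdeal F n ε).mkQ (mono F w.val) := by
      rw [Set.image_image, Set.image_eq_range]
    rw [h1, hβ.2.2]
    exact Submodule.subset_span ⟨w, (mem_goodWords_iff hn w).2 ⟨a, b, h⟩, rfl⟩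
  obtain ⟨c, χ, hc, heq, t, z, v, hz, hχ⟩ := evalEntry_of_isPath hinv h
  refine mkQ_notMem_span_of_evalEntry hinv (genTIdeal_le_gradedStarIdentities hinv hε) a b hc heq
    ?_ hmem
  rintro _ ⟨w', hw', rfl⟩
  obtain ⟨a', b', h'⟩ := exists_isPath_of_mem hn hβ hw'
  by_cases hd : listDeg (genStar n) w'.toList = elemDeg (fineSeq n) a b
  · right
    rw [h'.listDeg_eq] at hd
    obtain ⟨rfl, rfl⟩ := elemDeg_inj (h'.lt w'.toList_ne_nil) hd
    obtain ⟨c', χ', hc', heq', t', z', v', hz', hχ'⟩ := evalEntry_of_isPath hinv h'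
    refine ⟨χ', c', fun hχχ => ?_, heq'⟩
    rw [hχ, hχ'] at hχχ
    have hvs := varSet_eq_of_normalHom_eq hχχ
    rw [← hz, ← hz'] at hvs
    exact hno w' hw' (flipRel_of_isPath _ rfl h h' hvs.symm)
  · left
    exact evalEntry_eq_zero_of_deg_ne hinv a b hd

theorem exists_isLeadingBasis (F : Type*) [Field F] (n : ℕ) (hn : 1 ≤ n) (ε : F) :
    ∃ β : Set (Word (FG n)), IsLeadingBasis F ε β := by
  obtain ⟨κ, f, hf, hsp, hli⟩ := exists_linearIndependent' F
    (fun w : goodWords (n := n) F => (genTIdeal F n ε).mkQ (mono F w.val))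
  refine ⟨Set.range fun k => (f k).val, ?_, ?_, ?_⟩
  · rintro _ ⟨k, rfl⟩ l hl
    obtain ⟨a, b, h⟩ := (mem_goodWords_iff hn _).1 (f k).2
    exact h.deg_ne_one hl
  · have hinj : Function.Injective fun k => (f k).val := Subtype.val_injective.comp hf
    rw [← linearIndependent_equiv (Equiv.ofInjective _ hinj)]
    exact hli
  · have h1 : (Set.range fun w : Set.range fun k => (f k).val =>
        (genTIdeal F n ε).mkQ (mono F w.val)) = Set.range
        ((fun w : goodWords (n := n) F => (genTIdeal F n ε).mkQ (mono F w.val)) ∘ f) := by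
      ext x; simp
    rw [h1, hsp, Set.image_eq_range]

end Leading

/-! ### Reduction to normal monomials -/

section Spanning

variable {F : Type*} [Field F] {n : ℕ}

theorem varDeg_eq_one {l : Letter (FG n)} (h : l.deg (genStar n) = 1) : l.varDeg = 1 := by
  obtain ⟨g, i, b⟩ := l
  cases b
  · simpa [Letter.deg] using h
  · simpa [Letter.deg, genStar_eq_one_iff] using h

theorem deg_of_varDeg_eq_one (i : ℕ) (b : Bool) :
    Letter.deg (genStar n) (⟨1, i, b⟩ : Letter (FG n)) = 1 := by
  cases b <;> simp [Letter.deg, genStar_one]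

theorem Block.deg_eq_one (b : Block) {l : Letter (FG n)} (hl : l ∈ b.letters n) :
    l.deg (genStar n) = 1 := by
  simp only [Block.letters, List.mem_append, List.mem_map] at hl
  rcases hl with ⟨i, -, rfl⟩ | ⟨i, -, rfl⟩ <;> exact deg_of_varDeg_eq_one i _

theorem Block.zPart_letters (b : Block) : zPart (b.letters n) = [] :=
  zPart_eq_nil fun _ hl => b.deg_eq_one hl

theorem Block.exists_perm_cons (b : Block) {l : Letter (FG n)} (hl : l.deg (genStar n) = 1) :
    ∃ b' : Block, (l :: b.letters n).Perm (b'.letters n) := by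
  have h1 := varDeg_eq_one hl
  obtain ⟨g, i, s⟩ := l
  obtain rfl : g = 1 := h1
  cases s
  · refine ⟨⟨b.plain.orderedInsert (· ≤ ·) i, b.starred,
      b.plain_sorted.orderedInsert i _, b.starred_sorted⟩, ?_⟩
    exact ((List.perm_orderedInsert (· ≤ ·) i b.plain).map
      fun i => (⟨1, i, false⟩ : Letter (FG n))).symm.append_right _
  · refine ⟨⟨b.plain, b.starred.orderedInsert (· ≤ ·) i,
      b.plain_sorted, b.starred_sorted.orderedInsert i _⟩, ?_⟩
    exact List.perm_middle.symm.trans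
      (((List.perm_orderedInsert (· ≤ ·) i b.starred).map
        fun i => (⟨1, i, true⟩ : Letter (FG n))).symm.append_left _)

theorem zPart_normalLetters {t : ℕ} {z : Fin t → Letter (FG n)}
    (hz : ∀ c, (z c).deg (genStar n) ≠ 1) (ω : Fin (t + 1) → Block) :
    zPart (normalLetters z ω) = List.ofFn z := by
  induction t with
  | zero => rw [normalLetters_zero, Block.zPart_letters, List.ofFn_zero]
  | succ t ih =>
    rw [normalLetters_succ, zPart_append, Block.zPart_letters, List.nil_append,
      zPart_cons_of_ne (hz 0), ih fun c => hz _, List.ofFn_succ]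

/-- Isolates one block and records which z's lie on either side of it, the form in which the
reductions below are applied. -/
theorem normalLetters_split {t : ℕ} {z : Fin t → Letter (FG n)}
    (hz : ∀ c, (z c).deg (genStar n) ≠ 1) (ω : Fin (t + 1) → Block) (c : Fin (t + 1)) :
    ∃ A B, normalLetters z ω = A ++ (ω c).letters n ++ B ∧
      zPart A = (List.ofFn z).take c.val ∧ zPart B = (List.ofFn z).drop c.val := by
  induction t with
  | zero =>
    obtain rfl : c = 0 := Fin.eq_zero c
    exact ⟨[], [], by simp [normalLetters_zero], by simp [zPart], by simp [zPart]⟩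
  | succ t ih =>
    refine Fin.cases ?_ (fun c => ?_) c
    · refine ⟨[], z 0 :: normalLetters (fun c => z c.succ) (fun c => ω c.succ), ?_, by simp [zPart],
        ?_⟩
      · rw [normalLetters_succ, List.nil_append]
      · rw [zPart_cons_of_ne (hz 0), zPart_normalLetters fun c => hz _]
        simp [List.ofFn_succ]
    · obtain ⟨A, B, h1, h2, h3⟩ := ih (z := fun c => z c.succ) (fun c => hz _)
        (fun c => ω c.succ) c
      refine ⟨(ω 0).letters n ++ z 0 :: A, B, ?_, ?_, ?_⟩
      · rw [normalLetters_succ, h1]; simp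
      · rw [zPart_append, Block.zPart_letters, zPart_cons_of_ne (hz 0), h2, List.ofFn_succ]
        simp
      · rw [h3, List.ofFn_succ]; simp

/-- Every monomial can be brought into normal form by sorting. -/
theorem exists_normalLetters (ε : F) (L : List (Letter (FG n))) :
    ∃ (t : ℕ) (z : Fin t → Letter (FG n)) (ω : Fin (t + 1) → Block),
      (∀ c, (z c).deg (genStar n) ≠ 1) ∧ L.Perm (normalLetters z ω) ∧ zPart L = List.ofFn z ∧
      ∀ A, genClass ε (A ++ L) = genClass ε (A ++ normalLetters z ω) := by
  induction L with
  | nil =>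
    refine ⟨0, Fin.elim0, fun _ => emptyBlock, fun c => c.elim0, ?_, ?_, ?_⟩
    · simp [normalLetters_zero, emptyBlock, Block.letters]
    · simp [zPart]
    · simp [normalLetters_zero, emptyBlock, Block.letters]
  | cons l L ih =>
    obtain ⟨t, z, ω, hz, hp, hzp, hcl⟩ := ih
    by_cases hl : l.deg (genStar n) = 1
    -- A new first letter of trivial degree is sorted into the first block; the remainder R stays as
    -- it is.
    · obtain ⟨b, hb⟩ := (ω 0).exists_perm_cons hl
      let R := (List.finRange t).flatMap fun c => z c :: (ω c.succ).letters n
      have h1 : normalLetters z ω = (ω 0).letters n ++ R := rfl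
      have h2 : normalLetters z (Fin.cons b fun c => ω c.succ) = b.letters n ++ R := rfl
      refine ⟨t, z, Fin.cons b fun c => ω c.succ, hz, ?_, ?_, fun A => ?_⟩
      · rw [h2]
        exact (hp.cons l).trans (by rw [h1, ← List.cons_append]; exact hb.append_right R)
      · rw [zPart_cons_of_eq hl, hzp]
      · have h3 := hcl (A ++ [l])
        have h4 := genClass_perm (ε := ε) hb (by
          intro m hm
          rcases List.mem_cons.1 hm with rfl | hm
          · exact hl
          · exact (ω 0).deg_eq_one hm) A R
        rw [h1] at h3
        rw [h2]
        simpa using h3.trans (by simpa using h4)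
    · refine ⟨t + 1, Fin.cons l z, Fin.cons emptyBlock ω, fun c => ?_, ?_, ?_, fun A => ?_⟩
      · refine Fin.cases hl (fun c => ?_) c
        simpa using hz c
      · rw [normalLetters_succ]
        simpa [emptyBlock, Block.letters] using hp
      · rw [zPart_cons_of_ne hl, hzp, List.ofFn_succ]; simp
      · rw [normalLetters_succ]
        simpa [emptyBlock, Block.letters] using hcl (A ++ [l])

/-- The number of the letters plus the number of the starred letters of trivial degree. -/
noncomputable def letterWeight (L : List (Letter (FG n))) : ℕ :=
  open Classical in L.length + L.countP fun l => l.deg (genStar n) = 1 ∧ l.starred = true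

theorem letterWeight_append (L M : List (Letter (FG n))) :
    letterWeight (L ++ M) = letterWeight L + letterWeight M := by
  simp only [letterWeight, List.length_append, List.countP_append]; omega

theorem List.Perm.letterWeight_eq {L M : List (Letter (FG n))} (h : L.Perm M) :
    letterWeight L = letterWeight M := by
  classical
  simp only [letterWeight, h.length_eq, h.countP_eq]

theorem letterWeight_plain (i : ℕ) :
    letterWeight [(⟨1, i, false⟩ : Letter (FG n))] = 1 := by
  simp [letterWeight]

theorem letterWeight_starred (i : ℕ) :
    letterWeight [(⟨1, i, true⟩ : Letter (FG n))] = 2 := by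
  simp [letterWeight, deg_of_varDeg_eq_one]

theorem letterWeight_replicate (q : ℕ) (l : Letter (FG n)) :
    letterWeight (List.replicate q l) = q * letterWeight [l] := by
  induction q with
  | zero => simp [letterWeight]
  | succ q ih =>
    rw [List.replicate_succ', letterWeight_append, ih]; ring

/-- A monomial is a multiple of a monomial with the same letters of nontrivial degree but of smaller
weight. -/
def IsReducible (ε : F) (L : List (Letter (FG n))) : Prop :=
  ∃ (L' : List (Letter (FG n))) (c : F), zPart L' = zPart L ∧ letterWeight L' < letterWeight L ∧
    L' ≠ [] ∧ genClass ε L = c • genClass ε L'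

/-- Replacing a block by a permutation of it. -/
theorem IsReducible.of_perm {ε : F} {A K K' B : List (Letter (FG n))} (h : K.Perm K')
    (hK : ∀ l ∈ K, l.deg (genStar n) = 1) (hr : IsReducible ε (A ++ K' ++ B)) :
    IsReducible ε (A ++ K ++ B) := by
  obtain ⟨L', c, h1, h2, h3, h4⟩ := hr
  have hK' : ∀ l ∈ K', l.deg (genStar n) = 1 := fun l hl => hK l (h.mem_iff.2 hl)
  refine ⟨L', c, ?_, ?_, h3, by rw [genClass_perm h hK, h4]⟩
  · rw [h1]; simp [zPart_append, zPart_eq_nil hK, zPart_eq_nil hK']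
  · rw [letterWeight_append, letterWeight_append, h.letterWeight_eq, ← letterWeight_append,
      ← letterWeight_append]
    exact h2

theorem exists_perm_concat {α : Type*} {L : List α} {x : α} (h : x ∈ L) :
    ∃ E, L.Perm (E ++ [x]) := by
  obtain ⟨A, B, rfl⟩ := List.append_of_mem h
  exact ⟨A ++ B, List.perm_middle.trans (List.perm_append_singleton x (A ++ B)).symm⟩

theorem exists_perm_cons {α : Type*} {L : List α} {x : α} (h : x ∈ L) :
    ∃ E, L.Perm (x :: E) := by
  obtain ⟨A, B, rfl⟩ := List.append_of_mem h
  exact ⟨A ++ B, List.perm_middle⟩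

theorem Block.mem_letters_starred {b : Block} {j : ℕ} (h : j ∈ b.starred) :
    (⟨1, j, true⟩ : Letter (FG n)) ∈ b.letters n := by
  simp [Block.letters, h]

/-- Sort the starred letter to the end of its block and push it across B: it loses its star, so the
weight drops by one. -/
theorem isReducible_right {ε : F} (hε : ε * ε = 1) {A K B C : List (Letter (FG n))} {j : ℕ}
    (hK : ∀ l ∈ K, l.deg (genStar n) = 1) (hj : (⟨1, j, true⟩ : Letter (FG n)) ∈ K)
    (hB : IsSymmetricDeg (listDeg (genStar n) B)) : IsReducible ε (A ++ K ++ (B ++ C)) := by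
  obtain ⟨E, hE⟩ := exists_perm_concat hj
  refine IsReducible.of_perm hE hK ⟨A ++ E ++ B ++ [⟨1, j, false⟩] ++ C, 1, ?_, ?_, by simp, ?_⟩
  · simp [zPart_append, zPart_cons_of_eq, deg_of_varDeg_eq_one]
  · simp only [letterWeight_append, letterWeight_plain, letterWeight_starred]; omega
  · have := genClass_move_right hε (s := ⟨1, j, true⟩) (deg_of_varDeg_eq_one j _) hB (A ++ E) C
    rw [one_smul]
    simpa [Letter.star] using this

theorem isReducible_left {ε : F} (hε : ε * ε = 1) {A B K C : List (Letter (FG n))} {j : ℕ}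
    (hK : ∀ l ∈ K, l.deg (genStar n) = 1) (hj : (⟨1, j, true⟩ : Letter (FG n)) ∈ K)
    (hB : IsSymmetricDeg (listDeg (genStar n) B)) : IsReducible ε (A ++ B ++ K ++ C) := by
  obtain ⟨E, hE⟩ := exists_perm_cons hj
  refine IsReducible.of_perm hE hK ⟨A ++ [⟨1, j, false⟩] ++ B ++ E ++ C, 1, ?_, ?_, by simp, ?_⟩
  · simp [zPart_append, zPart_cons_of_eq, deg_of_varDeg_eq_one]
  · rw [← List.singleton_append (l := E)]
    simp only [letterWeight_append, letterWeight_plain, letterWeight_starred]; omega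
  · have := genClass_move_left hε (s := ⟨1, j, true⟩) (deg_of_varDeg_eq_one j _) hB A (E ++ C)
    rw [one_smul]
    simpa [Letter.star] using this

theorem isReducible_middle_left (ε : F) {k : ℕ} (hn : n = 2 * k + 1) {c i : Fin n}
    (hc : c.val = k) (hi : c < i) {z : Letter (FG n)}
    (hz : z.deg (genStar n) = elemDeg (fineSeq n) c i) {A K C : List (Letter (FG n))} {j : ℕ}
    (hK : ∀ l ∈ K, l.deg (genStar n) = 1) (hj : (⟨1, j, true⟩ : Letter (FG n)) ∈ K) :
    IsReducible ε (A ++ K ++ z :: C) := by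
  obtain ⟨E, hE⟩ := exists_perm_concat hj
  refine IsReducible.of_perm hE hK ⟨A ++ E ++ [⟨1, j, false⟩, z] ++ C, 1, ?_, ?_, by simp, ?_⟩
  · rw [show A ++ E ++ [(⟨1, j, false⟩ : Letter (FG n)), z] ++ C =
      A ++ E ++ [⟨1, j, false⟩] ++ z :: C by simp, show A ++ (E ++ [(⟨1, j, true⟩ : Letter (FG n))])
      ++ z :: C = A ++ E ++ [⟨1, j, true⟩] ++ z :: C by simp]
    simp only [zPart_append, zPart_eq_nil (L := [(⟨1, j, _⟩ : Letter (FG n))])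
      (by simp [deg_of_varDeg_eq_one])]
  · rw [show A ++ E ++ [(⟨1, j, false⟩ : Letter (FG n)), z] ++ C =
      A ++ E ++ [⟨1, j, false⟩] ++ z :: C by simp]
    simp only [letterWeight_append, letterWeight_plain, letterWeight_starred]; omega
  · have := genClass_middle_left ε hn hc hi (s := ⟨1, j, true⟩) (deg_of_varDeg_eq_one j _) hz
      (A ++ E) C
    rw [one_smul]
    simpa [Letter.star] using this

theorem isReducible_middle_right (ε : F) {k : ℕ} (hn : n = 2 * k + 1) {c i : Fin n}
    (hc : c.val = k) (hi : i < c) {z : Letter (FG n)}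
    (hz : z.deg (genStar n) = elemDeg (fineSeq n) i c) {A K C : List (Letter (FG n))} {j : ℕ}
    (hK : ∀ l ∈ K, l.deg (genStar n) = 1) (hj : (⟨1, j, true⟩ : Letter (FG n)) ∈ K) :
    IsReducible ε (A ++ [z] ++ K ++ C) := by
  obtain ⟨E, hE⟩ := exists_perm_cons hj
  refine IsReducible.of_perm hE hK ⟨A ++ [z, ⟨1, j, false⟩] ++ E ++ C, 1, ?_, ?_, by simp, ?_⟩
  · rw [show A ++ [z, (⟨1, j, false⟩ : Letter (FG n))] ++ E ++ C =
      A ++ [z] ++ [⟨1, j, false⟩] ++ E ++ C by simp, ← List.singleton_append (l := E)]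
    simp only [zPart_append, zPart_eq_nil (L := [(⟨1, j, _⟩ : Letter (FG n))])
      (by simp [deg_of_varDeg_eq_one]), List.nil_append, List.append_nil]
  · rw [show A ++ [z, (⟨1, j, false⟩ : Letter (FG n))] ++ E ++ C =
      A ++ [z] ++ [⟨1, j, false⟩] ++ E ++ C by simp, ← List.singleton_append (l := E)]
    simp only [letterWeight_append, letterWeight_plain, letterWeight_starred]; omega
  · have := genClass_middle_right ε hn hc hi (s := ⟨1, j, true⟩) (deg_of_varDeg_eq_one j _) hz
      A (E ++ C)
    rw [one_smul]
    simpa [Letter.star] using this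

theorem isReducible_of_eq_one (ε : F) (hn : n = 1) {A K C : List (Letter (FG n))} {j : ℕ}
    (hK : ∀ l ∈ K, l.deg (genStar n) = 1) (hj : (⟨1, j, true⟩ : Letter (FG n)) ∈ K) :
    IsReducible ε (A ++ K ++ C) := by
  obtain ⟨E, hE⟩ := exists_perm_cons hj
  refine IsReducible.of_perm hE hK ⟨A ++ [⟨1, j, false⟩] ++ E ++ C, ε, ?_, ?_, by simp, ?_⟩
  · simp [zPart_append, zPart_cons_of_eq, deg_of_varDeg_eq_one]
  · rw [← List.singleton_append (l := E)]
    simp only [letterWeight_append, letterWeight_plain, letterWeight_starred]; omega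
  · have := genClass_star_of_eq_one ε hn (s := ⟨1, j, false⟩) (deg_of_varDeg_eq_one j _)
      A (E ++ C)
    simpa [Letter.star] using this

theorem isReducible_frobenius (ε : F) (hF : Finite F) {A K C : List (Letter (FG n))}
    {s : Letter (FG n)} (hs : s.deg (genStar n) = 1)
    (hK : ∀ l ∈ K, l.deg (genStar n) = 1)
    (hsub : (List.replicate (Nat.card F) s).Sublist K) : IsReducible ε (A ++ K ++ C) := by
  obtain ⟨E, hE⟩ := hsub.exists_perm_append
  -- Replacing s^q by s is a genuine shortening because q ≥ 2.
  have hq : 1 < Nat.card F := Finite.one_lt_card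
  have hw : 0 < letterWeight [s] := by simp [letterWeight]
  refine IsReducible.of_perm hE hK ⟨A ++ [s] ++ E ++ C, 1, ?_, ?_, by simp, ?_⟩
  · have h1 : zPart (List.replicate (Nat.card F) s) = [] :=
      zPart_eq_nil fun l hl => by rw [List.eq_of_mem_replicate hl, hs]
    have h2 : zPart [s] = [] := zPart_eq_nil (by simp [hs])
    simp only [zPart_append, h1, h2]; simp
  · simp only [letterWeight_append, letterWeight_replicate]
    nlinarith
  · have := genClass_frobenius ε hs A (E ++ C)
    rw [one_smul]
    simpa using this

theorem drop_eq_segment_append {α : Type*} (D : List α) {a b : ℕ} (hab : a ≤ b)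
    (hb : b ≤ D.length) : D.drop a = (D.take b).drop a ++ D.drop b := by
  conv_lhs => rw [← List.take_append_drop b D]
  rw [List.drop_append_of_le_length (by rw [List.length_take]; omega)]

theorem take_eq_append_segment {α : Type*} (D : List α) {a b : ℕ} (hab : a ≤ b) :
    D.take b = D.take a ++ (D.take b).drop a := by
  conv_lhs => rw [← List.take_append_drop a (D.take b)]
  rw [List.take_take, min_eq_left hab]

/-- Irreducible normal monomials satisfy the conditions on the elements of the basis. -/
theorem isReducedNormal_of_not_isReducible {ε : F} (hε : ε * ε = 1) (hn : 1 ≤ n) {t : ℕ}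
    {z : Fin t → Letter (FG n)} {ω : Fin (t + 1) → Block} (hz : ∀ c, (z c).deg (genStar n) ≠ 1)
    (hgood : ∃ a b, IsPath a (List.ofFn z) b) (hr : ¬ IsReducible ε (normalLetters z ω)) :
    IsReducedNormal F z ω where
  nontrivial := hz
  good := (isGood_ofFn_iff hn z).2 hgood
  symm a b hab hs := by
    rw [segDeg_eq] at hs
    have hab' : a.val ≤ b.val := hab
    constructor
    · by_contra hne
      obtain ⟨j, hj⟩ := List.exists_mem_of_ne_nil _ hne
      obtain ⟨A, B, h1, -, h3⟩ := normalLetters_split hz ω a.castSucc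
      rw [Fin.val_castSucc, drop_eq_segment_append _ (b := b.val + 1) (by omega)
        (by rw [List.length_ofFn]; omega)] at h3
      -- B1 is the full factor, blocks included, lying over the segment of the z's; it has the same
      -- degree, and the starred letter is pushed across it.
      obtain ⟨B1, B2, rfl, hB1, -⟩ := zPart_eq_append h3
      rw [← hB1, listDeg_zPart] at hs
      rw [h1] at hr
      exact hr (isReducible_right hε (fun l hl => Block.deg_eq_one _ hl)
        (Block.mem_letters_starred hj) hs)
    · by_contra hne
      obtain ⟨j, hj⟩ := List.exists_mem_of_ne_nil _ hne
      obtain ⟨A, B, h1, h2, -⟩ := normalLetters_split hz ω b.succ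
      rw [Fin.val_succ, take_eq_append_segment _ (a := a.val) (by omega)] at h2
      obtain ⟨A1, A2, rfl, -, hA2⟩ := zPart_eq_append h2
      rw [← hA2, listDeg_zPart] at hs
      rw [h1] at hr
      exact hr (isReducible_left hε (fun l hl => Block.deg_eq_one _ hl)
        (Block.mem_letters_starred hj) hs)
  middle_left k hk c i j hi hd := by
    by_contra hne
    obtain ⟨m, hm⟩ := List.exists_mem_of_ne_nil _ hne
    obtain ⟨A, B, h1, -, h3⟩ := normalLetters_split hz ω c.castSucc
    rw [Fin.val_castSucc, List.drop_eq_getElem_cons (by simp)] at h3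
    -- Only the z-part of B is known, so letters D1 of trivial degree in front of `z c` are allowed
    -- for and absorbed into the block.
    obtain ⟨D1, D2, rfl, hD1, -, -⟩ := List.filter_eq_cons_iff.1 h3
    have hij : i < j := by
      by_contra h; exact hz c (hd.trans (elemDeg_of_le (not_lt.1 h)))
    rw [h1, show A ++ (ω c.castSucc).letters n ++
      (D1 ++ (List.ofFn z)[c.val]'(by simp) :: D2) = A ++ ((ω c.castSucc).letters n ++ D1) ++
        (List.ofFn z)[c.val]'(by simp) :: D2 by simp] at hr
    refine hr (isReducible_middle_left ε hk hi hij (by simpa using hd) (fun l hl => ?_)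
      (List.mem_append_left _ (Block.mem_letters_starred hm)))
    rcases List.mem_append.1 hl with hl | hl
    · exact Block.deg_eq_one _ hl
    · simpa using hD1 l hl
  middle_right k hk c i j hi hd := by
    by_contra hne
    obtain ⟨m, hm⟩ := List.exists_mem_of_ne_nil _ hne
    obtain ⟨A, B, h1, h2, -⟩ := normalLetters_split hz ω c.succ
    rw [Fin.val_succ, List.take_add_one, List.getElem?_eq_getElem (by simp)] at h2
    obtain ⟨A1, A2, rfl, -, hA2⟩ := zPart_eq_append h2
    simp only [Option.toList_some, List.getElem_ofFn] at hA2
    obtain ⟨D1, D2, rfl, -, -, hD2⟩ := List.filter_eq_cons_iff.1 hA2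
    have hij : j < i := by
      by_contra h; exact hz c (hd.trans (elemDeg_of_le (not_lt.1 h)))
    rw [h1, show A1 ++ (D1 ++ z c :: D2) ++ (ω c.succ).letters n ++ B =
      A1 ++ D1 ++ [z c] ++ (D2 ++ (ω c.succ).letters n) ++ B by simp] at hr
    refine hr (isReducible_middle_right ε hk hi hij hd (fun l hl => ?_)
      (List.mem_append_right _ (Block.mem_letters_starred hm)))
    rcases List.mem_append.1 hl with hl | hl
    · simpa using (List.filter_eq_nil_iff.1 hD2) l hl
    · exact Block.deg_eq_one _ hl
  one h c := by
    by_contra hne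
    obtain ⟨m, hm⟩ := List.exists_mem_of_ne_nil _ hne
    obtain ⟨A, B, h1, -, -⟩ := normalLetters_split hz ω c
    rw [h1] at hr
    exact hr (isReducible_of_eq_one ε h (fun l hl => Block.deg_eq_one _ hl)
      (Block.mem_letters_starred hm))
  finite hF c i := by
    obtain ⟨A, B, h1, -, -⟩ := normalLetters_split hz ω c
    rw [h1] at hr
    have hq : 0 < Nat.card F := Nat.card_pos
    constructor
    · by_contra hlt
      have hsub : (List.replicate (Nat.card F) i).Sublist (ω c).plain :=
        List.replicate_sublist_iff.2 (by omega)
      refine hr (isReducible_frobenius ε hF (s := ⟨1, i, false⟩) (deg_of_varDeg_eq_one i _)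
        (fun l hl => Block.deg_eq_one _ hl) ?_)
      have := hsub.map fun i => (⟨1, i, false⟩ : Letter (FG n))
      rw [List.map_replicate] at this
      exact this.trans (List.sublist_append_left _ _)
    · by_contra hlt
      have hsub : (List.replicate (Nat.card F) i).Sublist (ω c).starred :=
        List.replicate_sublist_iff.2 (by omega)
      refine hr (isReducible_frobenius ε hF (s := ⟨1, i, true⟩) (deg_of_varDeg_eq_one i _)
        (fun l hl => Block.deg_eq_one _ hl) ?_)
      have := hsub.map fun i => (⟨1, i, true⟩ : Letter (FG n))
      rw [List.map_replicate] at this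
      exact this.trans (List.sublist_append_right _ _)

variable {ε : F} {β : Set (Word (FG n))}

/-- Induction on the weight: sort, and reduce as long as possible. No reduction changes the z-part,
so it stays in β (or empty), and an irreducible normal monomial lies in the basis. -/
theorem genClass_mem_span_of_zPart (hε : ε * ε = 1) (hn : 1 ≤ n) (hβ : IsLeadingBasis F ε β)
    (k : ℕ) : ∀ L : List (Letter (FG n)), letterWeight L = k → L ≠ [] →
      (zPart L = [] ∨ ∃ w ∈ β, w.toList = zPart L) →
      genClass ε L ∈ Submodule.span F (Set.range fun w : normalBasis F β =>
        (genTIdeal F n ε).mkQ (mono F w.val)) := by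
  induction k using Nat.strong_induction_on with
  | _ k ih =>
  intro L hk hL hzL
  obtain ⟨t, z, ω, hz, hp, hzp, hcl⟩ := exists_normalLetters ε L
  have hcl : genClass ε L = genClass ε (normalLetters z ω) := hcl []
  rw [hcl]
  by_cases hr : IsReducible ε (normalLetters z ω)
  · obtain ⟨L', c, h1, h2, h3, h4⟩ := hr
    rw [h4]
    refine Submodule.smul_mem _ _ (ih _ ?_ L' rfl h3 ?_)
    · rwa [← hk, hp.letterWeight_eq]
    · rwa [h1, zPart_normalLetters hz, ← hzp]
  · have hne : normalLetters z ω ≠ [] := by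
      intro h; rw [h] at hp; exact hL hp.eq_nil
    have hgood : ∃ a b, IsPath a (List.ofFn z) b := by
      rw [← hzp]
      rcases hzL with h | ⟨w, hw, h⟩
      · rw [h]; exact ⟨⟨0, hn⟩, ⟨0, hn⟩, rfl⟩
      · rw [← h]; exact exists_isPath_of_mem hn hβ hw
    have hred := isReducedNormal_of_not_isReducible hε hn hz hgood hr
    obtain ⟨w, hw⟩ := Word.exists_toList_eq hne
    rw [← hw]
    refine Submodule.subset_span ⟨⟨w, t, z, ω, hred, hw, ?_⟩, rfl⟩
    rcases hzL with h | ⟨v, hv, h⟩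
    · left
      rw [hzp] at h
      simpa using congrArg List.length h
    · exact Or.inr ⟨v, hv, h.trans hzp⟩

/-- A word that does not vanish has a path as its z-part. Flips, lifted to the whole word, bring
this path into β at the cost of a scalar, and then the weight induction applies. -/
theorem span_normalBasis (hn : 1 ≤ n) {inv : UT F n →ₗ[F] UT F n}
    (hinv : IsHomogeneousInvolution (elemGrading F (fineSeq n)) (genStar n) inv)
    (hε : (ε = 1 ∧ IsOrthogonal inv) ∨ (ε = -1 ∧ IsSymplectic inv))
    (hβ : IsLeadingBasis F ε β) :
    Submodule.span F (Set.range fun w : normalBasis F β =>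
      (genTIdeal F n ε).mkQ (mono F w.val)) = ⊤ := by
  have hεε := sign_mul_sign hε
  have hε0 : ε ≠ 0 := left_ne_zero_of_mul (hεε ▸ one_ne_zero)
  rw [eq_top_iff]
  rintro x -
  obtain ⟨f, rfl⟩ := Submodule.mkQ_surjective _ x
  induction f using freeStarAlg_induction with
  | h0 => rw [map_zero]; exact zero_mem _
  | hadd f g hf hg => rw [map_add]; exact add_mem hf hg
  | hmono c w =>
    rw [map_smul]
    refine Submodule.smul_mem _ _ ?_
    rw [← genClass_toList]
    by_cases hz : zPart w.toList = []
    · exact genClass_mem_span_of_zPart hεε hn hβ _ _ rfl w.toList_ne_nil (Or.inl hz)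
    rcases exists_isPath_or_genClass_eq_zero ε hn w.toList with ⟨a, b, h⟩ | h
    · obtain ⟨v, hv⟩ := Word.exists_toList_eq hz
      rw [← hv] at h
      obtain ⟨v', hv', hflip⟩ := exists_mem_leadingBasis hn hinv hε hβ h
      rw [hv] at hflip
      obtain ⟨L', hL', hz'⟩ := hflip.lift_zPart
      obtain ⟨e, -, he⟩ := hL'.symm.genClass_eq hε0
      rw [he]
      refine Submodule.smul_mem _ _ (genClass_mem_span_of_zPart hεε hn hβ _ _ rfl ?_
        (Or.inr ⟨v', hv', hz'.symm⟩))
      rintro rfl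
      exact v'.toList_ne_nil hz'.symm
    · rw [h]; exact zero_mem _

end Spanning

/-! ### Linear independence modulo the identities, and the equality of the two ideals -/

section Main

variable {F : Type*} [Field F] {n : ℕ}

/-- For t = 0 no path prescribes a vertex. Fixing the vertex 0 lets all these monomials be compared
at one entry, and for n > 1 it differs from its reflection. -/
theorem IsReducedNormal.exists_isVertexSeq (hn : 1 ≤ n) {t : ℕ} {z : Fin t → Letter (FG n)}
    {ω : Fin (t + 1) → Block} (h : IsReducedNormal F z ω) :
    ∃ v : Fin (t + 1) → Fin n, IsVertexSeq z v ∧ (t = 0 → (v 0).val = 0) := by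
  by_cases ht : t = 0
  · subst ht
    exact ⟨fun _ => ⟨0, hn⟩, fun c => c.elim0, fun _ => rfl⟩
  · obtain ⟨a, b, hp⟩ := (isGood_ofFn_iff hn z).1 h.good
    obtain ⟨v, -, -, hv⟩ := hp.exists_isVertexSeq
    exact ⟨v, hv, fun h => absurd h ht⟩

/-- Each basis monomial is tested at the entry given by the ends of its own path; every other one
has there the value 0 or a multiple of a different character. -/
theorem linearIndependent_normalBasis (hn : 1 ≤ n) {inv : UT F n →ₗ[F] UT F n}
    (hinv : IsHomogeneousInvolution (elemGrading F (fineSeq n)) (genStar n) inv) {ε : F}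
    (hε : ε ≠ 0) {β : Set (Word (FG n))} (hβ : IsLeadingBasis F ε β) :
    LinearIndependent F (fun w : normalBasis F β =>
      (gradedStarIdentities (genStar n) (elemGrading F (fineSeq n)) inv).mkQ (mono F w.val)) := by
  rw [linearIndependent_iff_notMem_span]
  rintro ⟨w, t, z, ω, hred, hw, hz⟩
  obtain ⟨v, hv, hv0⟩ := hred.exists_isVertexSeq hn
  obtain ⟨c, hc, heq⟩ := evalEntry_normalLetters hinv ω (hw ▸ w.toList_ne_nil) hv
  rw [← hw, lmono_toList] at heq
  have himg : (fun w : normalBasis F β =>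
      (gradedStarIdentities (genStar n) (elemGrading F (fineSeq n)) inv).mkQ (mono F w.val)) ''
      (Set.univ \ {⟨w, t, z, ω, hred, hw, hz⟩}) =
      (gradedStarIdentities (genStar n) (elemGrading F (fineSeq n)) inv).mkQ ''
        (mono F '' {w' | w' ∈ normalBasis F β ∧ w' ≠ w}) := by
    rw [Set.image_image]
    ext x
    constructor
    · rintro ⟨w', hw', rfl⟩
      exact ⟨w'.1, ⟨w'.2, fun h => hw'.2 (Subtype.ext h)⟩, rfl⟩
    · rintro ⟨w', hw', rfl⟩
      exact ⟨⟨w', hw'.1⟩, ⟨Set.mem_univ _, fun h => hw'.2 (congrArg Subtype.val h)⟩, rfl⟩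
  rw [himg]
  refine mkQ_notMem_span_of_evalEntry hinv le_rfl _ _ hc heq ?_
  rintro _ ⟨w', ⟨⟨t', z', ω', hred', hw', hz'⟩, hne⟩, rfl⟩
  obtain ⟨v', hv', hv0'⟩ := hred'.exists_isVertexSeq hn
  have hdeg : listDeg (genStar n) w'.toList =
      elemDeg (fineSeq n) (v' 0) (v' (Fin.last t')) := by
    rw [hw', ← listDeg_zPart, zPart_normalLetters hred'.nontrivial, hv'.isPath.listDeg_eq]
  by_cases hd : elemDeg (fineSeq n) (v' 0) (v' (Fin.last t')) =
      elemDeg (fineSeq n) (v 0) (v (Fin.last t))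
  · right
    have hlt : ∀ {t : ℕ} {v : Fin (t + 1) → Fin n} {z : Fin t → Letter (FG n)},
        IsVertexSeq z v → t ≠ 0 → v 0 < v (Fin.last t) := fun {t} v z hv ht =>
      hv.strictMono (Fin.lt_def.2 (Nat.pos_of_ne_zero ht))
    -- Equal degrees mean equal ends if the path is nonempty. Trivial degree means t = 0 for both
    -- monomials, and then both vertices are 0 by choice.
    have hends : v' 0 = v 0 ∧ v' (Fin.last t') = v (Fin.last t) ∧ (t = 0 ↔ t' = 0) := by
      by_cases ht : t = 0
      · subst ht
        rw [show Fin.last 0 = (0 : Fin 1) from rfl, elemDeg_self] at hd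
        have ht' : t' = 0 := by
          by_contra h
          exact elemDeg_ne_one (hlt hv' h) hd
        subst ht'
        have : v' 0 = v 0 := Fin.ext ((hv0' rfl).trans (hv0 rfl).symm)
        exact ⟨this, this, by simp⟩
      · have h1 := elemDeg_inj (hlt hv ht) hd.symm
        refine ⟨h1.1, h1.2, iff_of_false ht ?_⟩
        rintro rfl
        exact (hlt hv ht).ne (h1.1.symm.trans h1.2)
    obtain ⟨c', hc', heq'⟩ := evalEntry_normalLetters hinv ω' (hw' ▸ w'.toList_ne_nil) hv'
    rw [← hw', lmono_toList, hends.1, hends.2.1] at heq'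
    refine ⟨_, c', fun hχ => hne ?_, heq'⟩
    -- Equal characters have the same variables of nontrivial degree, and elements of β with equal
    -- ends and variables coincide.
    have hlist : List.ofFn z' = List.ofFn z := by
      rcases hz with ht | ⟨u, hu, huz⟩
      · have ht' := hends.2.2.1 ht
        subst ht ht'
        simp
      · have ht : t ≠ 0 := by
          rintro rfl
          exact u.toList_ne_nil (by simpa using huz)
        rcases hz' with ht' | ⟨u', hu', huz'⟩
        · exact absurd (hends.2.2.2 ht') ht
        · have hvs := varSet_eq_of_normalHom_eq hχ
          have hp := hv.isPath
          have hp' := hv'.isPath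
          rw [hends.1, hends.2.1] at hp'
          rw [← huz, ← huz'] at hvs
          rw [← huz] at hp
          rw [← huz'] at hp'
          rw [← huz, ← huz', eq_of_mem_leadingBasis hε hβ hu' hu hp' hp hvs]
    have htt : t' = t := by simpa using congrArg List.length hlist
    subst htt
    obtain rfl : z' = z := List.ofFn_injective hlist
    obtain rfl : v' = v := hv'.unique hv hends.1
    obtain rfl : ω' = ω := eq_of_normalHom_eq hred' hred hv hv0 hχ
    exact Word.toList_injective (hw'.trans hw.symm)
  · left
    rw [← lmono_toList]
    exact evalEntry_eq_zero_of_deg_ne hinv _ _ (hdeg ▸ hd)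

/-- An identity is, modulo the generated ideal, a combination of normal monomials; these are
independent even modulo all identities, so the combination is zero. β occurs only as an auxiliary
choice. -/
theorem gradedStarIdentities_eq_genTIdeal (hn : 1 ≤ n) {inv : UT F n →ₗ[F] UT F n}
    (hinv : IsHomogeneousInvolution (elemGrading F (fineSeq n)) (genStar n) inv) {ε : F}
    (hε : (ε = 1 ∧ IsOrthogonal inv) ∨ (ε = -1 ∧ IsSymplectic inv)) :
    gradedStarIdentities (genStar n) (elemGrading F (fineSeq n)) inv = genTIdeal F n ε := by
  have hε0 : ε ≠ 0 := left_ne_zero_of_mul (sign_mul_sign hε ▸ one_ne_zero)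
  have hle := genTIdeal_le_gradedStarIdentities hinv hε
  refine le_antisymm (fun f hf => ?_) hle
  obtain ⟨β, hβ⟩ := exists_isLeadingBasis F n hn ε
  have hli := linearIndependent_normalBasis hn hinv hε0 hβ
  have hmem : (genTIdeal F n ε).mkQ f ∈ Submodule.span F (Set.range fun w : normalBasis F β =>
      (genTIdeal F n ε).mkQ (mono F w.val)) := by
    rw [span_normalBasis hn hinv hε hβ]; trivial
  obtain ⟨l, hl⟩ := (Finsupp.mem_span_range_iff_exists_finsupp).1 hmem
  let Φ := (genTIdeal F n ε).mapQ
    (gradedStarIdentities (genStar n) (elemGrading F (fineSeq n)) inv) LinearMap.id hle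
  have h1 := congrArg Φ hl
  have h2 : Φ ((genTIdeal F n ε).mkQ f) = 0 :=
    (Submodule.Quotient.mk_eq_zero _).2 hf
  rw [h2, Finsupp.sum, map_sum] at h1
  have h3 : l = 0 := by
    refine (linearIndependent_iff.1 hli) l ?_
    rw [Finsupp.linearCombination_apply, Finsupp.sum, ← h1]
    exact Finset.sum_congr rfl fun w _ => by rw [map_smul]; rfl
  rw [h3, Finsupp.sum_zero_index] at hl
  exact (Submodule.Quotient.mk_eq_zero _).1 hl.symm

end Main

theorem mainTheorem1 {F : Type*} [Field F] (n : ℕ) (hn : 1 ≤ n)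
    (inv : UT F n →ₗ[F] UT F n)
    (hinv : IsHomogeneousInvolution (elemGrading F (fineSeq n)) (genStar n) inv)
    (ε : F) (hε : (ε = 1 ∧ IsOrthogonal inv) ∨ (ε = -1 ∧ IsSymplectic inv)) :
    gradedStarIdentities (genStar n) (elemGrading F (fineSeq n)) inv = genTIdeal F n ε ∧
    ∀ β : Set (Word (FG n)), IsLeadingBasis F ε β →
      LinearIndependent F (fun w : normalBasis F β =>
        (gradedStarIdentities (genStar n) (elemGrading F (fineSeq n)) inv).mkQ (mono F w.val)) ∧
      Submodule.span F (Set.range fun w : normalBasis F β =>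
        (gradedStarIdentities (genStar n) (elemGrading F (fineSeq n)) inv).mkQ
          (mono F w.val)) = ⊤ := by
  have hε0 : ε ≠ 0 := left_ne_zero_of_mul (sign_mul_sign hε ▸ one_ne_zero)
  have heq := gradedStarIdentities_eq_genTIdeal hn hinv hε
  refine ⟨heq, fun β hβ => ⟨linearIndependent_normalBasis hn hinv hε0 hβ, ?_⟩⟩
  rw [heq]
  exact span_normalBasis hn hinv hε hβ
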